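/- For a Dirichlet character $\chi$ modulo $q\ge 1$ write $\chi_0$ for the principal character modulo $q$, let $\rho_\chi$ run over the nontrivial zeros of $L(s,\chi)$ (the zeros with $0<\Re s<1$), counted with multiplicity, and let $z(\chi)$ be the order of vanishing of $L(s,\chi)$ at $s=\frac12$. Sums over zeros are understood as $\sum_{\rho_\chi\notin\mathbb R}=\lim_{T\to\infty}\sum_{\rho_\chi\notin\mathbb R,\ |\Im\rho_\chi|\le T}$. Let $\frac12<\eta<1$. Assume the Generalized Riemann Hypothesis (for every $q\ge1$ and every $\chi \bmod q$, all zeros of $L(s,\chi)$ with $0<\Re s<1$ satisfy $\Re s=\frac12$), and assume the Modified Montgomery Conjecture with parameter $\eta$: for every $\epsilon>0$, uniformly for real $x\ge 1$, integers $1\le q\le x^{\eta}$ and integers $a$ with $(a,q)=1$, $$\frac1{\phi(q)}\sum_{\substack{\chi \bmod q\\ \chi\neq\chi_0}}\overline{\chi}(a)\sum_{\rho_\chi\notin\mathbb R}\frac{x^{\rho_\chi}}{\rho_\chi}\ll_\epsilon\frac{x^{\frac12+\epsilon}}{q^{\frac12}}.$$ Then for every $\epsilon>0$ and all real $Q\ge1$,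 $$\frac1{Q^2}\sum_{q\le Q}\ \sum_{\chi \bmod q}z(\chi)\ll_\epsilon\frac1{Q^{\frac12-\epsilon}}.$$ -/

import Mathlib

open Filter Topology

noncomputable section

namespace DirichletNonvanishing

instance fintypeCharacters (q : ℕ) [NeZero q] : Fintype (DirichletCharacter ℂ q) :=
  Fintype.ofFinite _

/-- The generalized Riemann hypothesis: for every Dirichlet character (primitive or not,
principal or not), every zero of `L(s, χ)` in the open critical strip has real part `1/2`. -/
def GRH : Prop :=
  ∀ (q : ℕ) [NeZero q] (χ : DirichletCharacter ℂ q) (s : ℂ),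
    0 < s.re → s.re < 1 → χ.LFunction s = 0 → s.re = 1 / 2

/-- The nontrivial zeros `ρ` of `L(s, χ)` with `ρ ∉ ℝ` and `|Im ρ| ≤ T`. -/
def nonrealZeros {q : ℕ} [NeZero q] (χ : DirichletCharacter ℂ q) (T : ℝ) : Set ℂ :=
  {ρ | χ.LFunction ρ = 0 ∧ 0 < ρ.re ∧ ρ.re < 1 ∧ ρ.im ≠ 0 ∧ |ρ.im| ≤ T}

/-- The sums over `nonrealZeros χ T` used below are finite sums. -/
theorem finite_nonrealZeros {q : ℕ} [NeZero q] {χ : DirichletCharacter ℂ q} (hχ : χ ≠ 1)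
    (T : ℝ) : (nonrealZeros χ T).Finite := by
  have han : AnalyticOnNhd ℂ χ.LFunction Set.univ :=
    (DirichletCharacter.differentiable_LFunction hχ).differentiableOn.analyticOnNhd isOpen_univ
  have hne : χ.LFunction 2 ≠ 0 :=
    DirichletCharacter.LFunction_ne_zero_of_one_le_re χ (Or.inl hχ) (by norm_num)
  have hcod := han.preimage_zero_mem_codiscrete hne
  have hK : IsCompact (Set.Icc (0 : ℝ) 1 ×ℂ Set.Icc (-T) T) := isCompact_Icc.reProdIm isCompact_Icc
  have hfin : ((Set.Icc (0 : ℝ) 1 ×ℂ Set.Icc (-T) T) \ (χ.LFunction ⁻¹' {0}ᶜ)).Finite :=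
    hK.finite_sdiff_of_mem_codiscreteWithin (Filter.codiscreteWithin_mono (Set.subset_univ _) hcod)
  refine hfin.subset ?_
  rintro ρ ⟨h0, h1, h2, -, h3⟩
  refine ⟨?_, by simpa using h0⟩
  rw [Complex.mem_reProdIm]
  exact ⟨⟨h1.le, h2.le⟩, abs_le.mp h3⟩

/-- `∑ x ^ ρ / ρ` over the nonreal nontrivial zeros `ρ` of `L(s, χ)` with `|Im ρ| ≤ T`,
counted with multiplicity. -/
def truncatedZeroSum {q : ℕ} [NeZero q] (χ : DirichletCharacter ℂ q) (x T : ℝ) : ℂ :=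
  ∑ᶠ ρ ∈ nonrealZeros χ T, (analyticOrderNatAt χ.LFunction ρ : ℂ) * ((x : ℂ) ^ ρ / ρ)

/-- `S` is the value of `∑_{ρ ∉ ℝ} x ^ ρ / ρ`, which, as usual in explicit formulas, is
the limit as `T → ∞` of the sums over `|Im ρ| ≤ T`. -/
def IsNonrealZeroSum {q : ℕ} [NeZero q] (χ : DirichletCharacter ℂ q) (x : ℝ) (S : ℂ) : Prop :=
  Tendsto (fun T : ℝ => truncatedZeroSum χ x T) atTop (𝓝 S)

open Classical in
/-- The Modified Montgomery Conjecture with parameter `η`. The function `S` is determined at all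
the characters that occur, since limits are unique. -/
def ModifiedMontgomery (η : ℝ) : Prop :=
  ∀ ε : ℝ, 0 < ε → ∃ C : ℝ, ∀ (q : ℕ) [NeZero q] (x : ℝ), 1 ≤ x → (q : ℝ) ≤ x ^ η →
    ∀ (a : (ZMod q)ˣ) (S : DirichletCharacter ℂ q → ℂ),
      (∀ χ : DirichletCharacter ℂ q, χ ≠ 1 → IsNonrealZeroSum χ x (S χ)) →
      ‖(1 / (q.totient : ℂ)) * ∑ χ : DirichletCharacter ℂ q with χ ≠ 1,
          (starRingEnd ℂ) (χ (a : ZMod q)) * S χ‖ ≤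
        C * (x ^ (1 / 2 + ε) / (q : ℝ) ^ (1 / 2 : ℝ))

/-- The order of vanishing of `L(s, χ)` at `s = 1/2`. -/
def z {q : ℕ} [NeZero q] (χ : DirichletCharacter ℂ q) : ℕ :=
  analyticOrderNatAt χ.LFunction (1 / 2)

end DirichletNonvanishing

end

/-! A zero at `1/2` shows up as a deficit of primes congruent to 1 modulo `q`. In the explicit
formula for `ψ(x, χ)` such a zero, of order `z χ`, contributes `-2 z(χ) √x`. Average over the
nonprincipal `χ` mod `q` (orthogonality at `a = 1`) and bound the nonreal zeros by the Montgomery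
hypothesis. With `M(q)` the mean of `z χ` (`meanOrder`), the sum of `Λ(n)` over `A < n ≤ B`, `q ∣ n
- 1`, is the full sum divided by `φ(q)`, minus about `2 (√B - √A) M(q)`, up to `O(B^(1/2+ε)
q^(-1/2))`. This is `exists_primes_one_mod_bound`.

Now let `q` run over `(Q, 2Q]` and `n` over `(x, 2x]` with `x = Qr`, and write `n - 1 = q m`. The
same pairs can be counted through the complementary divisor `m ≤ 2r` (`sum_primes_switch`). The main
terms of the two counts agree up to a small error, because the sum of `1/φ(m)` over `y ≤ m < 2y` is
a constant plus `O(y^(-1/2+δ))` (`exists_sum_inv_totient_dyadic`). Since `M ≥ 0`, comparing deficits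
bounds the sum of `M(q)` over `(Q, 2Q]` by the sum of `M(m)` over `m ≤ 2r`, plus an error
(`exists_dyadic_inequality`). Taking `r` near `Q/64` gives `x ≍ Q^2`. The moduli then have size
about `x^(1/2)`, which is why `η > 1/2` is needed, and the error is `O(Q^(1/2+3δ))`
(`exists_recursion`). Since `2r` is much smaller than `Q`, the recursion closes by induction
(`exists_sum_meanOrder_le`). Multiplying by `φ(q) ≤ Q` gives the theorem; the principal characters
add the same constant for each `q`.

The explicit formula comes from integrating the logarithmic derivative of the completed `L`-function
of a primitive character against `x^s/s` around a rectangle with `-1/2 ≤ Re s ≤ 3/2`. Perron's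
formula evaluates the right side, the functional equation sends the left side back to `Re s = 3/2`,
and the gamma factor costs only `O(x^(1/8))`, uniformly in `χ`. A constant depending on `χ` is never
estimated: it cancels when the formula is differenced between `A` and `B`. Bounds with constants
depending on `χ` serve only to let the height of the rectangle tend to infinity. -/

open Filter Topology

noncomputable section

namespace DirichletNonvanishing

/-! ### Cauchy's theorem and integral formula on rectangles. -/

section RectangleIntegrals

open Complex MeasureTheory intervalIntegral

/-- The integral of `f` over the boundary of `[a, b] × [c, d]`, counterclockwise. -/
def rectIntegral (f : ℂ → ℂ) (a b c d : ℝ) : ℂ :=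
  (∫ x : ℝ in a..b, f (x + c * I)) - (∫ x : ℝ in a..b, f (x + d * I)) +
    I * (∫ y : ℝ in c..d, f (b + y * I)) - I * (∫ y : ℝ in c..d, f (a + y * I))

/-- The boundary of the rectangle `[a, b] × [c, d]`. -/
def rectBoundary (a b c d : ℝ) : Set ℂ :=
  {s | s.re ∈ Set.Icc a b ∧ s.im ∈ Set.Icc c d ∧ (s.re = a ∨ s.re = b ∨ s.im = c ∨ s.im = d)}

variable {a b c d : ℝ}

theorem rectBoundary_intervalIntegrable (hab : a ≤ b) (hcd : c ≤ d) {f : ℂ → ℂ}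
    (hf : ContinuousOn f (rectBoundary a b c d)) :
    IntervalIntegrable (fun x : ℝ => f (x + c * I)) volume a b ∧
    IntervalIntegrable (fun x : ℝ => f (x + d * I)) volume a b ∧
    IntervalIntegrable (fun y : ℝ => f (b + y * I)) volume c d ∧
    IntervalIntegrable (fun y : ℝ => f (a + y * I)) volume c d := by
  refine ⟨?_, ?_, ?_, ?_⟩ <;>
  · apply ContinuousOn.intervalIntegrable
    rw [Set.uIcc_of_le (by assumption)]
    refine hf.comp (by fun_prop) fun x hx => ?_
    have h1 := hx.1
    have h2 := hx.2
    simp [rectBoundary, *]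

theorem rectIntegral_add (hab : a ≤ b) (hcd : c ≤ d) {f g : ℂ → ℂ}
    (hf : ContinuousOn f (rectBoundary a b c d)) (hg : ContinuousOn g (rectBoundary a b c d)) :
    rectIntegral (fun s => f s + g s) a b c d = rectIntegral f a b c d + rectIntegral g a b c d := by
  obtain ⟨f1, f2, f3, f4⟩ := rectBoundary_intervalIntegrable hab hcd hf
  obtain ⟨g1, g2, g3, g4⟩ := rectBoundary_intervalIntegrable hab hcd hg
  simp only [rectIntegral]
  rw [integral_add f1 g1, integral_add f2 g2, integral_add f3 g3, integral_add f4 g4]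
  ring

theorem rectIntegral_const_mul (k : ℂ) (f : ℂ → ℂ) :
    rectIntegral (fun s => k * f s) a b c d = k * rectIntegral f a b c d := by
  simp only [rectIntegral, intervalIntegral.integral_const_mul]
  ring

theorem rectIntegral_congr (hab : a ≤ b) (hcd : c ≤ d) {f g : ℂ → ℂ}
    (h : Set.EqOn f g (rectBoundary a b c d)) :
    rectIntegral f a b c d = rectIntegral g a b c d := by
  have key : ∀ (γ : ℝ → ℂ) (p q : ℝ), p ≤ q → (∀ x ∈ Set.Icc p q, γ x ∈ rectBoundary a b c d) →
      ∫ x in p..q, f (γ x) = ∫ x in p..q, g (γ x) := by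
    intro γ p q hpq hγ
    apply intervalIntegral.integral_congr
    intro x hx
    rw [Set.uIcc_of_le hpq] at hx
    exact h (hγ x hx)
  simp only [rectIntegral]
  rw [key (fun x => x + c * I) a b hab, key (fun x => x + d * I) a b hab,
    key (fun y => b + y * I) c d hcd, key (fun y => a + y * I) c d hcd] <;>
  · intro x hx
    have h1 := hx.1
    have h2 := hx.2
    simp [rectBoundary, *]

theorem rectIntegral_sum (hab : a ≤ b) (hcd : c ≤ d) {ι : Type*} (s : Finset ι) (f : ι → ℂ → ℂ)
    (hf : ∀ i ∈ s, ContinuousOn (f i) (rectBoundary a b c d)) :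
    rectIntegral (fun z => ∑ i ∈ s, f i z) a b c d = ∑ i ∈ s, rectIntegral (f i) a b c d := by
  classical
  induction s using Finset.induction_on with
  | empty => simp [rectIntegral]
  | insert i s hi ih =>
    have h1 : ∀ j ∈ s, ContinuousOn (f j) (rectBoundary a b c d) :=
      fun j hj => hf j (Finset.mem_insert_of_mem hj)
    simp only [Finset.sum_insert hi]
    rw [rectIntegral_add hab hcd (hf i (Finset.mem_insert_self _ _)) (continuousOn_finsetSum s h1),
      ih h1]

theorem rectIntegral_eq_zero (hab : a ≤ b) (hcd : c ≤ d) {f : ℂ → ℂ}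
    (hf : DifferentiableOn ℂ f (Set.Icc a b ×ℂ Set.Icc c d)) : rectIntegral f a b c d = 0 := by
  have := integral_boundary_rect_eq_zero_of_differentiableOn f (a + c * I) (b + d * I)
    (by simpa [Set.uIcc_of_le hab, Set.uIcc_of_le hcd] using hf)
  simpa [rectIntegral] using this

theorem rectBoundary_subset : rectBoundary a b c d ⊆ Set.Icc a b ×ℂ Set.Icc c d :=
  fun _ h => ⟨h.1, h.2.1⟩

theorem ne_of_mem_rectBoundary {p : ℂ} (h1 : a < p.re) (h2 : p.re < b) (h3 : c < p.im)
    (h4 : p.im < d) {s : ℂ} (hs : s ∈ rectBoundary a b c d) : s ≠ p := by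
  rintro rfl
  rcases hs.2.2 with h | h | h | h <;> linarith

/-- Integral of `1 / (s - p)` along a segment in the slit plane around `p`. -/
theorem integral_segment_inv_sub {p v w : ℂ} {x y : ℝ} (hxy : x ≤ y)
    (h : ∀ t ∈ Set.Icc x y, v + t * w - p ∈ slitPlane) :
    w * ∫ t : ℝ in x..y, (v + t * w - p)⁻¹ = log (v + y * w - p) - log (v + x * w - p) := by
  rw [← intervalIntegral.integral_const_mul]
  refine intervalIntegral.integral_eq_sub_of_hasDerivAt (f := fun t : ℝ => log (v + t * w - p))
    ?_ ?_
  · intro t ht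
    rw [Set.uIcc_of_le hxy] at ht
    have h1 : HasDerivAt (fun t : ℝ => v + (t : ℂ) * w - p) w t := by
      simpa using ((((hasDerivAt_id (t : ℂ)).comp_ofReal).mul_const w).const_add v).sub_const p
    simpa [div_eq_mul_inv] using h1.clog_real (h t ht)
  · apply ContinuousOn.intervalIntegrable
    rw [Set.uIcc_of_le hxy]
    refine continuousOn_const.mul (ContinuousOn.inv₀ (by fun_prop) ?_)
    exact fun t ht => slitPlane_ne_zero (h t ht)

/-- On three sides `log (s - p)` is a primitive. The left side crosses the branch cut, so there `log
(p - s)` is used instead. It differs from `log (s - p)` by `-πi` above the cut and `πi` below it,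
and these two jumps make up the value `2πi`. -/
theorem rectIntegral_inv_sub {p : ℂ} (h1 : a < p.re) (h2 : p.re < b) (h3 : c < p.im)
    (h4 : p.im < d) : rectIntegral (fun s => (s - p)⁻¹) a b c d = 2 * Real.pi * I := by
  have hab : a ≤ b := by linarith
  have hcd : c ≤ d := by linarith
  have e1 := integral_segment_inv_sub (p := p) (v := c * I) (w := 1) hab (fun t _ => by
    right; simp; linarith)
  have e2 := integral_segment_inv_sub (p := p) (v := d * I) (w := 1) hab (fun t _ => by
    right; simp; linarith)
  have e3 := integral_segment_inv_sub (p := p) (v := b) (w := I) hcd (fun t _ => by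
    left; simp; linarith)
  have e4 := integral_segment_inv_sub (p := -p) (v := -a) (w := -I) hcd (fun t _ => by
    left; simp; linarith)
  have e4' : ∫ t : ℝ in c..d, (-(a : ℂ) + t * -I - -p)⁻¹ = - ∫ t : ℝ in c..d, ((a : ℂ) + t * I - p)⁻¹ := by
    rw [← intervalIntegral.integral_neg]
    congr 1
    ext t
    rw [← inv_neg]
    congr 1
    ring
  have l1 : log (-(a : ℂ) + d * -I - -p) = log (a + d * I - p) - Real.pi * I := by
    rw [show -(a : ℂ) + d * -I - -p = -(a + d * I - p) by ring, Complex.log, Complex.log, norm_neg,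
      arg_neg_eq_arg_sub_pi_of_im_pos (by simp; linarith)]
    push_cast
    ring
  have l2 : log (-(a : ℂ) + c * -I - -p) = log (a + c * I - p) + Real.pi * I := by
    rw [show -(a : ℂ) + c * -I - -p = -(a + c * I - p) by ring, Complex.log, Complex.log, norm_neg,
      arg_neg_eq_arg_add_pi_of_im_neg (by simp; linarith)]
    push_cast
    ring
  rw [e4', l1, l2] at e4
  simp only [mul_one, one_mul] at e1 e2
  simp only [rectIntegral]
  have c1 : ∀ e : ℝ, ∫ t : ℝ in a..b, ((t : ℂ) + e * I - p)⁻¹ = ∫ t : ℝ in a..b, (e * I + t - p)⁻¹ :=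
    fun e => by congr 1; ext t; rw [add_comm]
  rw [c1, c1, e1, e2, e3]
  have : I * ∫ t : ℝ in c..d, ((a : ℂ) + t * I - p)⁻¹ =
      log (a + d * I - p) - Real.pi * I - (log (a + c * I - p) + Real.pi * I) := by
    rw [← e4]; ring
  rw [this, add_comm (d * I : ℂ) b, add_comm (c * I : ℂ) b, add_comm (d * I : ℂ) a,
    add_comm (c * I : ℂ) a]
  ring

/-- Cauchy's integral formula for rectangles. -/
theorem rectIntegral_div_sub {p : ℂ} (h1 : a < p.re) (h2 : p.re < b) (h3 : c < p.im)
    (h4 : p.im < d) {h : ℂ → ℂ} (hh : DifferentiableOn ℂ h (Set.Icc a b ×ℂ Set.Icc c d)) :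
    rectIntegral (fun s => h s / (s - p)) a b c d = 2 * Real.pi * I * h p := by
  have hab : a ≤ b := by linarith
  have hcd : c ≤ d := by linarith
  have hnhds : (Set.Icc a b ×ℂ Set.Icc c d) ∈ 𝓝 p :=
    mem_of_superset ((isOpen_Ioo.reProdIm isOpen_Ioo).mem_nhds (show p ∈ Set.Ioo a b ×ℂ Set.Ioo c d
      from ⟨⟨h1, h2⟩, ⟨h3, h4⟩⟩)) (fun s hs => ⟨Set.Ioo_subset_Icc_self hs.1,
        Set.Ioo_subset_Icc_self hs.2⟩)
  -- Split `h s / (s - p)` into the difference quotient, whose singularity at `p` is removable, and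
  -- `h p / (s - p)`.
  have hd : DifferentiableOn ℂ (dslope h p) (Set.Icc a b ×ℂ Set.Icc c d) :=
    (Complex.differentiableOn_dslope hnhds).2 hh
  have hc : ContinuousOn (fun s => h p * (s - p)⁻¹) (rectBoundary a b c d) :=
    continuousOn_const.mul (ContinuousOn.inv₀ (by fun_prop) fun s hs =>
      sub_ne_zero.2 (ne_of_mem_rectBoundary h1 h2 h3 h4 hs))
  rw [rectIntegral_congr hab hcd (g := fun s => dslope h p s + h p * (s - p)⁻¹),
    rectIntegral_add hab hcd (hd.continuousOn.mono rectBoundary_subset) hc,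
    rectIntegral_eq_zero hab hcd hd, rectIntegral_const_mul, rectIntegral_inv_sub h1 h2 h3 h4]
  · ring
  · intro s hs
    have hne := ne_of_mem_rectBoundary h1 h2 h3 h4 hs
    have : s - p ≠ 0 := sub_ne_zero.2 hne
    simp only [dslope_of_ne _ hne, slope_def_field]
    field_simp
    ring

end RectangleIntegrals

/-! ### Zeros of entire functions: residues and size of the logarithmic derivative. -/

section ArgumentPrinciple

open Complex MeasureTheory intervalIntegral

theorem analyticOrderAt_ne_top_of_entire {f : ℂ → ℂ} (hf : Differentiable ℂ f) {w : ℂ}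
    (hw : f w ≠ 0) (z : ℂ) : analyticOrderAt f z ≠ ⊤ := by
  intro h
  rw [analyticOrderAt_eq_top] at h
  have han : AnalyticOnNhd ℂ f Set.univ := hf.differentiableOn.analyticOnNhd isOpen_univ
  exact hw (han.eqOn_zero_of_preconnected_of_eventuallyEq_zero isPreconnected_univ
    (Set.mem_univ z) h (Set.mem_univ w))

theorem finite_zeros_of_entire {f : ℂ → ℂ} (hf : Differentiable ℂ f) {w : ℂ} (hw : f w ≠ 0)
    {K : Set ℂ} (hK : IsCompact K) : {z ∈ K | f z = 0}.Finite := by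
  have han : AnalyticOnNhd ℂ f Set.univ := hf.differentiableOn.analyticOnNhd isOpen_univ
  have hcod := han.preimage_zero_mem_codiscrete hw
  refine (hK.finite_sdiff_of_mem_codiscreteWithin
    (codiscreteWithin_mono (Set.subset_univ K) hcod)).subset ?_
  rintro z ⟨h1, h2⟩
  exact ⟨h1, by simpa using h2⟩

theorem exists_eq_pow_mul {f : ℂ → ℂ} (hf : Differentiable ℂ f) {w : ℂ} (hw : f w ≠ 0) (p : ℂ) :
    ∃ g : ℂ → ℂ, Differentiable ℂ g ∧ g p ≠ 0 ∧
      ∀ s, f s = (s - p) ^ analyticOrderNatAt f p * g s := by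
  obtain ⟨g, hg, hgp, hfg⟩ := (hf.analyticAt p).analyticOrderAt_ne_top.1
    (analyticOrderAt_ne_top_of_entire hf hw p)
  set n := analyticOrderNatAt f p
  refine ⟨Function.update (fun s => f s / (s - p) ^ n) p (g p), ?_, by simpa using hgp, ?_⟩
  · intro s
    rcases eq_or_ne s p with rfl | hs
    · have : Function.update (fun z => f z / (z - s) ^ n) s (g s) =ᶠ[𝓝 s] g := by
        filter_upwards [hfg] with z hz
        rcases eq_or_ne z s with rfl | hzs
        · simp
        · rw [Function.update_of_ne hzs, hz, smul_eq_mul,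
            mul_div_cancel_left₀ _ (pow_ne_zero _ (sub_ne_zero.2 hzs))]
      exact this.differentiableAt_iff.2 hg.differentiableAt
    · have : Function.update (fun z => f z / (z - p) ^ n) p (g p) =ᶠ[𝓝 s]
          fun z => f z / (z - p) ^ n := by
        filter_upwards [isOpen_ne.mem_nhds hs] with z hz
        rw [Function.update_of_ne hz]
      refine this.differentiableAt_iff.2 ?_
      exact (hf s).div (by fun_prop) (pow_ne_zero _ (sub_ne_zero.2 hs))
  · intro s
    rcases eq_or_ne s p with rfl | hs
    · simpa using hfg.self_of_nhds
    · rw [Function.update_of_ne hs, mul_div_cancel₀ _ (pow_ne_zero _ (sub_ne_zero.2 hs))]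

/-- Zeros are divided out one at a time; factors belonging to other points do not change the order
at `p`. -/
theorem exists_eq_prod_mul {f : ℂ → ℂ} (hf : Differentiable ℂ f) {w : ℂ} (hw : f w ≠ 0)
    (Z : Finset ℂ) : ∃ g : ℂ → ℂ, Differentiable ℂ g ∧ (∀ p ∈ Z, g p ≠ 0) ∧
      ∀ s, f s = (∏ p ∈ Z, (s - p) ^ analyticOrderNatAt f p) * g s := by
  induction Z using Finset.induction_on with
  | empty => exact ⟨f, hf, by simp, by simp⟩
  | insert p Z hp ih =>
    obtain ⟨g, hg, hgZ, hfg⟩ := ih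
    have hgw : g w ≠ 0 := fun h => hw (by rw [hfg, h, mul_zero])
    obtain ⟨k, hk, hkp, hgk⟩ := exists_eq_pow_mul hg hgw p
    have hP : Differentiable ℂ fun s => ∏ q ∈ Z, (s - q) ^ analyticOrderNatAt f q := by fun_prop
    have hord : analyticOrderNatAt f p = analyticOrderNatAt g p := by
      have h1 : f = (fun s => ∏ q ∈ Z, (s - q) ^ analyticOrderNatAt f q) * g := funext hfg
      have h2 : analyticOrderAt (fun s => ∏ q ∈ Z, (s - q) ^ analyticOrderNatAt f q) p = 0 := by
        rw [(hP.analyticAt p).analyticOrderAt_eq_zero, Finset.prod_ne_zero_iff]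
        intro q hq
        refine pow_ne_zero _ (sub_ne_zero.2 ?_)
        rintro rfl
        exact hp hq
      rw [analyticOrderNatAt, analyticOrderNatAt]
      conv_lhs => rw [h1]
      rw [analyticOrderAt_mul (hP.analyticAt p) (hg.analyticAt p), h2, zero_add]
    refine ⟨k, hk, ?_, fun s => ?_⟩
    · intro q hq
      rcases Finset.mem_insert.1 hq with rfl | hq
      · exact hkp
      · exact fun h => hgZ q hq (by rw [hgk, h, mul_zero])
    · rw [Finset.prod_insert hp, hfg s, hgk s, hord]
      ring

theorem logDeriv_eq_sum_add {f g : ℂ → ℂ} (hg : Differentiable ℂ g) {Z : Finset ℂ} {m : ℂ → ℕ}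
    (hfg : ∀ s, f s = (∏ p ∈ Z, (s - p) ^ m p) * g s) {s : ℂ} (hs : s ∉ Z) (hgs : g s ≠ 0) :
    logDeriv f s = ∑ p ∈ Z, (m p : ℂ) / (s - p) + logDeriv g s := by
  have hne : ∀ p ∈ Z, (s - p) ^ m p ≠ 0 := by
    intro p hp
    refine pow_ne_zero _ (sub_ne_zero.2 ?_)
    rintro rfl
    exact hs hp
  rw [show f = fun s => (∏ p ∈ Z, (s - p) ^ m p) * g s from funext hfg,
    logDeriv_mul s (Finset.prod_ne_zero_iff.2 hne) hgs (by fun_prop) (hg s)]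
  congr 1
  rw [logDeriv_prod hne (fun p _ => by fun_prop)]
  refine Finset.sum_congr rfl fun p _ => ?_
  rw [logDeriv_fun_pow (by fun_prop)]
  simp [logDeriv_apply, div_eq_mul_inv]

/-- The residue theorem for `logDeriv f s * (g s / s)` on a rectangle around the origin. -/
theorem rectIntegral_logDeriv_mul {a b c d : ℝ} (ha : a < 0) (hb : 0 < b) (hc : c < 0) (hd : 0 < d)
    {f g : ℂ → ℂ} (hf : Differentiable ℂ f) (hg : Differentiable ℂ g) (hf0 : f 0 ≠ 0)
    (Z : Finset ℂ) (hZ : ∀ p ∈ Z, p ∈ Set.Ioo a b ×ℂ Set.Ioo c d ∧ f p = 0)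
    (hZ' : ∀ p ∈ Set.Icc a b ×ℂ Set.Icc c d, f p = 0 → p ∈ Z) :
    rectIntegral (fun s => logDeriv f s * (g s / s)) a b c d =
      2 * Real.pi * I * (∑ p ∈ Z, (analyticOrderNatAt f p : ℂ) * (g p / p) + logDeriv f 0 * g 0) := by
  have hab : a ≤ b := by linarith
  have hcd : c ≤ d := by linarith
  obtain ⟨h, hh, hhZ, hfh⟩ := exists_eq_prod_mul hf hf0 Z
  have hh0 : ∀ s ∈ Set.Icc a b ×ℂ Set.Icc c d, h s ≠ 0 := by
    intro s hs h0
    exact hhZ s (hZ' s hs (by rw [hfh, h0, mul_zero])) h0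
  have hZ0 : ∀ p ∈ Z, p ≠ 0 := fun p hp h0 => hf0 (h0 ▸ (hZ p hp).2)
  have mem0 : (0 : ℂ) ∈ Set.Icc a b ×ℂ Set.Icc c d := ⟨by simp; constructor <;> linarith,
    by simp; constructor <;> linarith⟩
  have hbd0 : ∀ s ∈ rectBoundary a b c d, s ≠ 0 := fun s hs =>
    ne_of_mem_rectBoundary (by simpa) (by simpa) (by simpa) (by simpa) hs
  have hbdZ : ∀ p ∈ Z, ∀ s ∈ rectBoundary a b c d, s ≠ p := fun p hp s hs =>
    ne_of_mem_rectBoundary (hZ p hp).1.1.1 (hZ p hp).1.1.2 (hZ p hp).1.2.1 (hZ p hp).1.2.2 hs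
  have hld : DifferentiableOn ℂ (fun s => logDeriv h s * g s) (Set.Icc a b ×ℂ Set.Icc c d) := by
    refine DifferentiableOn.mul ?_ hg.differentiableOn
    exact DifferentiableOn.div hh.deriv.differentiableOn hh.differentiableOn hh0
  have hgc : Continuous g := hg.continuous
  have cont0 : ContinuousOn (fun s => g s / (s - 0)) (rectBoundary a b c d) :=
    hgc.continuousOn.div (by fun_prop) (fun s hs => by simpa using hbd0 s hs)
  have contZ : ∀ p ∈ Z, ContinuousOn (fun s => g s / (s - p)) (rectBoundary a b c d) :=
    fun p hp => hgc.continuousOn.div (by fun_prop) (fun s hs => sub_ne_zero.2 (hbdZ p hp s hs))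
  have contld : ContinuousOn (fun s => logDeriv h s * g s / (s - 0)) (rectBoundary a b c d) :=
    (hld.continuousOn.mono rectBoundary_subset).div (by fun_prop)
      (fun s hs => by simpa using hbd0 s hs)
  -- The partial fractions `1/((s-p)s) = (1/p)(1/(s-p) - 1/s)` leave only simple poles. The parts at
  -- `0` later recombine with `logDeriv h 0` into `logDeriv f 0`.
  have e1 : rectIntegral (fun s => logDeriv f s * (g s / s)) a b c d =
      rectIntegral (fun s => (∑ p ∈ Z, ((analyticOrderNatAt f p : ℂ) / p * (g s / (s - p)) +
        (-((analyticOrderNatAt f p : ℂ) / p)) * (g s / (s - 0)))) +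
        logDeriv h s * g s / (s - 0)) a b c d := by
    apply rectIntegral_congr hab hcd
    intro s hs
    have hs0 := hbd0 s hs
    have hsZ : s ∉ Z := fun h => hbdZ s h s hs rfl
    simp only
    rw [logDeriv_eq_sum_add hh hfh hsZ (hh0 s (rectBoundary_subset hs)), add_mul, Finset.sum_mul,
      sub_zero]
    congr 1
    · refine Finset.sum_congr rfl fun p hp => ?_
      have h1 := hZ0 p hp
      have h2 : s - p ≠ 0 := sub_ne_zero.2 (hbdZ p hp s hs)
      field_simp
      ring
    · ring
  have contT : ∀ p ∈ Z, ContinuousOn (fun s => (analyticOrderNatAt f p : ℂ) / p * (g s / (s - p)) +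
        (-((analyticOrderNatAt f p : ℂ) / p)) * (g s / (s - 0))) (rectBoundary a b c d) :=
    fun p hp => (continuousOn_const.mul (contZ p hp)).add (continuousOn_const.mul cont0)
  rw [e1, rectIntegral_add hab hcd (continuousOn_finsetSum _ contT) contld,
    rectIntegral_sum hab hcd _ _ contT,
    rectIntegral_div_sub (by simpa) (by simpa) (by simpa) (by simpa) hld]
  have e2 : ∀ p ∈ Z, rectIntegral (fun s => (analyticOrderNatAt f p : ℂ) / p * (g s / (s - p)) +
        (-((analyticOrderNatAt f p : ℂ) / p)) * (g s / (s - 0))) a b c d =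
      2 * Real.pi * I * ((analyticOrderNatAt f p : ℂ) * (g p / p)) +
      2 * Real.pi * I * ((analyticOrderNatAt f p : ℂ) / (0 - p) * g 0) := by
    intro p hp
    rw [rectIntegral_add hab hcd, rectIntegral_const_mul, rectIntegral_const_mul,
      rectIntegral_div_sub (hZ p hp).1.1.1 (hZ p hp).1.1.2 (hZ p hp).1.2.1 (hZ p hp).1.2.2
        hg.differentiableOn,
      rectIntegral_div_sub (by simpa) (by simpa) (by simpa) (by simpa) hg.differentiableOn]
    · have := hZ0 p hp
      field_simp
      ring
    · exact continuousOn_const.mul (contZ p hp)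
    · exact continuousOn_const.mul cont0
  rw [Finset.sum_congr rfl e2, Finset.sum_add_distrib, ← Finset.mul_sum, ← Finset.mul_sum,
    logDeriv_eq_sum_add hh hfh (fun h => hZ0 0 h rfl) (hh0 0 mem0), ← Finset.sum_mul]
  ring

/-- Jensen's bound for the number of zeros in a disc. -/
theorem sum_analyticOrderNatAt_le {f : ℂ → ℂ} (hf : Differentiable ℂ f) {c : ℂ} (hc : f c ≠ 0)
    {r R M : ℝ} (hr : 0 < r) (hrR : r < R) (hM1 : 1 ≤ M)
    (hM : ∀ z ∈ Metric.closedBall c R, ‖f z‖ ≤ M) (Z : Finset ℂ)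
    (hZ : ∀ p ∈ Z, p ∈ Metric.closedBall c r) :
    (∑ p ∈ Z, (analyticOrderNatAt f p : ℝ)) ≤ Real.log (M / ‖f c‖) / Real.log (R / r) := by
  have hR : 0 < R := hr.trans hrR
  have han : AnalyticOnNhd ℂ f Set.univ := hf.differentiableOn.analyticOnNhd isOpen_univ
  have key := AnalyticOnNhd.sum_divisor_le (c := c) (r := r) (R := R) (M := M) (f := f)
    (by simpa using hr.ne') (by rwa [abs_of_pos hr, abs_of_pos hR]) hM1
    (han.mono (Set.subset_univ _)) hc
    (by rw [abs_of_pos hR]; exact fun z hz => hM z (Metric.sphere_subset_closedBall hz))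
  refine le_trans ?_ key
  rw [abs_of_pos hr]
  have hanr : AnalyticOnNhd ℂ f (Metric.closedBall c r) := han.mono (Set.subset_univ _)
  have hfin := (MeromorphicOn.divisor f (Metric.closedBall c r)).finiteSupport
    (isCompact_closedBall c r)
  classical
  rw [finsum_eq_sum_of_support_subset (s := hfin.toFinset ∪ Z) _ (by
    intro x hx; simp only [Finset.coe_union, Set.Finite.coe_toFinset]; exact Or.inl hx)]
  push_cast
  refine le_trans (le_of_eq ?_) (Finset.sum_le_sum_of_subset_of_nonneg Finset.subset_union_right
    fun i _ _ => by exact_mod_cast MeromorphicOn.AnalyticOnNhd.divisor_nonneg hanr i)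
  refine Finset.sum_congr rfl fun p hp => ?_
  rw [MeromorphicOn.AnalyticOnNhd.divisor_apply hanr (hZ p hp),
    ← Nat.cast_analyticOrderNatAt (analyticOrderAt_ne_top_of_entire hf hc p)]
  simp

/-- If `g` has no zeros in a disc and `‖g‖ ≤ exp K * ‖g c‖` there, then `logDeriv g` is bounded by
a multiple of `K` in smaller discs. -/
theorem norm_logDeriv_le_of_ne_zero {g : ℂ → ℂ} (hg : Differentiable ℂ g) {c : ℂ} {r R K : ℝ}
    (hrR : r < R) (hr : 0 ≤ r) (hK : 0 < K) (hg0 : ∀ z ∈ Metric.ball c R, g z ≠ 0)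
    (hgK : ∀ z ∈ Metric.ball c R, ‖g z‖ ≤ Real.exp K * ‖g c‖) {s : ℂ}
    (hs : s ∈ Metric.closedBall c r) :
    ‖logDeriv g s‖ ≤ 8 * R / (R - r) ^ 2 * K := by
  have hR : 0 < R := hr.trans_lt hrR
  have hd : DifferentiableOn ℂ (logDeriv g) (Metric.ball c R) :=
    DifferentiableOn.div hg.deriv.differentiableOn hg.differentiableOn hg0
  -- `ℓ` is a logarithm of `g / g c` vanishing at `c`. Its real part is at most `K`, so
  -- Borel–Carathéodory bounds `ℓ`, and Cauchy's estimate bounds its derivative `logDeriv g`.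
  obtain ⟨ℓ, hℓc, hℓ⟩ := hd.isExactOn_ball.with_val_at c 0
  have hcR : c ∈ Metric.ball c R := Metric.mem_ball_self hR
  have hexp : ∀ z ∈ Metric.ball c R, g z = g c * exp (ℓ z) := by
    intro z hz
    have hconst : ∀ x ∈ Metric.ball c R, HasDerivAt (fun z => g z * exp (-ℓ z)) 0 x := by
      intro x hx
      have h1 := (hg x).hasDerivAt.mul (hℓ x hx).neg.cexp
      convert! h1 using 1
      rw [logDeriv_apply]
      have := hg0 x hx
      field_simp
      ring
    have := (convex_ball c R).is_const_of_fderivWithin_eq_zero (𝕜 := ℂ)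
      (f := fun z => g z * exp (-ℓ z))
      (fun x hx => (hconst x hx).differentiableAt.differentiableWithinAt)
      (fun x hx => by
        rw [fderivWithin_of_isOpen Metric.isOpen_ball hx]
        ext
        simp [(hconst x hx).deriv]) hz hcR
    simp only [hℓc, neg_zero, exp_zero, mul_one] at this
    rw [← this, mul_assoc, ← exp_add, neg_add_cancel, exp_zero, mul_one]
  have hre : ∀ z ∈ Metric.ball c R, (ℓ z).re ≤ K := by
    intro z hz
    have h1 := hgK z hz
    have h2 : 0 < ‖g c‖ := norm_pos_iff.2 (hg0 c hcR)
    rw [hexp z hz, norm_mul, norm_exp, mul_comm] at h1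
    exact Real.exp_le_exp.1 (le_of_mul_le_mul_right h1 h2)
  have hbc : ∀ z ∈ Metric.ball (0 : ℂ) R, ‖ℓ (c + z)‖ ≤ 2 * K * ‖z‖ / (R - ‖z‖) := by
    intro z hz
    have hmaps : ∀ z ∈ Metric.ball (0 : ℂ) R, c + z ∈ Metric.ball c R := by
      intro z hz
      simpa [dist_eq_norm] using hz
    refine borelCaratheodory_zero (f := fun z => ℓ (c + z)) hK ?_ ?_ hR hz (by simpa using hℓc)
    · intro x hx
      have := (hℓ (c + x) (hmaps x hx)).differentiableAt
      exact (this.comp x (by fun_prop)).differentiableWithinAt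
    · exact fun x hx => hre _ (hmaps x hx)
  have hsr : ‖s - c‖ ≤ r := by simpa [dist_eq_norm] using hs
  -- Cauchy's estimate is applied on the circle of radius `(R - r)/2`, halfway to the boundary. It
  -- contributes one factor `2/(R - r)` and Borel–Carathéodory contributes the other.
  have hsb : ∀ w ∈ Metric.closedBall s ((R - r) / 2), ‖w - c‖ ≤ (R + r) / 2 := by
    intro w hw
    have h1 : ‖w - s‖ ≤ (R - r) / 2 := by simpa [dist_eq_norm] using hw
    calc ‖w - c‖ = ‖(w - s) + (s - c)‖ := by ring_nf
      _ ≤ _ := norm_add_le _ _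
      _ ≤ (R + r) / 2 := by linarith
  have hball : Metric.closedBall s ((R - r) / 2) ⊆ Metric.ball c R := by
    intro w hw
    have := hsb w hw
    rw [Metric.mem_ball, dist_eq_norm]
    linarith
  have hcirc : ∀ w ∈ Metric.sphere s ((R - r) / 2), ‖ℓ w‖ ≤ 4 * R / (R - r) * K := by
    intro w hw
    have hw' := hsb w (Metric.sphere_subset_closedBall hw)
    have h1 := hbc (w - c) (by rw [Metric.mem_ball, dist_zero_right]; linarith)
    rw [add_sub_cancel] at h1
    refine h1.trans ?_
    have h3 : 0 < R - r := by linarith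
    calc 2 * K * ‖w - c‖ / (R - ‖w - c‖) ≤ 2 * K * R / ((R - r) / 2) := by
          gcongr <;> linarith
      _ = _ := by field_simp; ring
  have hdiff : DiffContOnCl ℂ ℓ (Metric.ball s ((R - r) / 2)) := by
    refine DifferentiableOn.diffContOnCl_ball (U := Metric.ball c R) ?_ hball
    exact fun x hx => (hℓ x hx).differentiableAt.differentiableWithinAt
  have hsR : s ∈ Metric.ball c R := hball (Metric.mem_closedBall_self (by linarith))
  have := norm_deriv_le_of_forall_mem_sphere_norm_le (by linarith) hdiff hcirc
  rw [(hℓ s hsR).deriv] at this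
  refine this.trans (le_of_eq ?_)
  have h3 : R - r ≠ 0 := by linarith
  field_simp
  ring

/-- Bound for the logarithmic derivative of an entire function in terms of its growth and the
distance to its zeros. -/
theorem exists_norm_logDeriv_le {r r' R : ℝ} (hr : 0 < r) (hrr' : r < r') (hr'R : r' < R)
    (hR : R ≤ 2 * r') : ∃ C : ℝ, 0 < C ∧ ∀ (f : ℂ → ℂ), Differentiable ℂ f → ∀ (c : ℂ) (M : ℝ),
      f c ≠ 0 → 1 ≤ M → Real.exp 1 * ‖f c‖ ≤ M → (∀ z ∈ Metric.closedBall c R, ‖f z‖ ≤ M) →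
      ∀ (δ : ℝ), 0 < δ → δ ≤ 1 → ∀ s ∈ Metric.closedBall c r,
        (∀ p ∈ Metric.closedBall c r', f p = 0 → δ ≤ ‖s - p‖) →
        ‖logDeriv f s‖ ≤ C * Real.log (M / ‖f c‖) / δ := by
  have hr' : 0 < r' := hr.trans hrr'
  have hR0 : 0 < R := hr'.trans hr'R
  have hRr' : 0 < R - r' := sub_pos.2 hr'R
  have hlogRr : 0 < Real.log (R / r') := Real.log_pos ((one_lt_div hr').2 hr'R)
  have hq1 : 1 ≤ r' / (R - r') := (one_le_div hRr').2 (by linarith)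
  set D := Real.log (r' / (R - r'))
  have hD : 0 ≤ D := Real.log_nonneg hq1
  refine ⟨(Real.log (R / r'))⁻¹ + 8 * r' / (r' - r) ^ 2 * (1 + D / Real.log (R / r')), by
    have : 0 < r' - r := by linarith
    positivity, ?_⟩
  intro f hf c M hc hM1 hMe hM δ hδ hδ1 s hs hsδ
  have hfc : 0 < ‖f c‖ := norm_pos_iff.2 hc
  set L := Real.log (M / ‖f c‖) with hLdef
  have hL1 : 1 ≤ L := by
    rw [hLdef, Real.le_log_iff_exp_le (by positivity), le_div_iff₀ hfc]
    exact hMe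
  have hfin := finite_zeros_of_entire hf hc (isCompact_closedBall c r')
  set Z := hfin.toFinset with hZdef
  have hZ : ∀ p ∈ Z, p ∈ Metric.closedBall c r' ∧ f p = 0 := by
    intro p hp
    simpa [hZdef] using hp
  have hZ' : ∀ p ∈ Metric.closedBall c r', f p = 0 → p ∈ Z := by
    intro p hp h0
    simpa [hZdef] using ⟨hp, h0⟩
  have hcount := sum_analyticOrderNatAt_le hf hc hr' hr'R hM1 hM Z (fun p hp => (hZ p hp).1)
  rw [← hLdef] at hcount
  obtain ⟨h, hh, hhZ, hfh⟩ := exists_eq_prod_mul hf hc Z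
  set m := analyticOrderNatAt f
  set n := ∑ p ∈ Z, m p with hn
  have hn' : (n : ℝ) ≤ L / Real.log (R / r') := by
    rw [hn]; push_cast; exact hcount
  have hh0 : ∀ z ∈ Metric.closedBall c r', h z ≠ 0 := by
    intro z hz h0
    exact hhZ z (hZ' z hz (by rw [hfh, h0, mul_zero])) h0
  -- `exp K` bounds the growth of `h`: on the outer circle each removed factor is at least `R - r'`
  -- and at `c` at most `r'`, so `n` zeros cost `(r'/(R - r'))^n = exp (n D)`. Here `D ≥ 0` because
  -- `R ≤ 2 r'`.
  set K := L + n * D with hKdef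
  have hK : 0 < K := by positivity
  have hcprod : ‖f c‖ ≤ r' ^ n * ‖h c‖ := by
    rw [hfh c, norm_mul, norm_prod, hn, ← Finset.prod_pow_eq_pow_sum]
    gcongr with p hp
    rw [norm_pow]
    have : ‖c - p‖ ≤ r' := by
      have := (hZ p hp).1
      rwa [Metric.mem_closedBall, dist_comm, dist_eq_norm] at this
    gcongr
  have hsphere : ∀ z ∈ Metric.sphere c R, ‖h z‖ ≤ Real.exp K * ‖h c‖ := by
    intro z hz
    have h1 : (R - r') ^ n * ‖h z‖ ≤ M := by
      refine le_trans ?_ (hM z (Metric.sphere_subset_closedBall hz))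
      rw [hfh z, norm_mul, norm_prod, hn, ← Finset.prod_pow_eq_pow_sum]
      gcongr with p hp
      rw [norm_pow]
      have h2 : ‖p - c‖ ≤ r' := by
        have := (hZ p hp).1
        rwa [Metric.mem_closedBall, dist_eq_norm] at this
      have h3 : ‖z - c‖ = R := by
        rwa [Metric.mem_sphere, dist_eq_norm] at hz
      have h4 : R - r' ≤ ‖z - p‖ := by
        have := norm_sub_norm_le (z - c) (p - c)
        rw [sub_sub_sub_cancel_right] at this
        linarith
      gcongr
    have hexpK : Real.exp K = M / ‖f c‖ * (r' / (R - r')) ^ n := by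
      rw [hKdef, Real.exp_add, hLdef, Real.exp_log (by positivity), mul_comm (n : ℝ) D,
        Real.exp_mul, Real.exp_log (by positivity), Real.rpow_natCast]
    rw [hexpK]
    have hpos : 0 < (R - r') ^ n := by positivity
    calc ‖h z‖ ≤ M / (R - r') ^ n := by rw [le_div_iff₀ hpos]; linarith
      _ = M / ‖f c‖ * (1 / (R - r') ^ n) * ‖f c‖ := by field_simp
      _ ≤ M / ‖f c‖ * (1 / (R - r') ^ n) * (r' ^ n * ‖h c‖) := by gcongr
      _ = _ := by rw [div_pow]; ring
  have hball : ∀ z ∈ Metric.ball c r', ‖h z‖ ≤ Real.exp K * ‖h c‖ := by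
    intro z hz
    refine norm_le_of_forall_mem_frontier_norm_le (U := Metric.ball c R) Metric.isBounded_ball
      hh.diffContOnCl ?_ (subset_closure (Metric.ball_subset_ball hr'R.le hz))
    rw [frontier_ball c hR0.ne']
    exact hsphere
  have hlog := norm_logDeriv_le_of_ne_zero hh hrr' hr.le hK
    (fun z hz => hh0 z (Metric.ball_subset_closedBall hz)) hball hs
  have hsZ : s ∉ Z := by
    intro h
    have := hsδ s (hZ s h).1 (hZ s h).2
    rw [sub_self, norm_zero] at this
    linarith
  have hsr' : s ∈ Metric.closedBall c r' := Metric.closedBall_subset_closedBall hrr'.le hs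
  rw [logDeriv_eq_sum_add hh hfh hsZ (hh0 s hsr')]
  have hsum : ‖∑ p ∈ Z, (m p : ℂ) / (s - p)‖ ≤ n / δ := by
    refine (norm_sum_le _ _).trans ?_
    rw [hn]
    push_cast
    rw [Finset.sum_div]
    refine Finset.sum_le_sum fun p hp => ?_
    rw [norm_div, Complex.norm_natCast]
    have := hsδ p (hZ p hp).1 (hZ p hp).2
    gcongr
  have hKle : K ≤ L * (1 + D / Real.log (R / r')) := by
    rw [hKdef]
    have : n * D ≤ L / Real.log (R / r') * D := by gcongr
    calc L + n * D ≤ L + L / Real.log (R / r') * D := by gcongr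
      _ = _ := by ring
  have h6 : 0 < r' - r := by linarith
  calc ‖∑ p ∈ Z, (m p : ℂ) / (s - p) + logDeriv h s‖
      ≤ n / δ + 8 * r' / (r' - r) ^ 2 * K := (norm_add_le _ _).trans (add_le_add hsum hlog)
    _ ≤ L / Real.log (R / r') / δ +
        8 * r' / (r' - r) ^ 2 * (L * (1 + D / Real.log (R / r'))) / δ := by
        refine add_le_add (by gcongr) ?_
        rw [le_div_iff₀ hδ]
        calc 8 * r' / (r' - r) ^ 2 * K * δ ≤ 8 * r' / (r' - r) ^ 2 * K * 1 := by gcongr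
          _ ≤ _ := by rw [mul_one]; gcongr
    _ = _ := by ring

end ArgumentPrinciple

/-! ### Truncated Perron integrals and oscillatory integrals. -/

section PerronIntegrals

open Complex MeasureTheory intervalIntegral

theorem norm_exp_mul_add_mul_I (ℓ x y : ℝ) : ‖exp (ℓ * (x + y * I))‖ = Real.exp (ℓ * x) := by
  rw [norm_exp]
  simp

theorem norm_integral_horizontal_exp_div_le {ℓ : ℝ} (hℓ : 0 < ℓ) {a b T y : ℝ} (hab : a ≤ b)
    (hT : 0 < T) (hy : |y| = T) :
    ‖∫ x : ℝ in a..b, exp (ℓ * (x + y * I)) / (x + y * I)‖ ≤ Real.exp (ℓ * b) / (ℓ * T) := by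
  have h1 : ∀ x ∈ Set.Ioc a b, ‖exp (ℓ * (x + y * I)) / (x + y * I)‖ ≤ Real.exp (ℓ * x) / T := by
    intro x _
    rw [norm_div, norm_exp_mul_add_mul_I]
    have : T ≤ ‖(x + y * I : ℂ)‖ := by
      rw [← hy]
      simpa using abs_im_le_norm (x + y * I : ℂ)
    gcongr
  refine (intervalIntegral.norm_integral_le_of_norm_le hab (ae_of_all _ h1)
    (Continuous.intervalIntegrable (by fun_prop) _ _)).trans ?_
  have h2 : ∫ x : ℝ in a..b, Real.exp (ℓ * x) / T = (Real.exp (ℓ * b) - Real.exp (ℓ * a)) / (ℓ * T) := by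
    rw [intervalIntegral.integral_div, intervalIntegral.integral_comp_mul_left _ hℓ.ne']
    simp
    field_simp
  rw [h2]
  have := Real.exp_pos (ℓ * a)
  gcongr
  linarith

/-- Truncated Perron formula. -/
theorem norm_integral_exp_div_sub_le {ℓ : ℝ} (hℓ : 0 < ℓ) {c T : ℝ} (hc : c ≠ 0) (hT : 0 < T) :
    ‖(∫ y : ℝ in (-T)..T, exp (ℓ * (c + y * I)) / (c + y * I)) - if 0 < c then (2 * Real.pi : ℂ) else 0‖ ≤
      2 * Real.exp (ℓ * c) / (ℓ * T) := by
  -- The line is moved left to `Re s = -U` and `U → ∞`; the pole at `0` is crossed exactly when `0 <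
  -- c`.
  set V : ℝ → ℂ := fun x => ∫ y : ℝ in (-T)..T, exp (ℓ * (x + y * I)) / (x + y * I)
  have main : ∀ U : ℝ, 1 ≤ U → -U < c →
      ‖V c - if 0 < c then (2 * Real.pi : ℂ) else 0‖ ≤
        2 * Real.exp (ℓ * c) / (ℓ * T) + 2 * T * Real.exp (-U * ℓ) := by
    intro U hU hUc
    have hrect : rectIntegral (fun s => exp (ℓ * s) / s) (-U) c (-T) T =
        I * if 0 < c then (2 * Real.pi : ℂ) else 0 := by
      split_ifs with h
      · have := rectIntegral_div_sub (a := -U) (b := c) (c := -T) (d := T) (p := 0)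
          (h := fun s => exp (ℓ * s)) (by simp; linarith) (by simpa) (by simpa) (by simpa)
          (by fun_prop)
        simp only [sub_zero, mul_zero, exp_zero, mul_one] at this
        rw [this]
        ring
      · rw [mul_zero]
        apply rectIntegral_eq_zero hUc.le (by linarith)
        refine DifferentiableOn.div (by fun_prop) (by fun_prop) ?_
        rintro s hs rfl
        have := hs.1.2
        simp at this
        exact h (lt_of_le_of_ne this hc.symm)
    have h1 := norm_integral_horizontal_exp_div_le hℓ hUc.le hT (y := -T) (by simp [hT.le])
    have h2 := norm_integral_horizontal_exp_div_le hℓ hUc.le hT (y := T) (by simp [hT.le])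
    have h3 : ‖V (-U)‖ ≤ 2 * T * Real.exp (-U * ℓ) := by
      have : ∀ y ∈ Set.uIoc (-T) T, ‖exp (ℓ * ((-U : ℝ) + y * I)) / ((-U : ℝ) + y * I)‖ ≤
          Real.exp (-U * ℓ) := by
        intro y _
        rw [norm_div, norm_exp_mul_add_mul_I, mul_comm]
        refine div_le_self (Real.exp_pos _).le (hU.trans ?_)
        have := abs_re_le_norm (((-U : ℝ) : ℂ) + y * I)
        simp only [add_re, ofReal_re, mul_re, I_re, mul_zero, ofReal_im, I_im, mul_one, sub_self,
          add_zero, abs_neg] at this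
        exact (le_abs_self U).trans this
      refine (intervalIntegral.norm_integral_le_of_norm_le_const this).trans (le_of_eq ?_)
      rw [show T - -T = 2 * T by ring, abs_of_pos (by linarith)]
      ring
    have h4 : I * (V c - if 0 < c then (2 * Real.pi : ℂ) else 0) =
        -(∫ x : ℝ in (-U)..c, exp (ℓ * (x + (-T : ℝ) * I)) / (x + (-T : ℝ) * I)) +
        (∫ x : ℝ in (-U)..c, exp (ℓ * (x + T * I)) / (x + T * I)) + I * V (-U) := by
      have hr2 := hrect
      simp only [rectIntegral] at hr2
      rw [mul_sub, ← hr2]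
      simp only [V]
      ring
    have h5 : ‖V c - if 0 < c then (2 * Real.pi : ℂ) else 0‖ =
        ‖I * (V c - if 0 < c then (2 * Real.pi : ℂ) else 0)‖ := by
      rw [norm_mul, norm_I, one_mul]
    rw [h5, h4]
    refine (norm_add_le _ _).trans (add_le_add ((norm_add_le _ _).trans ?_) ?_)
    · rw [norm_neg]
      calc _ ≤ Real.exp (ℓ * c) / (ℓ * T) + Real.exp (ℓ * c) / (ℓ * T) := add_le_add h1 h2
        _ = _ := by ring
    · rwa [norm_mul, norm_I, one_mul]
  have hlim : Tendsto (fun U : ℝ => 2 * Real.exp (ℓ * c) / (ℓ * T) + 2 * T * Real.exp (-U * ℓ)) atTop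
      (𝓝 (2 * Real.exp (ℓ * c) / (ℓ * T) + 2 * T * 0)) := by
    refine tendsto_const_nhds.add (tendsto_const_nhds.mul ?_)
    refine Real.tendsto_exp_atBot.comp ?_
    simp_rw [neg_mul]
    exact tendsto_neg_atTop_atBot.comp (tendsto_id.atTop_mul_const hℓ)
  rw [mul_zero, add_zero] at hlim
  refine ge_of_tendsto hlim ?_
  filter_upwards [eventually_ge_atTop 1, eventually_gt_atTop (-c)] with U h1 h2
  exact main U h1 (by linarith)

/-- Truncated Perron formula for negative exponents. -/
theorem norm_integral_exp_div_le_of_neg {ℓ : ℝ} (hℓ : ℓ < 0) {c T : ℝ} (hc : 0 < c) (hT : 0 < T) :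
    ‖∫ y : ℝ in (-T)..T, exp (ℓ * (c + y * I)) / (c + y * I)‖ ≤
      2 * Real.exp (ℓ * c) / (-ℓ * T) := by
  -- Replacing `s` by `-s` turns `(ℓ, c)` into `(-ℓ, -c)`, where no pole is enclosed.
  have h := norm_integral_exp_div_sub_le (ℓ := -ℓ) (by linarith) (c := -c) (T := T) (by linarith) hT
  rw [if_neg (by linarith), sub_zero] at h
  have e : ∫ y : ℝ in (-T)..T, exp (ℓ * (c + y * I)) / (c + y * I) =
      -∫ y : ℝ in (-T)..T, exp ((-ℓ : ℝ) * ((-c : ℝ) + y * I)) / ((-c : ℝ) + y * I) := by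
    rw [← intervalIntegral.integral_neg]
    have := intervalIntegral.integral_comp_neg (a := -T) (b := T)
      (fun y : ℝ => exp (ℓ * (c + y * I)) / (c + y * I))
    rw [neg_neg] at this
    rw [← this]
    refine intervalIntegral.integral_congr fun y _ => ?_
    push_cast
    rw [← div_neg]
    congr 2 <;> ring
  rw [e, norm_neg]
  refine h.trans (le_of_eq ?_)
  congr 3
  ring

/-- Oscillatory integrals: integration by parts against `exp (i ℓ t)`. -/
theorem tendsto_integral_mul_exp {K K' : ℝ → ℂ} (hK : ∀ t, HasDerivAt K (K' t) t)
    (hK' : Integrable K') (hKc : Continuous K') (htop : Tendsto K atTop (𝓝 0))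
    (hbot : Tendsto K atBot (𝓝 0)) {ℓ : ℝ} (hℓ : ℓ ≠ 0) :
    ∃ J : ℂ, Tendsto (fun T : ℝ => ∫ t : ℝ in (-T)..T, K t * exp (ℓ * t * I)) atTop (𝓝 J) ∧
      ‖J‖ ≤ (∫ t, ‖K' t‖) / |ℓ| := by
  have hℓI : (ℓ * I : ℂ) ≠ 0 := mul_ne_zero (by exact_mod_cast hℓ) I_ne_zero
  have hnorm : ∀ t : ℝ, ‖exp (ℓ * t * I)‖ = 1 := fun t => by
    rw [← ofReal_mul]
    exact norm_exp_ofReal_mul_I _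
  have hIntegrable : Integrable fun t : ℝ => K' t * (exp (ℓ * t * I) / (ℓ * I)) := by
    refine hK'.mul_bdd (c := 1 / ‖(ℓ * I : ℂ)‖) (by fun_prop) (ae_of_all _ fun t => ?_)
    rw [norm_div, hnorm]
  refine ⟨-∫ t, K' t * (exp (ℓ * t * I) / (ℓ * I)), ?_, ?_⟩
  · have hparts : ∀ T : ℝ, ∫ t : ℝ in (-T)..T, K t * exp (ℓ * t * I) =
        K T * (exp (ℓ * T * I) / (ℓ * I)) - K (-T) * (exp (ℓ * (-T : ℝ) * I) / (ℓ * I)) -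
          ∫ t : ℝ in (-T)..T, K' t * (exp (ℓ * t * I) / (ℓ * I)) := by
      intro T
      refine intervalIntegral.integral_mul_deriv_eq_deriv_mul (u := K) (u' := K')
        (v := fun t : ℝ => exp (ℓ * t * I) / (ℓ * I)) (fun t _ => hK t) (fun t _ => ?_)
        (hKc.intervalIntegrable _ _) (Continuous.intervalIntegrable (by fun_prop) _ _)
      have h1 : HasDerivAt (fun t : ℝ => (ℓ * t * I : ℂ)) (ℓ * I) t := by
        simpa using ((((hasDerivAt_id (t : ℂ)).comp_ofReal).const_mul (ℓ : ℂ)).mul_const I)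
      have h2 := (h1.cexp).div_const (ℓ * I : ℂ)
      rwa [mul_div_cancel_right₀ _ hℓI] at h2
    have hz : ∀ (f : ℝ → ℝ), Tendsto (fun T => K (f T)) atTop (𝓝 0) →
        Tendsto (fun T => K (f T) * (exp (ℓ * (f T) * I) / (ℓ * I))) atTop (𝓝 0) := by
      intro f hf
      rw [tendsto_zero_iff_norm_tendsto_zero] at hf ⊢
      have := hf.mul_const (1 / ‖(ℓ * I : ℂ)‖)
      rw [zero_mul] at this
      refine this.congr fun T => ?_
      rw [norm_mul (K _), norm_div, hnorm]
    have h1 := hz id htop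
    have h2 := hz (fun T => -T) (hbot.comp tendsto_neg_atTop_atBot)
    have h3 := intervalIntegral_tendsto_integral hIntegrable tendsto_neg_atTop_atBot tendsto_id
    have := (h1.sub h2).sub h3
    rw [sub_zero, zero_sub] at this
    exact this.congr fun T => (hparts T).symm
  · rw [norm_neg]
    refine (MeasureTheory.norm_integral_le_integral_norm _).trans (le_of_eq ?_)
    rw [← MeasureTheory.integral_div]
    refine integral_congr_ae (ae_of_all _ fun t => ?_)
    simp only
    rw [norm_mul, norm_div, hnorm, norm_mul, norm_I, mul_one, norm_real, Real.norm_eq_abs]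
    ring

/-- Termwise limits of truncated integrals of a series. -/
theorem tendsto_integral_tsum_of_le {f : ℕ → ℝ → ℂ} (hf : ∀ n, Continuous (f n)) {b B : ℕ → ℝ}
    {v : ℕ → ℂ} (hb : Summable b) (hB : Summable B) (hv : Summable v) (hfb : ∀ n t, ‖f n t‖ ≤ b n)
    (hfv : ∀ n, ∀ T > 0, ‖(∫ t : ℝ in (-T)..T, f n t) - v n‖ ≤ B n / T) :
    Tendsto (fun T : ℝ => ∫ t : ℝ in (-T)..T, ∑' n, f n t) atTop (𝓝 (∑' n, v n)) := by
  have key : ∀ T > 0, ‖(∫ t : ℝ in (-T)..T, ∑' n, f n t) - ∑' n, v n‖ ≤ (∑' n, B n) / T := by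
    intro T hT
    have hs : HasSum (fun n => ∫ t : ℝ in (-T)..T, f n t) (∫ t : ℝ in (-T)..T, ∑' n, f n t) := by
      refine intervalIntegral.hasSum_integral_of_dominated_convergence (fun n _ => b n)
        (fun n => (hf n).aestronglyMeasurable) (fun n => ae_of_all _ fun t _ => hfb n t)
        (ae_of_all _ fun t _ => hb) (by simp) (ae_of_all _ fun t _ => ?_)
      exact (Summable.of_norm_bounded hb (fun n => hfb n t)).hasSum
    rw [← (hs.sub hv.hasSum).tsum_eq, ← tsum_div_const]
    exact tsum_of_norm_bounded (hB.div_const T).hasSum (fun n => hfv n T hT)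
  rw [tendsto_iff_norm_sub_tendsto_zero]
  refine squeeze_zero' (Eventually.of_forall fun _ => norm_nonneg _) ?_
    (tendsto_const_nhds.div_atTop tendsto_id : Tendsto (fun T : ℝ => (∑' n, B n) / T) atTop (𝓝 0))
  filter_upwards [eventually_gt_atTop 0] with T hT using key T hT

end PerronIntegrals

/-! ### The digamma function: its series and crude bounds. -/

section Digamma

open Complex MeasureTheory intervalIntegral

/-- Derivatives are Cauchy integrals over a circle, so dominated convergence applies: pointwise
limits with a common continuous bound are enough. -/
theorem tendsto_deriv_of_dominated {f : ℕ → ℂ → ℂ} {g : ℂ → ℂ} {z : ℂ} {r : ℝ} (hr : 0 < r)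
    {U : Set ℂ} (hU : IsOpen U) (hzU : Metric.closedBall z r ⊆ U)
    (hf : ∀ n, DifferentiableOn ℂ (f n) U) (hg : DifferentiableOn ℂ g U) {B : ℂ → ℝ}
    (hB : ContinuousOn B U) (hfB : ∀ n, ∀ w ∈ U, ‖f n w‖ ≤ B w)
    (hlim : ∀ w ∈ U, Tendsto (fun n => f n w) atTop (𝓝 (g w))) :
    Tendsto (fun n => deriv (f n) z) atTop (𝓝 (deriv g z)) := by
  rw [← cderiv_eq_deriv hU hg hr hzU]
  simp_rw [fun n => (cderiv_eq_deriv hU (hf n) hr hzU).symm]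
  unfold cderiv
  refine tendsto_const_nhds.smul ?_
  simp only [circleIntegral]
  have hmem : ∀ θ, circleMap z r θ ∈ U := fun θ =>
    hzU (Metric.sphere_subset_closedBall (circleMap_mem_sphere z hr.le θ))
  have hcU : ∀ (E : Type) [TopologicalSpace E] (k : ℂ → E), ContinuousOn k U →
      Continuous fun θ => k (circleMap z r θ) := fun E _ k hk =>
    hk.comp_continuous (continuous_circleMap z r) hmem
  have hne : ∀ θ, (circleMap z r θ - z) ^ 2 ≠ 0 := fun θ =>
    pow_ne_zero _ (sub_ne_zero.2 (circleMap_ne_center hr.ne'))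
  refine intervalIntegral.tendsto_integral_filter_of_dominated_convergence
    (fun θ => |r| * (((r ^ 2)⁻¹) * B (circleMap z r θ))) (Eventually.of_forall fun n => ?_)
    (Eventually.of_forall fun n => ae_of_all _ fun θ _ => ?_)
    (Continuous.intervalIntegrable ?_ _ _) (ae_of_all _ fun θ _ => ?_)
  · refine Continuous.aestronglyMeasurable ?_
    have c1 : Continuous fun θ => deriv (circleMap z r) θ := by
      simp only [deriv_circleMap]
      fun_prop
    have c2 : Continuous fun θ => ((circleMap z r θ - z) ^ 2)⁻¹ :=
      Continuous.inv₀ (by fun_prop) hne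
    exact c1.smul (c2.smul (hcU _ _ (hf n).continuousOn))
  · rw [norm_smul, norm_smul, norm_inv, norm_pow]
    have h1 : ‖deriv (circleMap z r) θ‖ = |r| := by simp [deriv_circleMap]
    have h2 : ‖circleMap z r θ - z‖ = r := by simp [abs_of_pos hr]
    rw [h1, h2]
    gcongr
    exact hfB n _ (hmem θ)
  · exact continuous_const.mul (continuous_const.mul (hcU _ _ hB))
  · exact (tendsto_const_nhds.smul (tendsto_const_nhds.smul (hlim _ (hmem θ))))

/-- In the integral for `GammaSeq` use `(1 - x/n)^n ≤ e^(-x)`. This is the common bound needed to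
differentiate Euler's limit for `Γ`. -/
theorem norm_GammaSeq_le {s : ℂ} (hs : 0 < s.re) {n : ℕ} (hn : n ≠ 0) :
    ‖GammaSeq s n‖ ≤ Real.Gamma s.re := by
  rw [GammaSeq_eq_approx_Gamma_integral hs hn]
  have hIntegrable : IntegrableOn (fun x : ℝ => Real.exp (-x) * x ^ (s.re - 1)) (Set.Ioi 0) :=
    Real.GammaIntegral_convergent hs
  have hn0 : (0 : ℝ) ≤ n := n.cast_nonneg
  have h1 : ∀ x ∈ Set.Ioc (0 : ℝ) n, ‖(((1 - x / n) ^ n : ℝ) : ℂ) * (x : ℂ) ^ (s - 1)‖ ≤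
      Real.exp (-x) * x ^ (s.re - 1) := by
    intro x hx
    have hn' : (0 : ℝ) < n := by positivity
    have h0 : 0 ≤ 1 - x / n := by
      rw [sub_nonneg, div_le_one hn']
      exact hx.2
    rw [norm_mul, norm_cpow_eq_rpow_re_of_pos hx.1, norm_real, Real.norm_of_nonneg (by positivity)]
    have := Real.one_sub_div_pow_le_exp_neg hx.2
    have h3 := Real.rpow_nonneg hx.1.le (s.re - 1)
    simp only [sub_re, one_re]
    gcongr
  refine (intervalIntegral.norm_integral_le_of_norm_le hn0 (ae_of_all _ h1) ?_).trans ?_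
  · rw [intervalIntegrable_iff_integrableOn_Ioc_of_le hn0]
    exact hIntegrable.mono_set Set.Ioc_subset_Ioi_self
  · rw [Real.Gamma_eq_integral hs, intervalIntegral.integral_of_le hn0]
    refine setIntegral_mono_set hIntegrable ?_ (Eventually.of_forall Set.Ioc_subset_Ioi_self)
    filter_upwards [self_mem_ae_restrict measurableSet_Ioi] with x hx
    have := Real.rpow_nonneg (le_of_lt hx) (s.re - 1)
    exact mul_nonneg (Real.exp_pos _).le this

theorem logDeriv_GammaSeq {s : ℂ} (hs : 0 < s.re) {n : ℕ} (hn : n ≠ 0) :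
    logDeriv (fun z => GammaSeq z n) s = Real.log n - ∑ j ∈ Finset.range (n + 1), 1 / (s + j) := by
  have hne : ∀ j ∈ Finset.range (n + 1), s + (j : ℂ) ≠ 0 := by
    intro j _ h
    have := congrArg re h
    simp at this
    have : (0 : ℝ) ≤ j := j.cast_nonneg
    linarith
  have hnC : (n : ℂ) ≠ 0 := by exact_mod_cast hn
  have hfac : ((Nat.factorial n : ℕ) : ℂ) ≠ 0 := by exact_mod_cast Nat.factorial_ne_zero n
  unfold GammaSeq
  have hd : HasDerivAt (fun z : ℂ => (n : ℂ) ^ z) ((n : ℂ) ^ s * Complex.log n) s := by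
    simpa using (hasDerivAt_id s).const_cpow (c := (n : ℂ)) (Or.inl hnC)
  have hcp : (n : ℂ) ^ s ≠ 0 := by simp [cpow_eq_zero_iff, hnC]
  rw [logDeriv_div (f := fun z : ℂ => (n : ℂ) ^ z * (Nat.factorial n : ℕ))
    (g := fun z : ℂ => ∏ j ∈ Finset.range (n + 1), (z + j)) s (mul_ne_zero hcp hfac) (Finset.prod_ne_zero_iff.2 hne)
    (hd.differentiableAt.mul_const _) (by fun_prop), logDeriv_mul_const _ _ hfac,
    logDeriv_prod hne (fun j _ => by fun_prop)]
  congr 1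
  · rw [logDeriv_apply, hd.deriv, mul_div_cancel_left₀ _ hcp, natCast_log]
  · refine Finset.sum_congr rfl fun j _ => ?_
    simp [logDeriv_apply]

theorem tendsto_digamma {s : ℂ} (hs : 0 < s.re) :
    Tendsto (fun n : ℕ => (Real.log n : ℂ) - ∑ j ∈ Finset.range (n + 1), 1 / (s + j)) atTop
      (𝓝 (digamma s)) := by
  have hU : IsOpen {z : ℂ | 0 < z.re} := isOpen_lt continuous_const continuous_re
  have hball : Metric.closedBall s (s.re / 2) ⊆ {z : ℂ | 0 < z.re} := by
    intro w hw
    have h1 : ‖w - s‖ ≤ s.re / 2 := by simpa [dist_eq_norm] using hw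
    have h2 := (abs_le.1 ((abs_re_le_norm (w - s)).trans h1)).1
    simp only [sub_re] at h2
    simp only [Set.mem_ofPred_eq]
    linarith
  have hpole : ∀ z : ℂ, 0 < z.re → ∀ m : ℕ, z ≠ -m := by
    rintro z hz m rfl
    simp at hz
    have : (0 : ℝ) ≤ m := m.cast_nonneg
    linarith
  have hdΓ : DifferentiableOn ℂ Gamma {z : ℂ | 0 < z.re} := fun z hz =>
    (differentiableAt_Gamma z (hpole z hz)).differentiableWithinAt
  have hder : Tendsto (fun n : ℕ => deriv (fun z => GammaSeq z (n + 1)) s) atTop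
      (𝓝 (deriv Gamma s)) := by
    refine tendsto_deriv_of_dominated (by linarith) hU hball (fun n => ?_) hdΓ
      (B := fun w => Real.Gamma w.re) ?_ (fun n w hw => norm_GammaSeq_le hw (Nat.succ_ne_zero n))
      (fun w _ => (GammaSeq_tendsto_Gamma w).comp (tendsto_add_atTop_nat 1))
    · unfold GammaSeq
      intro z hz
      refine (DifferentiableAt.div ?_ (by fun_prop) ?_).differentiableWithinAt
      · refine DifferentiableAt.mul_const ?_ _
        have : ((n + 1 : ℕ) : ℂ) ≠ 0 := by exact_mod_cast Nat.succ_ne_zero n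
        exact (differentiableAt_id).const_cpow (Or.inl this)
      · rw [Finset.prod_ne_zero_iff]
        intro j _ h
        exact hpole z hz j (eq_neg_of_add_eq_zero_left h)
    · exact Real.differentiableOn_Gamma_Ioi.continuousOn.comp continuous_re.continuousOn
        (fun z hz => hz)
  have hlog := hder.div ((GammaSeq_tendsto_Gamma s).comp (tendsto_add_atTop_nat 1))
    (Gamma_ne_zero (hpole s hs))
  rw [← tendsto_add_atTop_iff_nat 1]
  refine hlog.congr fun n => ?_
  exact logDeriv_GammaSeq hs (Nat.succ_ne_zero n)

/-- The difference is the series of `(s - w)/((s + j)(w + j))`. Interpolating `‖z + j‖ ≥ ‖z‖^(1/4)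
(j + δ)^(3/4)` keeps the sum over `j` convergent and saves a power of both variables. Taking `w = 1`
then gives growth, and `w → s` gives the derivative. -/
theorem exists_norm_digamma_sub_le {δ : ℝ} (hδ : 0 < δ) : ∃ C : ℝ, 0 < C ∧ ∀ s w : ℂ,
    δ ≤ s.re → δ ≤ w.re →
      ‖digamma s - digamma w‖ ≤ C * ‖s - w‖ * (‖s‖ ^ (-(1 / 4) : ℝ) * ‖w‖ ^ (-(1 / 4) : ℝ)) := by
  have hsum : Summable fun j : ℕ => ((j : ℝ) + δ) ^ (-(3 / 2) : ℝ) := by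
    rw [← summable_nat_add_iff 1]
    have h1 : Summable fun j : ℕ => (((j + 1 : ℕ) : ℝ)) ^ (-(3 / 2) : ℝ) :=
      (summable_nat_add_iff 1).2 (Real.summable_nat_rpow.2 (by norm_num))
    refine h1.of_nonneg_of_le (fun j => by positivity) fun j => ?_
    exact Real.rpow_le_rpow_of_nonpos (by positivity) (by linarith) (by norm_num)
  set C := ∑' j : ℕ, ((j : ℝ) + δ) ^ (-(3 / 2) : ℝ)
  have hC : 0 < C := hsum.tsum_pos (fun j => by positivity) 0 (by positivity)
  refine ⟨C, hC, fun s w hs hw => ?_⟩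
  have hlow : ∀ z : ℂ, δ ≤ z.re → ∀ j : ℕ,
      ‖z‖ ^ (1 / 4 : ℝ) * ((j : ℝ) + δ) ^ (3 / 4 : ℝ) ≤ ‖z + j‖ := by
    intro z hz j
    have hj : (0 : ℝ) ≤ j := j.cast_nonneg
    have h1 : ‖z‖ ≤ ‖z + j‖ := by
      rw [← abs_norm z, ← abs_norm (z + j), ← sq_le_sq, Complex.sq_norm, Complex.sq_norm,
        normSq_apply, normSq_apply]
      simp
      nlinarith
    have h2 : (j : ℝ) + δ ≤ ‖z + j‖ := by
      have := re_le_norm (z + j)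
      simp at this
      linarith
    have hpos : 0 < ‖z + j‖ := by linarith
    calc ‖z‖ ^ (1 / 4 : ℝ) * ((j : ℝ) + δ) ^ (3 / 4 : ℝ)
        ≤ ‖z + j‖ ^ (1 / 4 : ℝ) * ‖z + j‖ ^ (3 / 4 : ℝ) := by gcongr
      _ = ‖z + j‖ := by rw [← Real.rpow_add hpos]; norm_num
  have hpos : ∀ z : ℂ, δ ≤ z.re → 0 < ‖z‖ := fun z hz => by
    have := re_le_norm z
    linarith
  have hne : ∀ z : ℂ, δ ≤ z.re → ∀ j : ℕ, z + j ≠ 0 := by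
    intro z hz j h
    have := congrArg re h
    simp at this
    have : (0 : ℝ) ≤ j := j.cast_nonneg
    linarith
  have hlim := (tendsto_digamma (by linarith : 0 < s.re)).sub
    (tendsto_digamma (by linarith : 0 < w.re))
  refine le_of_tendsto hlim.norm (Eventually.of_forall fun n => ?_)
  have e : (Real.log n : ℂ) - ∑ j ∈ Finset.range (n + 1), 1 / (s + j) -
      ((Real.log n : ℂ) - ∑ j ∈ Finset.range (n + 1), 1 / (w + j)) =
      ∑ j ∈ Finset.range (n + 1), (s - w) / ((s + j) * (w + j)) := by
    rw [sub_sub_sub_cancel_left, ← Finset.sum_sub_distrib]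
    refine Finset.sum_congr rfl fun j _ => ?_
    have h1 := hne s hs j
    have h2 := hne w hw j
    field_simp
    ring
  rw [e]
  have hs0 := hpos s hs
  have hw0 := hpos w hw
  calc ‖∑ j ∈ Finset.range (n + 1), (s - w) / ((s + j) * (w + j))‖
      ≤ ∑ j ∈ Finset.range (n + 1), ‖s - w‖ * (‖s‖ ^ (-(1 / 4) : ℝ) * ‖w‖ ^ (-(1 / 4) : ℝ)) *
          ((j : ℝ) + δ) ^ (-(3 / 2) : ℝ) := by
        refine (norm_sum_le _ _).trans (Finset.sum_le_sum fun j _ => ?_)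
        have hj : (0 : ℝ) < j + δ := by positivity
        rw [norm_div, norm_mul]
        have h1 := hlow s hs j
        have h2 := hlow w hw j
        calc ‖s - w‖ / (‖s + j‖ * ‖w + j‖) ≤ ‖s - w‖ /
              ((‖s‖ ^ (1 / 4 : ℝ) * ((j : ℝ) + δ) ^ (3 / 4 : ℝ)) *
                (‖w‖ ^ (1 / 4 : ℝ) * ((j : ℝ) + δ) ^ (3 / 4 : ℝ))) := by gcongr
          _ = _ := by
            rw [Real.rpow_neg hs0.le, Real.rpow_neg hw0.le, Real.rpow_neg hj.le,
              show (3 / 2 : ℝ) = 3 / 4 + 3 / 4 by norm_num, Real.rpow_add hj]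
            field_simp
    _ = ‖s - w‖ * (‖s‖ ^ (-(1 / 4) : ℝ) * ‖w‖ ^ (-(1 / 4) : ℝ)) *
          ∑ j ∈ Finset.range (n + 1), ((j : ℝ) + δ) ^ (-(3 / 2) : ℝ) := by rw [Finset.mul_sum]
    _ ≤ ‖s - w‖ * (‖s‖ ^ (-(1 / 4) : ℝ) * ‖w‖ ^ (-(1 / 4) : ℝ)) * C := by
        gcongr
        exact hsum.sum_le_tsum _ (fun j _ => by positivity)
    _ = _ := by ring

end Digamma

/-! ### The archimedean part of the explicit formula. -/

section ArchimedeanTerms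

open Complex MeasureTheory intervalIntegral

theorem differentiableAt_digamma {s : ℂ} (hs : 0 < s.re) : DifferentiableAt ℂ digamma s := by
  have hU : IsOpen {z : ℂ | 0 < z.re} := isOpen_lt continuous_const continuous_re
  have hpole : ∀ z : ℂ, 0 < z.re → ∀ m : ℕ, z ≠ -m := by
    rintro z hz m rfl
    simp at hz
    have : (0 : ℝ) ≤ m := m.cast_nonneg
    linarith
  have hdΓ : DifferentiableOn ℂ Gamma {z : ℂ | 0 < z.re} := fun z hz =>
    (differentiableAt_Gamma z (hpole z hz)).differentiableWithinAt
  have : DifferentiableOn ℂ digamma {z : ℂ | 0 < z.re} :=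
    (hdΓ.deriv hU).div hdΓ fun z hz => Gamma_ne_zero (hpole z hz)
  exact this.differentiableAt (hU.mem_nhds hs)

theorem exists_norm_digamma_le {δ : ℝ} (hδ : 0 < δ) : ∃ C : ℝ, 0 < C ∧ ∀ s : ℂ, δ ≤ s.re →
    ‖digamma s‖ ≤ C * ‖s‖ ^ (3 / 4 : ℝ) ∧ ‖deriv digamma s‖ ≤ C * ‖s‖ ^ (-(1 / 2) : ℝ) := by
  -- `ε < δ` leaves room for points `w` near `s`, and `ε ≤ 1` admits the reference point `w = 1`.
  set ε := min (δ / 2) 1 with hε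
  have hε0 : 0 < ε := by positivity
  have hεδ : ε < δ := (min_le_left _ _).trans_lt (by linarith)
  have hε1 : ε ≤ 1 := min_le_right _ _
  obtain ⟨C, hC, hbound⟩ := exists_norm_digamma_sub_le hε0
  refine ⟨C * (1 + 1 / δ) + ‖digamma 1‖ / δ ^ (3 / 4 : ℝ) + C, by positivity, fun s hs => ?_⟩
  have hsn : δ ≤ ‖s‖ := hs.trans (re_le_norm s)
  have hs0 : 0 < ‖s‖ := hδ.trans_le hsn
  constructor
  · have h1 := hbound s 1 (by linarith) (by simpa using hε1)
    rw [norm_one, Real.one_rpow, mul_one] at h1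
    have h2 : ‖s - 1‖ ≤ (1 + 1 / δ) * ‖s‖ := by
      refine (norm_sub_le _ _).trans ?_
      have : 1 ≤ ‖s‖ / δ := (one_le_div hδ).2 hsn
      rw [norm_one, add_mul, one_mul, one_div_mul_eq_div]
      linarith
    have h3 : ‖s‖ * ‖s‖ ^ (-(1 / 4) : ℝ) = ‖s‖ ^ (3 / 4 : ℝ) := by
      rw [← Real.rpow_one_add' hs0.le (by norm_num)]
      norm_num
    have h4 : ‖digamma 1‖ ≤ ‖digamma 1‖ / δ ^ (3 / 4 : ℝ) * ‖s‖ ^ (3 / 4 : ℝ) := by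
      rw [div_mul_eq_mul_div, le_div_iff₀ (by positivity)]
      gcongr
    calc ‖digamma s‖ = ‖(digamma s - digamma 1) + digamma 1‖ := by rw [sub_add_cancel]
      _ ≤ C * ((1 + 1 / δ) * ‖s‖) * ‖s‖ ^ (-(1 / 4) : ℝ) +
          ‖digamma 1‖ / δ ^ (3 / 4 : ℝ) * ‖s‖ ^ (3 / 4 : ℝ) := by
          refine (norm_add_le _ _).trans (add_le_add (h1.trans ?_) h4)
          gcongr
      _ = (C * (1 + 1 / δ) + ‖digamma 1‖ / δ ^ (3 / 4 : ℝ)) * ‖s‖ ^ (3 / 4 : ℝ) := by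
          rw [← h3]; ring
      _ ≤ _ := mul_le_mul_of_nonneg_right (by linarith) (by positivity)
  · have h1 : ‖deriv digamma s‖ ≤ C * ‖s‖ ^ (-(1 / 2) : ℝ) := by
      have hd := (differentiableAt_digamma (by linarith : 0 < s.re)).hasDerivAt
      rw [hasDerivAt_iff_tendsto_slope] at hd
      have hcont : Tendsto (fun w : ℂ => C * (‖w‖ ^ (-(1 / 4) : ℝ) * ‖s‖ ^ (-(1 / 4) : ℝ))) (𝓝[≠] s)
          (𝓝 (C * (‖s‖ ^ (-(1 / 4) : ℝ) * ‖s‖ ^ (-(1 / 4) : ℝ)))) := by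
        refine tendsto_const_nhds.mul (Tendsto.mul_const _ ?_)
        exact ((continuous_norm.tendsto s).mono_left nhdsWithin_le_nhds).rpow_const
          (Or.inl hs0.ne')
      have he : C * (‖s‖ ^ (-(1 / 4) : ℝ) * ‖s‖ ^ (-(1 / 4) : ℝ)) = C * ‖s‖ ^ (-(1 / 2) : ℝ) := by
        rw [← Real.rpow_add hs0]
        norm_num
      rw [he] at hcont
      refine le_of_tendsto_of_tendsto hd.norm hcont ?_
      have hnear : ∀ᶠ w in 𝓝[≠] s, ε ≤ w.re := by
        refine nhdsWithin_le_nhds ?_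
        filter_upwards [(isOpen_lt continuous_const continuous_re).mem_nhds
          (show ε < s.re by linarith)] with w hw using le_of_lt hw
      filter_upwards [hnear, self_mem_nhdsWithin] with w hw hws
      have h2 : 0 < ‖w - s‖ := norm_pos_iff.2 (sub_ne_zero.2 hws)
      rw [slope_def_field, norm_div, div_le_iff₀ h2]
      refine (hbound w s hw (by linarith)).trans (le_of_eq ?_)
      ring
    refine h1.trans ?_
    have : 0 ≤ C * (1 + 1 / δ) + ‖digamma 1‖ / δ ^ (3 / 4 : ℝ) := by positivity
    gcongr
    linarith

/-- The logarithmic derivative of `Gammaℝ (s + a)`. -/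
def archLogDeriv (a : ℝ) (s : ℂ) : ℂ := -(Real.log Real.pi) / 2 + digamma ((s + a) / 2) / 2

theorem hasDerivAt_archLogDeriv {a : ℝ} (ha : 0 ≤ a) {s : ℂ} (hs : 0 < s.re) :
    HasDerivAt (archLogDeriv a) (deriv digamma ((s + a) / 2) / 4) s := by
  have h1 : HasDerivAt (fun z : ℂ => (z + a) / 2) (1 / 2) s :=
    ((hasDerivAt_id s).add_const _).div_const 2
  have h2 := (differentiableAt_digamma (s := (s + a) / 2) (by
    simp
    linarith)).hasDerivAt
  have := ((h2.comp s h1).div_const 2).const_add (-(Real.log Real.pi) / 2 : ℂ)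
  convert! this using 1
  ring

theorem exists_norm_archLogDeriv_le {a : ℝ} (ha : 0 ≤ a) : ∃ C : ℝ, 0 < C ∧ ∀ s : ℂ, 1 / 8 ≤ s.re →
    ‖archLogDeriv a s‖ ≤ C * ‖s‖ ^ (3 / 4 : ℝ) ∧
    ‖deriv (archLogDeriv a) s‖ ≤ C * ‖s‖ ^ (-(1 / 2) : ℝ) := by
  obtain ⟨C, hC, hb⟩ := exists_norm_digamma_le (δ := 1 / 16) (by norm_num)
  have hlog : 0 < Real.log Real.pi := Real.log_pos (by linarith [Real.pi_gt_three])
  refine ⟨C * ((1 + 8 * a) / 2) ^ (3 / 4 : ℝ) + Real.log Real.pi / (1 / 8) ^ (3 / 4 : ℝ) +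
    C * (1 / 2) ^ (-(1 / 2) : ℝ), by positivity, fun s hs => ?_⟩
  have hsn : 1 / 8 ≤ ‖s‖ := hs.trans (re_le_norm s)
  have hs0 : 0 < ‖s‖ := by linarith
  have hv := hb ((s + a) / 2) (by simp; linarith)
  have hlow : 1 / 2 * ‖s‖ ≤ ‖(s + a) / 2‖ := by
    rw [norm_div, Complex.norm_ofNat]
    have : ‖s‖ ≤ ‖s + a‖ := by
      rw [← abs_norm s, ← abs_norm (s + a), ← sq_le_sq, Complex.sq_norm, Complex.sq_norm,
        normSq_apply, normSq_apply]
      simp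
      nlinarith
    linarith
  have hup : ‖(s + a) / 2‖ ≤ (1 + 8 * a) / 2 * ‖s‖ := by
    rw [norm_div, Complex.norm_ofNat]
    have : ‖s + a‖ ≤ ‖s‖ + a := by
      refine (norm_add_le _ _).trans ?_
      rw [norm_real, Real.norm_of_nonneg ha]
    nlinarith
  constructor
  · have h1 : ‖digamma ((s + a) / 2)‖ ≤ C * ((1 + 8 * a) / 2) ^ (3 / 4 : ℝ) * ‖s‖ ^ (3 / 4 : ℝ) := by
      refine hv.1.trans ?_
      rw [mul_assoc, ← Real.mul_rpow (by positivity) hs0.le]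
      gcongr
    have h2 : Real.log Real.pi ≤ Real.log Real.pi / (1 / 8) ^ (3 / 4 : ℝ) * ‖s‖ ^ (3 / 4 : ℝ) := by
      rw [div_mul_eq_mul_div, le_div_iff₀ (by positivity)]
      gcongr
    have h3 : ‖archLogDeriv a s‖ ≤ Real.log Real.pi + ‖digamma ((s + a) / 2)‖ := by
      unfold archLogDeriv
      refine (norm_add_le _ _).trans (add_le_add ?_ ?_)
      · rw [norm_div, norm_neg, norm_real, Real.norm_of_nonneg hlog.le, Complex.norm_ofNat]
        linarith
      · rw [norm_div, Complex.norm_ofNat]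
        linarith [norm_nonneg (digamma ((s + a) / 2))]
    have h4 : 0 ≤ C * (1 / 2) ^ (-(1 / 2) : ℝ) * ‖s‖ ^ (3 / 4 : ℝ) := by positivity
    linarith
  · rw [(hasDerivAt_archLogDeriv ha (by linarith)).deriv, norm_div, Complex.norm_ofNat]
    have h1 : ‖deriv digamma ((s + a) / 2)‖ ≤ C * (1 / 2) ^ (-(1 / 2) : ℝ) * ‖s‖ ^ (-(1 / 2) : ℝ) := by
      refine hv.2.trans ?_
      rw [mul_assoc, ← Real.mul_rpow (by positivity) hs0.le]
      have : ‖(s + a) / 2‖ ^ (-(1 / 2) : ℝ) ≤ (1 / 2 * ‖s‖) ^ (-(1 / 2) : ℝ) :=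
        Real.rpow_le_rpow_of_nonpos (by positivity) hlow (by norm_num)
      gcongr
    have h2 : 0 ≤ (C * ((1 + 8 * a) / 2) ^ (3 / 4 : ℝ) + Real.log Real.pi / (1 / 8) ^ (3 / 4 : ℝ)) *
      ‖s‖ ^ (-(1 / 2) : ℝ) := by positivity
    have h3 := norm_nonneg (deriv digamma ((s + a) / 2))
    linarith

theorem one_add_sq_le_norm_sq {c : ℝ} (hc : c ≠ 0) : ∃ κ : ℝ, 0 < κ ∧ ∀ t : ℝ,
    κ * (1 + t ^ 2) ^ (1 / 2 : ℝ) ≤ ‖(c + t * I : ℂ)‖ := by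
  refine ⟨min |c| 1, lt_min (abs_pos.2 hc) one_pos, fun t => ?_⟩
  set κ := min |c| 1
  have h0 : 0 ≤ κ := (lt_min (abs_pos.2 hc) one_pos).le
  rw [← Real.sqrt_eq_rpow, Complex.norm_add_mul_I]
  have hκc : κ ^ 2 ≤ c ^ 2 := by
    rw [← sq_abs c]
    exact pow_le_pow_left₀ h0 (min_le_left _ _) 2
  have hκ1 : κ ^ 2 ≤ 1 := by
    simpa using pow_le_pow_left₀ h0 (min_le_right |c| 1) 2
  refine Real.le_sqrt_of_sq_le ?_
  rw [mul_pow, Real.sq_sqrt (by positivity)]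
  nlinarith [sq_nonneg t]

/-- Oscillatory integrals with slowly varying amplitude `A t / (c + i t)`. -/
theorem tendsto_integral_div_mul_exp {A A' : ℝ → ℂ} (hA : ∀ t, HasDerivAt A (A' t) t)
    (hAc : Continuous A') {C : ℝ} (hb : ∀ t, ‖A t‖ ≤ C * (1 + t ^ 2) ^ (3 / 8 : ℝ))
    (hb' : ∀ t, ‖A' t‖ ≤ C * (1 + t ^ 2) ^ (-(1 / 4) : ℝ)) {c : ℝ} (hc : c ≠ 0) :
    ∃ D : ℝ, 0 ≤ D ∧ ∀ ℓ : ℝ, ℓ ≠ 0 → ∃ J : ℂ,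
      Tendsto (fun T : ℝ => ∫ t : ℝ in (-T)..T, A t / (c + t * I) * exp (ℓ * t * I)) atTop (𝓝 J) ∧
      ‖J‖ ≤ D / |ℓ| := by
  obtain ⟨κ, hκ, hlow⟩ := one_add_sq_le_norm_sq hc
  have hpos : ∀ t : ℝ, 0 < 1 + t ^ 2 := fun t => by positivity
  have hne : ∀ t : ℝ, (c + t * I : ℂ) ≠ 0 := fun t => by
    rw [← norm_pos_iff]
    refine lt_of_lt_of_le ?_ (hlow t)
    have := hpos t
    positivity
  have hC : 0 ≤ C := by
    have := (norm_nonneg _).trans (hb 0)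
    simpa using this
  set K : ℝ → ℂ := fun t => A t / (c + t * I)
  set K' : ℝ → ℂ := fun t => (A' t * (c + t * I) - A t * I) / (c + t * I) ^ 2
  have hK : ∀ t, HasDerivAt K (K' t) t := by
    intro t
    have h1 : HasDerivAt (fun t : ℝ => (c + t * I : ℂ)) I t := by
      simpa using (((hasDerivAt_id (t : ℂ)).comp_ofReal).mul_const I).const_add (c : ℂ)
    exact (hA t).div h1 (hne t)
  have hAcont : Continuous A := continuous_iff_continuousAt.2 fun t => (hA t).continuousAt
  have hK'c : Continuous K' :=
    Continuous.div (by fun_prop) (by fun_prop) fun t => pow_ne_zero 2 (hne t)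
  -- The exponent `-5/8` means decay like `|t|^(-5/4)`, which is integrable; `K` itself decays only
  -- like `|t|^(-1/4)`, hence the integration by parts.
  have hK'b : ∀ t, ‖K' t‖ ≤ (C / κ + C / κ ^ 2) * (1 + t ^ 2) ^ (-(5 / 8) : ℝ) := by
    intro t
    have hp := hpos t
    have hl := hlow t
    have hn : 0 < ‖(c + t * I : ℂ)‖ := norm_pos_iff.2 (hne t)
    have e : K' t = A' t / (c + t * I) - A t * I / (c + t * I) ^ 2 := by
      have := hne t
      simp only [K']
      field_simp
    rw [e]
    refine (norm_sub_le _ _).trans ?_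
    rw [norm_div, norm_div, norm_mul, norm_I, mul_one, norm_pow, add_mul]
    refine add_le_add ?_ ?_
    · calc ‖A' t‖ / ‖(c + t * I : ℂ)‖ ≤ C * (1 + t ^ 2) ^ (-(1 / 4) : ℝ) /
            (κ * (1 + t ^ 2) ^ (1 / 2 : ℝ)) := by
            gcongr
            exact hb' t
        _ = C / κ * (1 + t ^ 2) ^ (-(3 / 4) : ℝ) := by
            rw [show (-(3 / 4) : ℝ) = -(1 / 4) - 1 / 2 by norm_num, Real.rpow_sub hp]
            field_simp
        _ ≤ C / κ * (1 + t ^ 2) ^ (-(5 / 8) : ℝ) := by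
            refine mul_le_mul_of_nonneg_left (Real.rpow_le_rpow_of_exponent_le
              (by nlinarith [sq_nonneg t]) (by norm_num)) (by positivity)
    · calc ‖A t‖ / ‖(c + t * I : ℂ)‖ ^ 2 ≤ C * (1 + t ^ 2) ^ (3 / 8 : ℝ) /
            (κ * (1 + t ^ 2) ^ (1 / 2 : ℝ)) ^ 2 := by
            gcongr
            exact hb t
        _ = C / κ ^ 2 * (1 + t ^ 2) ^ (-(5 / 8) : ℝ) := by
            rw [mul_pow, ← Real.rpow_natCast ((1 + t ^ 2) ^ (1 / 2 : ℝ)), ← Real.rpow_mul hp.le,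
              show (-(5 / 8) : ℝ) = 3 / 8 - 1 / 2 * (2 : ℕ) by norm_num, Real.rpow_sub hp]
            field_simp
  have hintg : Integrable fun t : ℝ => (C / κ + C / κ ^ 2) * (1 + t ^ 2) ^ (-(5 / 8) : ℝ) := by
    refine Integrable.const_mul ?_ _
    have := integrable_rpow_neg_one_add_norm_sq (E := ℝ) (μ := volume) (r := 5 / 4) (by simp; norm_num)
    refine this.congr (ae_of_all _ fun t => ?_)
    simp only [Real.norm_eq_abs, sq_abs]
    norm_num
  have hK'i : Integrable K' := hintg.mono' hK'c.aestronglyMeasurable (ae_of_all _ hK'b)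
  have hKb : ∀ t, ‖K t‖ ≤ C / κ * (1 + t ^ 2) ^ (-(1 / 8) : ℝ) := by
    intro t
    have hp := hpos t
    have hl := hlow t
    rw [norm_div]
    calc ‖A t‖ / ‖(c + t * I : ℂ)‖ ≤ C * (1 + t ^ 2) ^ (3 / 8 : ℝ) /
          (κ * (1 + t ^ 2) ^ (1 / 2 : ℝ)) := by
          gcongr
          exact hb t
      _ = _ := by
          rw [show (-(1 / 8) : ℝ) = 3 / 8 - 1 / 2 by norm_num, Real.rpow_sub hp]
          field_simp
  have hlim : ∀ l : Filter ℝ, Tendsto (fun t : ℝ => t ^ 2) l atTop → Tendsto K l (𝓝 0) := by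
    intro l hl
    refine squeeze_zero_norm hKb ?_
    have h1 := (tendsto_rpow_neg_atTop (y := 1 / 8) (by norm_num)).comp
      (tendsto_atTop_add_const_left l 1 hl)
    simpa using h1.const_mul (C / κ)
  refine ⟨∫ t, ‖K' t‖, integral_nonneg fun _ => norm_nonneg _, fun ℓ hℓ => ?_⟩
  exact tendsto_integral_mul_exp hK hK'i hK'c (hlim _ (tendsto_pow_atTop two_ne_zero))
    (hlim _ ((tendsto_pow_atTop two_ne_zero).comp tendsto_abs_atBot_atTop |>.congr
      fun t => by simp)) hℓ

theorem norm_add_mul_I_sq_le {c t : ℝ} (hc : |c| ≤ 2) :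
    ‖(c + t * I : ℂ)‖ ≤ 2 * (1 + t ^ 2) ^ (1 / 2 : ℝ) := by
  rw [← Real.sqrt_eq_rpow, Complex.norm_add_mul_I, Real.sqrt_le_left (by positivity), mul_pow,
    Real.sq_sqrt (by positivity)]
  have : c ^ 2 ≤ 4 := by
    rw [← sq_abs]
    nlinarith [abs_nonneg c]
  nlinarith [sq_nonneg t]

/-- Oscillatory integrals of the archimedean factor along a vertical line. -/
theorem exists_tendsto_archLogDeriv_vertical {a : ℝ} (ha : 0 ≤ a) {b c σ : ℝ} (hb : 1 / 8 ≤ b)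
    (hb2 : b ≤ 2) (hc : c ≠ 0) (hσ : |σ| = 1) :
    ∃ D : ℝ, 0 ≤ D ∧ ∀ ℓ : ℝ, ℓ ≠ 0 → ∃ J : ℂ,
      Tendsto (fun T : ℝ => ∫ t : ℝ in (-T)..T,
        archLogDeriv a (b + (σ * t : ℝ) * I) * (exp (ℓ * (c + t * I)) / (c + t * I))) atTop (𝓝 J) ∧
      ‖J‖ ≤ D / |ℓ| * Real.exp (ℓ * c) := by
  obtain ⟨C, hC, hG⟩ := exists_norm_archLogDeriv_le ha
  obtain ⟨κ, hκ, hlow⟩ := one_add_sq_le_norm_sq (c := b) (by linarith)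
  have hσ2 : σ ^ 2 = 1 := by rw [← sq_abs, hσ, one_pow]
  have hre : ∀ t : ℝ, (b + (σ * t : ℝ) * I : ℂ).re = b := fun t => by simp
  have hder : ∀ t : ℝ, HasDerivAt (fun t : ℝ => archLogDeriv a (b + (σ * t : ℝ) * I))
      (deriv (archLogDeriv a) (b + (σ * t : ℝ) * I) * (σ * I)) t := by
    intro t
    have h1 : HasDerivAt (fun t : ℝ => (b + (σ * t : ℝ) * I : ℂ)) (σ * I) t := by
      have := ((((hasDerivAt_id (t : ℂ)).comp_ofReal).const_mul (σ : ℂ)).mul_const I).const_add (b : ℂ)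
      simpa using this
    have h2 := (hasDerivAt_archLogDeriv ha (s := b + (σ * t : ℝ) * I)
      (by rw [hre]; linarith)).differentiableAt.hasDerivAt
    exact HasDerivAt.comp (h₂ := archLogDeriv a) (h := fun t : ℝ => (b + (σ * t : ℝ) * I : ℂ)) t h2 h1
  have hU : IsOpen {z : ℂ | 0 < z.re} := isOpen_lt continuous_const continuous_re
  have hdc : ContinuousOn (deriv (archLogDeriv a)) {z : ℂ | 0 < z.re} := by
    refine (DifferentiableOn.deriv (fun z hz => ?_) hU).continuousOn
    exact (hasDerivAt_archLogDeriv ha hz).differentiableAt.differentiableWithinAt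
  have hcont : Continuous fun t : ℝ =>
      deriv (archLogDeriv a) (b + (σ * t : ℝ) * I) * (σ * I) := by
    refine Continuous.mul (hdc.comp_continuous (by fun_prop) fun t => ?_) continuous_const
    change 0 < (b + (σ * t : ℝ) * I : ℂ).re
    rw [hre]
    linarith
  have hpos : ∀ t : ℝ, 0 < 1 + t ^ 2 := fun t => by positivity
  have hsq : ∀ t : ℝ, (σ * t) ^ 2 = t ^ 2 := fun t => by rw [mul_pow, hσ2, one_mul]
  have hb₁ : ∀ t : ℝ, ‖archLogDeriv a (b + (σ * t : ℝ) * I)‖ ≤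
      (C * 2 ^ (3 / 4 : ℝ) + C * κ ^ (-(1 / 2) : ℝ)) * (1 + t ^ 2) ^ (3 / 8 : ℝ) := by
    intro t
    have hp := hpos t
    refine (hG _ (by rw [hre]; exact hb)).1.trans ?_
    have h1 := norm_add_mul_I_sq_le (c := b) (t := σ * t) (by rw [abs_of_pos (by linarith)]; exact hb2)
    rw [hsq] at h1
    calc C * ‖(b + (σ * t : ℝ) * I : ℂ)‖ ^ (3 / 4 : ℝ)
        ≤ C * (2 * (1 + t ^ 2) ^ (1 / 2 : ℝ)) ^ (3 / 4 : ℝ) := by gcongr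
      _ = C * 2 ^ (3 / 4 : ℝ) * (1 + t ^ 2) ^ (3 / 8 : ℝ) := by
          rw [Real.mul_rpow (by norm_num) (by positivity), ← Real.rpow_mul hp.le]
          norm_num
          ring
      _ ≤ _ := mul_le_mul_of_nonneg_right (le_add_of_nonneg_right (by positivity)) (by positivity)
  have hb₂ : ∀ t : ℝ, ‖deriv (archLogDeriv a) (b + (σ * t : ℝ) * I) * (σ * I)‖ ≤
      (C * 2 ^ (3 / 4 : ℝ) + C * κ ^ (-(1 / 2) : ℝ)) * (1 + t ^ 2) ^ (-(1 / 4) : ℝ) := by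
    intro t
    have hp := hpos t
    have h1 := hlow (σ * t)
    rw [hsq] at h1
    rw [norm_mul, norm_mul, norm_I, mul_one, norm_real, Real.norm_eq_abs, hσ, mul_one]
    refine (hG _ (by rw [hre]; exact hb)).2.trans ?_
    calc C * ‖(b + (σ * t : ℝ) * I : ℂ)‖ ^ (-(1 / 2) : ℝ)
        ≤ C * (κ * (1 + t ^ 2) ^ (1 / 2 : ℝ)) ^ (-(1 / 2) : ℝ) :=
          mul_le_mul_of_nonneg_left (Real.rpow_le_rpow_of_nonpos (by positivity) h1 (by norm_num))
            hC.le
      _ = C * κ ^ (-(1 / 2) : ℝ) * (1 + t ^ 2) ^ (-(1 / 4) : ℝ) := by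
          rw [Real.mul_rpow hκ.le (by positivity), ← Real.rpow_mul hp.le]
          norm_num
          ring
      _ ≤ _ := mul_le_mul_of_nonneg_right (le_add_of_nonneg_left (by positivity)) (by positivity)
  obtain ⟨D, hD, hJ⟩ := tendsto_integral_div_mul_exp hder hcont hb₁ hb₂ hc
  refine ⟨D, hD, fun ℓ hℓ => ?_⟩
  obtain ⟨J, hJt, hJb⟩ := hJ ℓ hℓ
  refine ⟨Real.exp (ℓ * c) * J, ?_, ?_⟩
  · refine (hJt.const_mul (Real.exp (ℓ * c) : ℂ)).congr fun T => ?_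
    rw [← intervalIntegral.integral_const_mul]
    refine intervalIntegral.integral_congr fun t _ => ?_
    rw [mul_add, exp_add, ofReal_exp]
    push_cast
    rw [mul_assoc (ℓ : ℂ) t I]
    ring
  · rw [norm_mul, norm_real, Real.norm_of_nonneg (Real.exp_pos _).le, mul_comm]
    gcongr

/-- The archimedean contribution on the line `Re s = 3/2`, moved to `Re s = 1/8`. -/
theorem tendsto_archLogDeriv_shift {a : ℝ} (ha : 0 ≤ a) {ℓ : ℝ} (hℓ : 0 < ℓ) {J : ℂ}
    (hJ : Tendsto (fun T : ℝ => ∫ t : ℝ in (-T)..T, archLogDeriv a ((1 / 8 : ℝ) + t * I) *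
      (exp (ℓ * ((1 / 8 : ℝ) + t * I)) / ((1 / 8 : ℝ) + t * I))) atTop (𝓝 J)) :
    Tendsto (fun T : ℝ => ∫ t : ℝ in (-T)..T, archLogDeriv a ((3 / 2 : ℝ) + t * I) *
      (exp (ℓ * ((3 / 2 : ℝ) + t * I)) / ((3 / 2 : ℝ) + t * I))) atTop (𝓝 J) := by
  obtain ⟨C, hC, hG⟩ := exists_norm_archLogDeriv_le ha
  set F : ℂ → ℂ := fun s => archLogDeriv a s * (exp (ℓ * s) / s) with hF
  have hrect : ∀ T : ℝ, 0 < T → rectIntegral F (1 / 8) (3 / 2) (-T) T = 0 := by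
    intro T hT
    refine rectIntegral_eq_zero (by norm_num) (by linarith) fun s hs => ?_
    have h1 : 0 < s.re := lt_of_lt_of_le (by norm_num) hs.1.1
    have h2 : s ≠ 0 := by
      rintro rfl
      simp at h1
    refine ((hasDerivAt_archLogDeriv ha h1).differentiableAt.mul ?_).differentiableWithinAt
    exact DifferentiableAt.div (by fun_prop) (by fun_prop) h2
  have hhor : ∀ (y : ℝ), 0 < |y| → ‖∫ x : ℝ in (1 / 8 : ℝ)..(3 / 2), F (x + y * I)‖ ≤
      C * Real.exp (ℓ * (3 / 2)) * |y| ^ (-(1 / 4) : ℝ) * |3 / 2 - 1 / 8| := by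
    intro y hy
    refine intervalIntegral.norm_integral_le_of_norm_le_const fun x hx => ?_
    rw [Set.uIoc_of_le (by norm_num)] at hx
    have hyn : |y| ≤ ‖(x + y * I : ℂ)‖ := by simpa using abs_im_le_norm (x + y * I : ℂ)
    have hn : 0 < ‖(x + y * I : ℂ)‖ := hy.trans_le hyn
    simp only [hF]
    rw [norm_mul, norm_div, norm_exp_mul_add_mul_I]
    have h1 := (hG (x + y * I) (by simpa using hx.1.le)).1
    calc ‖archLogDeriv a (x + y * I)‖ * (Real.exp (ℓ * x) / ‖(x + y * I : ℂ)‖)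
        ≤ C * ‖(x + y * I : ℂ)‖ ^ (3 / 4 : ℝ) * (Real.exp (ℓ * (3 / 2)) / ‖(x + y * I : ℂ)‖) := by
          gcongr
          exact hx.2
      _ = C * Real.exp (ℓ * (3 / 2)) * ‖(x + y * I : ℂ)‖ ^ (-(1 / 4) : ℝ) := by
          rw [show (-(1 / 4) : ℝ) = 3 / 4 - 1 by norm_num, Real.rpow_sub hn, Real.rpow_one]
          field_simp
      _ ≤ _ := by
          have := Real.rpow_le_rpow_of_nonpos hy hyn (show (-(1 / 4) : ℝ) ≤ 0 by norm_num)
          gcongr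
  have hlim : ∀ ε : ℝ, |ε| = 1 →
      Tendsto (fun T : ℝ => ∫ x : ℝ in (1 / 8 : ℝ)..(3 / 2), F (x + (ε * T : ℝ) * I)) atTop (𝓝 0) := by
    intro ε hε
    have h1 : Tendsto (fun T : ℝ => C * Real.exp (ℓ * (3 / 2)) * T ^ (-(1 / 4) : ℝ) *
        |(3 / 2 - 1 / 8 : ℝ)|) atTop (𝓝 0) := by
      have := ((tendsto_rpow_neg_atTop (y := 1 / 4) (by norm_num)).const_mul
        (C * Real.exp (ℓ * (3 / 2)))).mul_const |(3 / 2 - 1 / 8 : ℝ)|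
      simpa using this
    refine squeeze_zero_norm' ?_ h1
    filter_upwards [eventually_gt_atTop 0] with T hT
    have h2 : |ε * T| = T := by rw [abs_mul, hε, one_mul, abs_of_pos hT]
    have := hhor (ε * T) (by rw [h2]; exact hT)
    rwa [h2] at this
  have h1 := hlim (-1) (by simp)
  have h2 := hlim 1 (by simp)
  have h3 := hJ.add ((h1.sub h2).const_mul I)
  rw [sub_zero, mul_zero, add_zero] at h3
  refine h3.congr' ?_
  filter_upwards [eventually_gt_atTop 0] with T hT
  have h4 := hrect T hT
  simp only [rectIntegral] at h4
  have h5 : (∫ t : ℝ in (-T)..T, F ((3 / 2 : ℝ) + t * I)) =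
      (∫ t : ℝ in (-T)..T, F ((1 / 8 : ℝ) + t * I)) + I * ((∫ x : ℝ in (1 / 8 : ℝ)..(3 / 2),
        F (x + (-T : ℝ) * I)) - ∫ x : ℝ in (1 / 8 : ℝ)..(3 / 2), F (x + T * I)) := by
    linear_combination (-I) * h4 + ((∫ t : ℝ in (-T)..T, F ((3 / 2 : ℝ) + t * I)) -
      (∫ t : ℝ in (-T)..T, F ((1 / 8 : ℝ) + t * I))) * I_sq
  simp only [neg_one_mul, one_mul]
  exact h5.symm

/-- The two archimedean contributions to the explicit formula. -/
theorem exists_archimedean_terms {a : ℝ} (ha : 0 ≤ a) : ∃ D : ℝ, 0 ≤ D ∧ ∀ ℓ : ℝ,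
    Real.log (3 / 2) ≤ ℓ → ∃ J₁ J₂ : ℂ,
      Tendsto (fun T : ℝ => ∫ t : ℝ in (-T)..T, archLogDeriv a ((3 / 2 : ℝ) + t * I) *
        (exp (ℓ * ((3 / 2 : ℝ) + t * I)) / ((3 / 2 : ℝ) + t * I))) atTop (𝓝 J₁) ∧
      Tendsto (fun T : ℝ => ∫ t : ℝ in (-T)..T, archLogDeriv a ((3 / 2 : ℝ) + (-t : ℝ) * I) *
        (exp (ℓ * ((-1 / 2 : ℝ) + t * I)) / ((-1 / 2 : ℝ) + t * I))) atTop (𝓝 J₂) ∧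
      ‖J₁ + J₂‖ ≤ D * Real.exp (ℓ / 8) := by
  -- The first integral is estimated on `Re s = 1/8`, which is where `exp (ℓ/8)` comes from. The
  -- second carries `exp (-ℓ/2)`; its `σ = -1` records the reflection `s ↦ 1 - s`. The condition
  -- `log (3/2) ≤ ℓ` keeps `1/ℓ` bounded.
  obtain ⟨D₁, hD₁, h₁⟩ := exists_tendsto_archLogDeriv_vertical ha (b := 1 / 8) (c := 1 / 8) (σ := 1)
    le_rfl (by norm_num) (by norm_num) (by simp)
  obtain ⟨D₂, hD₂, h₂⟩ := exists_tendsto_archLogDeriv_vertical ha (b := 3 / 2) (c := -1 / 2) (σ := -1)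
    (by norm_num) (by norm_num) (by norm_num) (by simp)
  have hlog : 0 < Real.log (3 / 2) := Real.log_pos (by norm_num)
  refine ⟨(D₁ + D₂) / Real.log (3 / 2), by positivity, fun ℓ hℓ => ?_⟩
  have hℓ0 : 0 < ℓ := hlog.trans_le hℓ
  obtain ⟨J₁, ht₁, hb₁⟩ := h₁ ℓ hℓ0.ne'
  obtain ⟨J₂, ht₂, hb₂⟩ := h₂ ℓ hℓ0.ne'
  refine ⟨J₁, J₂, tendsto_archLogDeriv_shift ha hℓ0 (by simpa only [one_mul] using ht₁),
    by simpa only [neg_one_mul] using ht₂, (norm_add_le _ _).trans ?_⟩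
  rw [abs_of_pos hℓ0] at hb₁ hb₂
  calc ‖J₁‖ + ‖J₂‖ ≤ D₁ / Real.log (3 / 2) * Real.exp (ℓ / 8) +
      D₂ / Real.log (3 / 2) * Real.exp (ℓ / 8) := by
        refine add_le_add (hb₁.trans ?_) (hb₂.trans ?_)
        · gcongr
          linarith
        · gcongr
          linarith
    _ = _ := by ring

end ArchimedeanTerms

/-! ### Growth of `L(s, χ)`, its zeros and its logarithmic derivative in fixed discs. -/

section LocalBounds

open Complex MeasureTheory

variable {q : ℕ} [NeZero q]

theorem sum_range_period {χ : DirichletCharacter ℂ q} (hχ : χ ≠ 1) :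
    ∑ k ∈ Finset.range q, χ (k : ZMod q) = 0 := by
  rw [← χ.sum_eq_zero_of_ne_one hχ]
  refine Finset.sum_bij' (fun k _ => (k : ZMod q)) (fun a _ => a.val) (by simp)
    (fun a _ => Finset.mem_range.2 (ZMod.val_lt a)) ?_ ?_ (by simp)
  · intro k hk
    exact ZMod.val_cast_of_lt (Finset.mem_range.1 hk)
  · intro a _
    exact ZMod.natCast_zmod_val a

/-- The sum over a full period vanishes, so the partial sums are periodic in `n` and only fewer than
`q` terms matter. -/
theorem norm_sum_range_le {χ : DirichletCharacter ℂ q} (hχ : χ ≠ 1) (n : ℕ) :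
    ‖∑ k ∈ Finset.range n, χ (k : ZMod q)‖ ≤ q := by
  have hper : Function.Periodic (fun n : ℕ => ∑ k ∈ Finset.range n, χ (k : ZMod q)) q := by
    intro n
    induction n with
    | zero => simpa using sum_range_period hχ
    | succ n ih =>
      simp only at ih ⊢
      rw [show n + 1 + q = (n + q) + 1 by ring, Finset.sum_range_succ, Finset.sum_range_succ, ih]
      simp
  have h := hper.map_mod_nat n
  rw [← h]
  refine (norm_sum_le _ _).trans ((Finset.sum_le_card_nsmul _ _ 1
    fun k _ => χ.norm_le_one _).trans ?_)
  simp only [Finset.card_range, nsmul_eq_mul, mul_one]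
  exact_mod_cast (Nat.mod_lt n (NeZero.pos q)).le

theorem norm_sum_Icc_le {χ : DirichletCharacter ℂ q} (hχ : χ ≠ 1) (n : ℕ) :
    ‖∑ k ∈ Finset.Icc 1 n, χ (k : ZMod q)‖ ≤ 2 * q := by
  have h1 : ∑ k ∈ Finset.range (n + 1), χ (k : ZMod q) =
      χ ((0 : ℕ) : ZMod q) + ∑ k ∈ Finset.Icc 1 n, χ (k : ZMod q) := by
    rw [Finset.range_eq_Ico, Finset.sum_eq_sum_Ico_succ_bot (Nat.succ_pos n)]
    rfl
  have h2 := norm_sum_range_le hχ (n + 1)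
  have h3 : ‖χ ((0 : ℕ) : ZMod q)‖ ≤ 1 := χ.norm_le_one _
  have h4 : (1 : ℝ) ≤ q := by exact_mod_cast NeZero.one_le
  have h5 : ∑ k ∈ Finset.Icc 1 n, χ (k : ZMod q) =
      ∑ k ∈ Finset.range (n + 1), χ (k : ZMod q) - χ ((0 : ℕ) : ZMod q) := by rw [h1]; ring
  rw [h5]
  exact (norm_sub_le _ _).trans (by linarith)

/-- Polynomial growth of Dirichlet `L`-functions to the right of the imaginary axis. -/
theorem norm_LFunction_le {χ : DirichletCharacter ℂ q} (hχ : χ ≠ 1) {s : ℂ} (hs : 0 < s.re) :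
    ‖χ.LFunction s‖ ≤ 2 * q * ‖s‖ / s.re := by
  -- Abel summation gives `L(s, χ) = s ∫ A(t) t^(-s-1) dt` over `t > 1` for `Re s > 1`. Since `A` is
  -- bounded, the integral is holomorphic for `Re s > 0` (as a Mellin transform at `-s`), and the
  -- identity theorem extends the formula.
  set A : ℝ → ℂ := fun t => ∑ k ∈ Finset.Icc 1 ⌊t⌋₊, χ (k : ZMod q) with hA
  have hAb : ∀ t, ‖A t‖ ≤ 2 * q := fun t => norm_sum_Icc_le hχ _
  have hAm : Measurable A :=
    (measurable_of_countable fun n : ℕ => ∑ k ∈ Finset.Icc 1 n, χ (k : ZMod q)).comp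
      Nat.measurable_floor
  set f : ℝ → ℂ := (Set.Ioi (1 : ℝ)).indicator A with hf
  have hfb : ∀ t, ‖f t‖ ≤ 2 * q := by
    intro t
    refine (norm_indicator_le_norm_self _ _).trans (hAb t)
  have hfm : Measurable f := hAm.indicator measurableSet_Ioi
  have hloc : LocallyIntegrableOn f (Set.Ioi 0) := by
    refine LocallyIntegrable.locallyIntegrableOn (fun x => ?_) _
    refine ⟨Set.Ioo (x - 1) (x + 1), Ioo_mem_nhds (by linarith) (by linarith), ?_⟩
    exact Measure.integrableOn_of_bounded (M := 2 * q) (by simp) hfm.aestronglyMeasurable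
      (ae_of_all _ hfb)
  have hmel : ∀ z : ℂ, mellin f (-z) =
      ∫ t in Set.Ioi (1 : ℝ), A t * (t : ℂ) ^ (-(z + 1)) := by
    intro z
    rw [mellin]
    have : ∀ t : ℝ, (t : ℂ) ^ (-z - 1) • f t =
        (Set.Ioi (1 : ℝ)).indicator (fun t => A t * (t : ℂ) ^ (-(z + 1))) t := by
      intro t
      by_cases ht : t ∈ Set.Ioi (1 : ℝ)
      · rw [hf, Set.indicator_of_mem ht, Set.indicator_of_mem ht, smul_eq_mul, mul_comm]
        ring_nf
      · rw [hf, Set.indicator_of_notMem ht, Set.indicator_of_notMem ht, smul_zero]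
    simp_rw [this]
    rw [setIntegral_indicator measurableSet_Ioi,
      Set.inter_eq_right.2 (Set.Ioi_subset_Ioi zero_le_one)]
  have hdiff : ∀ z : ℂ, 0 < z.re → DifferentiableAt ℂ (mellin f) (-z) := by
    intro z hz
    refine mellin_differentiableAt_of_isBigO_rpow (a := 0) (b := -z.re - 1) hloc ?_ (by simpa) ?_
      (by simp)
    · simp only [neg_zero, Real.rpow_zero]
      exact Asymptotics.isBigO_of_le' (c := 2 * q) _ fun t => by simpa using hfb t
    · refine Asymptotics.IsBigO.of_bound 0 ?_
      filter_upwards [nhdsWithin_le_nhds (gt_mem_nhds zero_lt_one)] with t ht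
      rw [hf, Set.indicator_of_notMem (by simpa using ht.le)]
      simp
  have hU : IsOpen {z : ℂ | 0 < z.re} := isOpen_lt continuous_const continuous_re
  have heq : χ.LFunction s = s * mellin f (-s) := by
    have hL : AnalyticOnNhd ℂ χ.LFunction {z : ℂ | 0 < z.re} :=
      (DirichletCharacter.differentiable_LFunction hχ).differentiableOn.analyticOnNhd hU
    have hM : AnalyticOnNhd ℂ (fun z => z * mellin f (-z)) {z : ℂ | 0 < z.re} := by
      refine DifferentiableOn.analyticOnNhd (fun z hz => ?_) hU
      refine (DifferentiableAt.mul differentiableAt_id ?_).differentiableWithinAt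
      exact (hdiff z hz).comp z differentiableAt_id.neg
    have hpc : IsPreconnected {z : ℂ | 0 < z.re} :=
      (convex_halfSpace_re_gt 0).isPreconnected
    refine hL.eqOn_of_preconnected_of_eventuallyEq hM hpc (z₀ := 2) (by simp) ?_ hs
    filter_upwards [(isOpen_lt continuous_const continuous_re).mem_nhds
      (show (1 : ℝ) < (2 : ℂ).re by simp)] with z hz
    rw [DirichletCharacter.LFunction_eq_LSeries χ hz, hmel,
      LSeries_eq_mul_integral _ le_rfl (zero_lt_one.trans hz)
        (χ.LSeriesSummable_of_one_lt_re hz) ?_]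
    simp only [Real.rpow_zero]
    exact Asymptotics.isBigO_of_le' (c := 2 * q) _ fun n => by simpa using norm_sum_Icc_le hχ n
  rw [heq, hmel, norm_mul]
  have hIntegrable : ‖∫ t in Set.Ioi (1 : ℝ), A t * (t : ℂ) ^ (-(s + 1))‖ ≤ 2 * q / s.re := by
    have hi : IntegrableOn (fun t : ℝ => 2 * q * t ^ (-(s.re + 1))) (Set.Ioi 1) :=
      (integrableOn_Ioi_rpow_of_lt (by linarith) zero_lt_one).const_mul _
    refine (norm_integral_le_of_norm_le hi ?_).trans (le_of_eq ?_)
    · filter_upwards [self_mem_ae_restrict measurableSet_Ioi] with t ht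
      have ht0 : (0 : ℝ) < t := zero_lt_one.trans ht
      rw [norm_mul, norm_cpow_eq_rpow_re_of_pos ht0]
      simp only [neg_re, add_re, one_re]
      have := Real.rpow_nonneg ht0.le (-(s.re + 1))
      gcongr
      exact hAb t
    · rw [integral_const_mul, integral_Ioi_rpow_of_lt (by linarith) zero_lt_one, Real.one_rpow]
      have : s.re ≠ 0 := hs.ne'
      rw [show -(s.re + 1) + 1 = -s.re by ring]
      field_simp
  calc ‖s‖ * ‖∫ t in Set.Ioi (1 : ℝ), A t * (t : ℂ) ^ (-(s + 1))‖ ≤ ‖s‖ * (2 * q / s.re) := by gcongr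
    _ = _ := by ring

/-- `|L - 1| ≤ ζ(2) - 1 ≤ 3/4`. This is the lower bound at the centre required by Jensen's
inequality. -/
theorem one_quarter_le_norm_LFunction (χ : DirichletCharacter ℂ q) {s : ℂ} (hs : s.re = 2) :
    1 / 4 ≤ ‖χ.LFunction s‖ := by
  have hs1 : 1 < s.re := by rw [hs]; norm_num
  have hz := hasSum_zeta_two
  have hsum := χ.LSeriesSummable_of_one_lt_re hs1
  have hL := DirichletCharacter.LFunction_eq_LSeries χ hs1
  set F := LSeries.term (fun n => χ (n : ZMod q)) s
  have hF1 : F 1 = 1 := by simp [F]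
  have hF0 : F 0 = 0 := by simp [F]
  have hb : ∀ n, ‖F n‖ ≤ 1 / (n : ℝ) ^ 2 := by
    intro n
    rcases eq_or_ne n 0 with rfl | hn
    · simp [hF0]
    · simp only [F]
      rw [LSeries.norm_term_eq, if_neg hn, hs, Real.rpow_two]
      gcongr
      exact χ.norm_le_one _
  have h1 : LSeries (fun n => χ (n : ZMod q)) s = 1 + ∑' n, F (n + 2) := by
    rw [LSeries, ← hsum.sum_add_tsum_nat_add 2]
    simp [Finset.sum_range_succ, F, LSeries.term]
  have h2 : Summable fun n : ℕ => 1 / (((n + 2 : ℕ) : ℝ)) ^ 2 :=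
    (summable_nat_add_iff 2).2 hz.summable
  have h3 : ∑' n : ℕ, 1 / (((n + 2 : ℕ) : ℝ)) ^ 2 = Real.pi ^ 2 / 6 - 1 := by
    have := hz.summable.sum_add_tsum_nat_add 2
    rw [hz.tsum_eq] at this
    simp [Finset.sum_range_succ] at this ⊢
    linarith
  have h4 : ‖∑' n, F (n + 2)‖ ≤ Real.pi ^ 2 / 6 - 1 := by
    rw [← h3]
    exact tsum_of_norm_bounded h2.hasSum fun n => hb (n + 2)
  have h5 : Real.pi ^ 2 / 6 - 1 ≤ 3 / 4 := by
    have := Real.pi_lt_d2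
    nlinarith [Real.pi_pos]
  rw [hL, h1]
  have h6 := norm_sub_norm_le (1 : ℂ) (-∑' n, F (n + 2))
  rw [norm_one, norm_neg, sub_neg_eq_add] at h6
  linarith

/-- Growth of `L` in discs around `2 + iT`. -/
theorem norm_LFunction_le_of_mem_closedBall {χ : DirichletCharacter ℂ q} (hχ : χ ≠ 1) {c z : ℂ}
    (hc : c.re = 2) (hz : z ∈ Metric.closedBall c (9 / 5)) :
    ‖χ.LFunction z‖ ≤ 10 * q * (|c.im| + 4) := by
  have h1 : ‖z - c‖ ≤ 9 / 5 := by simpa [dist_eq_norm] using hz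
  have h2 := (abs_le.1 ((abs_re_le_norm (z - c)).trans h1)).1
  simp only [sub_re, hc] at h2
  have h3 : ‖c‖ ≤ 2 + |c.im| := by
    refine (norm_le_abs_re_add_abs_im c).trans ?_
    rw [hc]
    norm_num
  have h4 : ‖z‖ ≤ |c.im| + 4 := by
    calc ‖z‖ = ‖(z - c) + c‖ := by rw [sub_add_cancel]
      _ ≤ _ := norm_add_le _ _
      _ ≤ _ := by linarith
  refine (norm_LFunction_le hχ (by linarith)).trans ?_
  rw [div_le_iff₀ (by linarith)]
  have h5 : (0 : ℝ) ≤ q := q.cast_nonneg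
  have h6 := abs_nonneg c.im
  calc 2 * q * ‖z‖ ≤ 2 * q * (|c.im| + 4) := by gcongr
    _ = 10 * q * (|c.im| + 4) * (1 / 5) := by ring
    _ ≤ _ := by
      gcongr
      linarith

/-- Discs about `2 + iT` with radii `3/2 < 8/5 < 9/5`: the smallest reaches `Re s = 1/2`, and the
largest stays in `Re s ≥ 1/5`, where the growth bound holds. The constant may depend on `χ`, since
it is only used to pass to limits in the height. -/
theorem exists_logDeriv_LFunction_bounds {χ : DirichletCharacter ℂ q} (hχ : χ ≠ 1) :
    ∃ C : ℝ, 0 < C ∧ (∀ c : ℂ, c.re = 2 → ∀ Z : Finset ℂ,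
        (∀ p ∈ Z, p ∈ Metric.closedBall c (8 / 5)) →
        ∑ p ∈ Z, (analyticOrderNatAt χ.LFunction p : ℝ) ≤ C * Real.log (|c.im| + 4)) ∧
      ∀ c : ℂ, c.re = 2 → ∀ δ : ℝ, 0 < δ → δ ≤ 1 → ∀ s ∈ Metric.closedBall c (3 / 2),
        (∀ p ∈ Metric.closedBall c (8 / 5), χ.LFunction p = 0 → δ ≤ ‖s - p‖) →
        ‖logDeriv χ.LFunction s‖ ≤ C * Real.log (|c.im| + 4) / δ := by
  obtain ⟨C, hC, hb⟩ := exists_norm_logDeriv_le (r := 3 / 2) (r' := 8 / 5) (R := 9 / 5)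
    (by norm_num) (by norm_num) (by norm_num) (by norm_num)
  have hq1 : (1 : ℝ) ≤ q := by exact_mod_cast NeZero.one_le
  have hq0 : (0 : ℝ) < q := by linarith
  have hent := DirichletCharacter.differentiable_LFunction hχ
  have hlog1 : ∀ y : ℝ, 1 ≤ Real.log (|y| + 4) := by
    intro y
    rw [Real.le_log_iff_exp_le (by positivity)]
    have := Real.exp_one_lt_d9
    have := abs_nonneg y
    linarith
  set E := Real.log (40 * q) + 1 with hE
  have hE0 : 0 < E := by
    have := Real.log_nonneg (show (1 : ℝ) ≤ 40 * q by linarith)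
    linarith
  have key : ∀ c : ℂ, c.re = 2 → χ.LFunction c ≠ 0 ∧ 1 ≤ 10 * q * (|c.im| + 4) ∧
      Real.exp 1 * ‖χ.LFunction c‖ ≤ 10 * q * (|c.im| + 4) ∧
      Real.log (10 * q * (|c.im| + 4) / ‖χ.LFunction c‖) ≤ E * Real.log (|c.im| + 4) := by
    intro c hc
    have h1 := one_quarter_le_norm_LFunction χ hc
    have h0 : 0 < ‖χ.LFunction c‖ := by linarith
    have ha := abs_nonneg c.im
    refine ⟨norm_pos_iff.1 h0, by nlinarith, ?_, ?_⟩
    · have h2 := norm_LFunction_le hχ (s := c) (by rw [hc]; norm_num)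
      have h3 : ‖c‖ ≤ 2 + |c.im| := by
        refine (norm_le_abs_re_add_abs_im c).trans ?_
        rw [hc]
        norm_num
      rw [hc] at h2
      have h4 : ‖χ.LFunction c‖ ≤ q * (2 + |c.im|) := by
        refine h2.trans ?_
        rw [div_le_iff₀ (by norm_num)]
        nlinarith
      have h5 := Real.exp_one_lt_d9
      calc Real.exp 1 * ‖χ.LFunction c‖ ≤ 10 * (q * (2 + |c.im|)) := by
            gcongr
            linarith
        _ ≤ _ := by nlinarith
    · have h2 : 10 * q * (|c.im| + 4) / ‖χ.LFunction c‖ ≤ 40 * q * (|c.im| + 4) := by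
        rw [div_le_iff₀ h0]
        have : 0 ≤ 40 * q * (|c.im| + 4) := by positivity
        nlinarith
      refine (Real.log_le_log (by positivity) h2).trans ?_
      rw [Real.log_mul (by positivity) (by positivity)]
      have h3 := hlog1 c.im
      have h4 := Real.log_nonneg (show (1 : ℝ) ≤ 40 * q by linarith)
      rw [hE]
      nlinarith
  have hR : 0 < Real.log ((9 / 5 : ℝ) / (8 / 5)) := Real.log_pos (by norm_num)
  refine ⟨E / Real.log ((9 / 5 : ℝ) / (8 / 5)) + C * E, by positivity, ?_, ?_⟩
  · intro c hc Z hZ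
    obtain ⟨h1, h2, h3, h4⟩ := key c hc
    have := sum_analyticOrderNatAt_le hent h1 (r := 8 / 5) (R := 9 / 5) (by norm_num) (by norm_num)
      h2 (fun z hz => norm_LFunction_le_of_mem_closedBall hχ hc hz) Z hZ
    refine this.trans ?_
    have h5 := hlog1 c.im
    calc Real.log (10 * q * (|c.im| + 4) / ‖χ.LFunction c‖) / Real.log ((9 / 5 : ℝ) / (8 / 5))
        ≤ E * Real.log (|c.im| + 4) / Real.log ((9 / 5 : ℝ) / (8 / 5)) := by gcongr
      _ = E / Real.log ((9 / 5 : ℝ) / (8 / 5)) * Real.log (|c.im| + 4) := by ring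
      _ ≤ _ := mul_le_mul_of_nonneg_right (le_add_of_nonneg_right (by positivity)) (by linarith)
  · intro c hc δ hδ hδ1 s hs hsp
    obtain ⟨h1, h2, h3, h4⟩ := key c hc
    refine (hb _ hent c _ h1 h2 h3 (fun z hz => norm_LFunction_le_of_mem_closedBall hχ hc hz) δ hδ
      hδ1 s hs hsp).trans ?_
    have h5 := hlog1 c.im
    refine div_le_div_of_nonneg_right ?_ hδ.le
    calc C * Real.log (10 * q * (|c.im| + 4) / ‖χ.LFunction c‖)
        ≤ C * (E * Real.log (|c.im| + 4)) := by gcongr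
      _ = C * E * Real.log (|c.im| + 4) := by ring
      _ ≤ _ := mul_le_mul_of_nonneg_right (le_add_of_nonneg_left (by positivity)) (by linarith)

end LocalBounds

/-! ### The completed `L`-function and its functional equation. -/

section CompletedLFunction

open Complex MeasureTheory DirichletCharacter

variable {q : ℕ}

open Classical in
/-- The shift in the archimedean factor of `χ`: `0` for even and `1` for odd characters. -/
def archParity (χ : DirichletCharacter ℂ q) : ℝ := if χ.Even then 0 else 1

theorem archParity_nonneg (χ : DirichletCharacter ℂ q) : 0 ≤ archParity χ := by
  unfold archParity
  split_ifs <;> norm_num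

theorem archParity_eq_zero_or_one (χ : DirichletCharacter ℂ q) :
    archParity χ = 0 ∨ archParity χ = 1 := by
  unfold archParity
  split_ifs <;> simp

theorem archParity_inv (χ : DirichletCharacter ℂ q) : archParity χ⁻¹ = archParity χ := by
  have : χ⁻¹.Even ↔ χ.Even := by
    unfold DirichletCharacter.Even
    rw [MulChar.inv_apply_eq_inv]
    simp
  unfold archParity
  by_cases h : χ.Even
  · rw [if_pos h, if_pos (this.2 h)]
  · rw [if_neg h, if_neg (mt this.1 h)]

theorem gammaFactor_eq (χ : DirichletCharacter ℂ q) (s : ℂ) :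
    gammaFactor χ s = Gammaℝ (s + archParity χ) := by
  unfold gammaFactor archParity
  split_ifs <;> simp

theorem inv_ne_one_of_ne_one {χ : DirichletCharacter ℂ q} (hχ : χ ≠ 1) : χ⁻¹ ≠ 1 := by
  simpa using hχ

theorem gammaFactor_ne_zero (χ : DirichletCharacter ℂ q) {s : ℂ} (hs : 0 < s.re) :
    gammaFactor χ s ≠ 0 := by
  rw [gammaFactor_eq]
  apply Gammaℝ_ne_zero_of_re_pos
  have := archParity_nonneg χ
  simp
  linarith

theorem hasDerivAt_Gammaℝ_add {a : ℝ} (ha : 0 ≤ a) {s : ℂ} (hs : 0 < s.re) :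
    HasDerivAt (fun z => Gammaℝ (z + a)) (archLogDeriv a s * Gammaℝ (s + a)) s := by
  have hre : 0 < ((s + a) / 2).re := by
    simp
    linarith
  have hpole : ∀ m : ℕ, (s + a) / 2 ≠ -m := by
    intro m h
    rw [h] at hre
    simp at hre
    have : (0 : ℝ) ≤ m := m.cast_nonneg
    linarith
  have hπ : (Real.pi : ℂ) ≠ 0 := by exact_mod_cast Real.pi_ne_zero
  have h1 : HasDerivAt (fun z : ℂ => (z + a) / 2) (1 / 2) s :=
    ((hasDerivAt_id s).add_const _).div_const 2
  have h2 : HasDerivAt (fun z : ℂ => -(z + a) / 2) (-1 / 2) s :=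
    (((hasDerivAt_id s).add_const _).neg).div_const 2
  have h3 := h2.const_cpow (c := (Real.pi : ℂ)) (Or.inl hπ)
  have h4 := (differentiableAt_Gamma _ hpole).hasDerivAt.comp s h1
  have h5 := h3.mul h4
  convert! h5 using 1
  have h6 : Gamma ((s + a) / 2) ≠ 0 := Gamma_ne_zero hpole
  simp only [Gammaℝ_def, archLogDeriv, digamma_def, logDeriv_apply, Function.comp, ← ofReal_log
    Real.pi_pos.le]
  field_simp

theorem differentiableAt_gammaFactor (χ : DirichletCharacter ℂ q) {s : ℂ} (hs : 0 < s.re) :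
    DifferentiableAt ℂ (gammaFactor χ) s := by
  rw [show gammaFactor χ = fun z => Gammaℝ (z + archParity χ) from funext (gammaFactor_eq χ)]
  exact (hasDerivAt_Gammaℝ_add (archParity_nonneg χ) hs).differentiableAt

theorem logDeriv_gammaFactor (χ : DirichletCharacter ℂ q) {s : ℂ} (hs : 0 < s.re) :
    logDeriv (gammaFactor χ) s = archLogDeriv (archParity χ) s := by
  have h0 := gammaFactor_ne_zero χ hs
  rw [gammaFactor_eq] at h0
  rw [show gammaFactor χ = fun z => Gammaℝ (z + archParity χ) from funext (gammaFactor_eq χ),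
    logDeriv_apply, (hasDerivAt_Gammaℝ_add (archParity_nonneg χ) hs).deriv,
    mul_div_cancel_right₀ _ h0]

variable [NeZero q]

theorem completedLFunction_eq_mul (χ : DirichletCharacter ℂ q) {s : ℂ} (hs : 0 < s.re) :
    completedLFunction χ s = χ.LFunction s * gammaFactor χ s := by
  rw [LFunction_eq_completed_div_gammaFactor χ s (Or.inl (by rintro rfl; simp at hs)),
    div_mul_cancel₀ _ (gammaFactor_ne_zero χ hs)]

theorem completedLFunction_eventuallyEq_mul (χ : DirichletCharacter ℂ q) {s : ℂ} (hs : 0 < s.re) :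
    completedLFunction χ =ᶠ[𝓝 s] fun z => χ.LFunction z * gammaFactor χ z := by
  filter_upwards [(isOpen_lt continuous_const continuous_re).mem_nhds hs] with z hz
  exact completedLFunction_eq_mul χ hz

theorem completedLFunction_eq_zero_iff (χ : DirichletCharacter ℂ q) {s : ℂ} (hs : 0 < s.re) :
    completedLFunction χ s = 0 ↔ χ.LFunction s = 0 := by
  rw [completedLFunction_eq_mul χ hs, mul_eq_zero, or_iff_left (gammaFactor_ne_zero χ hs)]

theorem analyticOrderNatAt_completedLFunction {χ : DirichletCharacter ℂ q} (hχ : χ ≠ 1) {s : ℂ}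
    (hs : 0 < s.re) :
    analyticOrderNatAt (completedLFunction χ) s = analyticOrderNatAt χ.LFunction s := by
  have hU : IsOpen {z : ℂ | 0 < z.re} := isOpen_lt continuous_const continuous_re
  have h1 : AnalyticAt ℂ (gammaFactor χ) s := by
    have : DifferentiableOn ℂ (gammaFactor χ) {z : ℂ | 0 < z.re} := fun z hz =>
      (differentiableAt_gammaFactor χ hz).differentiableWithinAt
    exact this.analyticAt (hU.mem_nhds hs)
  have h2 : AnalyticAt ℂ χ.LFunction s := (differentiable_LFunction hχ).analyticAt s
  unfold analyticOrderNatAt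
  rw [analyticOrderAt_congr (completedLFunction_eventuallyEq_mul χ hs)]
  change (analyticOrderAt (χ.LFunction * gammaFactor χ) s).toNat = _
  rw [analyticOrderAt_mul h2 h1, h1.analyticOrderAt_eq_zero.2 (gammaFactor_ne_zero χ hs), add_zero]

theorem logDeriv_completedLFunction {χ : DirichletCharacter ℂ q} (hχ : χ ≠ 1) {s : ℂ}
    (hs : 0 < s.re) (h0 : χ.LFunction s ≠ 0) :
    logDeriv (completedLFunction χ) s =
      logDeriv χ.LFunction s + archLogDeriv (archParity χ) s := by
  rw [(logDeriv_congr_nhds (completedLFunction_eventuallyEq_mul χ hs)).eq_of_nhds,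
    logDeriv_mul s h0 (gammaFactor_ne_zero χ hs) (differentiable_LFunction hχ s)
      (differentiableAt_gammaFactor χ hs), logDeriv_gammaFactor χ hs]

/-- Otherwise the functional equation at `s = -1` would make the completed function vanish at `2`.
-/
theorem rootNumber_ne_zero {χ : DirichletCharacter ℂ q} (hχ : χ ≠ 1) (hp : χ.IsPrimitive) :
    rootNumber χ ≠ 0 := by
  intro h
  have h1 := hp.completedLFunction_one_sub (-1)
  rw [h, mul_zero, zero_mul, completedLFunction_eq_mul χ (by norm_num)] at h1
  refine mul_ne_zero ?_ (gammaFactor_ne_zero χ (by norm_num)) h1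
  exact LFunction_ne_zero_of_one_le_re χ (Or.inl hχ) (by norm_num)

theorem completedLFunction_one_sub_eq_zero_iff {χ : DirichletCharacter ℂ q} (hχ : χ ≠ 1)
    (hp : χ.IsPrimitive) (s : ℂ) :
    completedLFunction χ (1 - s) = 0 ↔ completedLFunction χ⁻¹ s = 0 := by
  have hq : (q : ℂ) ≠ 0 := by exact_mod_cast NeZero.ne q
  rw [hp.completedLFunction_one_sub, mul_eq_zero, or_iff_right]
  exact mul_ne_zero (by simp [cpow_eq_zero_iff, hq]) (rootNumber_ne_zero hχ hp)

/-- The zeros of the completed `L`-function of a primitive character lie in the open critical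
strip. -/
theorem mem_strip_of_completedLFunction_eq_zero {χ : DirichletCharacter ℂ q} (hχ : χ ≠ 1)
    (hp : χ.IsPrimitive) {s : ℂ} (h : completedLFunction χ s = 0) : 0 < s.re ∧ s.re < 1 := by
  have hright : ∀ {ψ : DirichletCharacter ℂ q}, ψ ≠ 1 → ∀ {z : ℂ}, completedLFunction ψ z = 0 →
      z.re < 1 := by
    intro ψ hψ z hz
    by_contra! h1
    rw [completedLFunction_eq_zero_iff ψ (by linarith)] at hz
    exact LFunction_ne_zero_of_one_le_re ψ (Or.inl hψ) h1 hz
  refine ⟨?_, hright hχ h⟩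
  have h2 : completedLFunction χ⁻¹ (1 - s) = 0 := by
    rw [← completedLFunction_one_sub_eq_zero_iff hχ hp]
    simpa using h
  have := hright (inv_ne_one_of_ne_one hχ) h2
  simp at this
  exact this

/-- The functional equation, differentiated logarithmically. It carries the side `Re s = -1/2` of
the contour to `Re s = 3/2` for `χ⁻¹`. -/
theorem logDeriv_completedLFunction_one_sub {χ : DirichletCharacter ℂ q} (hχ : χ ≠ 1)
    (hp : χ.IsPrimitive) {s : ℂ} (hs : completedLFunction χ⁻¹ s ≠ 0) :
    logDeriv (completedLFunction χ) (1 - s) =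
      -(Real.log q + logDeriv (completedLFunction χ⁻¹) s) := by
  have hq : (q : ℂ) ≠ 0 := by exact_mod_cast NeZero.ne q
  have hroot := rootNumber_ne_zero hχ hp
  have hd := differentiable_completedLFunction hχ
  have hd' := differentiable_completedLFunction (inv_ne_one_of_ne_one hχ)
  have hpow : HasDerivAt (fun z : ℂ => (q : ℂ) ^ (z - 1 / 2)) ((q : ℂ) ^ (s - 1 / 2) * log q) s := by
    simpa using ((hasDerivAt_id s).sub_const (1 / 2 : ℂ)).const_cpow (c := (q : ℂ)) (Or.inl hq)
  have hpow0 : (q : ℂ) ^ (s - 1 / 2) ≠ 0 := by simp [cpow_eq_zero_iff, hq]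
  have e : (fun z => completedLFunction χ (1 - z)) =
      fun z => ((q : ℂ) ^ (z - 1 / 2) * rootNumber χ) * completedLFunction χ⁻¹ z :=
    funext hp.completedLFunction_one_sub
  have h1 : logDeriv (fun z => completedLFunction χ (1 - z)) s =
      -logDeriv (completedLFunction χ) (1 - s) := by
    have := ((hd (1 - s)).hasDerivAt).comp s ((hasDerivAt_id s).const_sub 1)
    have h2 : HasDerivAt (fun z => completedLFunction χ (1 - z))
      (deriv (completedLFunction χ) (1 - s) * -1) s := this
    rw [logDeriv_apply, logDeriv_apply, h2.deriv]
    ring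
  have h2 : logDeriv (fun z => completedLFunction χ (1 - z)) s =
      Real.log q + logDeriv (completedLFunction χ⁻¹) s := by
    rw [e, logDeriv_mul (f := fun z : ℂ => (q : ℂ) ^ (z - 1 / 2) * rootNumber χ) s (mul_ne_zero hpow0 hroot) hs (hpow.differentiableAt.mul_const _) (hd' s),
      logDeriv_mul_const _ _ hroot, logDeriv_apply, hpow.deriv, mul_div_cancel_left₀ _ hpow0,
      natCast_log]
  rw [← h2, h1, neg_neg]

/-- A point of `[x, x + 1]` far away from a given finite set. -/
theorem exists_far_point (S : Finset ℝ) (x : ℝ) : ∃ T ∈ Set.Icc x (x + 1), ∀ p ∈ S,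
    1 / (2 * ((S.card : ℝ) + 1)) ≤ |T - p| := by
  by_contra! h
  set n : ℝ := (S.card : ℝ) + 1 with hn
  have hn0 : 0 < n := by positivity
  have hmem : ∀ j : ℕ, j ∈ Finset.range (S.card + 1) → x + j / n ∈ Set.Icc x (x + 1) := by
    intro j hj
    have h1 : (j : ℝ) ≤ n := by
      rw [hn]
      exact_mod_cast (Finset.mem_range.1 hj).le
    have h2 : (j : ℝ) / n ≤ 1 := (div_le_one hn0).2 h1
    have h3 : 0 ≤ (j : ℝ) / n := by positivity
    exact ⟨by linarith, by linarith⟩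
  have hex : ∀ j : ℕ, ∃ p : ℝ, j ∈ Finset.range (S.card + 1) →
      p ∈ S ∧ |x + j / n - p| < 1 / (2 * n) := by
    intro j
    by_cases hj : j ∈ Finset.range (S.card + 1)
    · obtain ⟨p, hp, hlt⟩ := h _ (hmem j hj)
      exact ⟨p, fun _ => ⟨hp, hlt⟩⟩
    · exact ⟨0, fun h => absurd h hj⟩
  choose f hf using hex
  -- Pigeonhole: there are more points `x + j/n` than elements of `S`, so two of them would be
  -- within `1/(2n)` of the same element, although they are at least `1/n` apart.
  obtain ⟨i, hi, j, hj, hij, hfij⟩ := Finset.exists_ne_map_eq_of_card_lt_of_maps_to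
    (s := Finset.range (S.card + 1)) (t := S) (by simp) (f := f) (fun j hj => (hf j hj).1)
  have h1 := (hf i hi).2
  have h2 := (hf j hj).2
  rw [hfij] at h1
  have h3 : |(i : ℝ) / n - j / n| < 1 / n := by
    calc |(i : ℝ) / n - j / n| = |(x + i / n - f j) - (x + j / n - f j)| := by ring_nf
      _ ≤ _ := abs_sub _ _
      _ < 1 / (2 * n) + 1 / (2 * n) := add_lt_add h1 h2
      _ = 1 / n := by field_simp; norm_num
  rw [← sub_div, abs_div, abs_of_pos hn0, div_lt_div_iff_of_pos_right hn0] at h3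
  have h4 : (1 : ℝ) ≤ |(i : ℝ) - j| := by
    have : (1 : ℤ) ≤ |(i : ℤ) - j| := Int.one_le_abs (by omega)
    exact_mod_cast this
  linarith

end CompletedLFunction

/-! ### The Dirichlet series on the two vertical sides. -/

section PrimeSide

open Complex MeasureTheory DirichletCharacter

variable {q : ℕ} [NeZero q]

/-- The coefficient `χ(n) Λ(n)`. -/
def twistedLambda {q : ℕ} (χ : DirichletCharacter ℂ q) (n : ℕ) : ℂ :=
  χ (n : ZMod q) * ArithmeticFunction.vonMangoldt n

theorem twistedLambda_zero {q : ℕ} (χ : DirichletCharacter ℂ q) : twistedLambda χ 0 = 0 := by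
  simp [twistedLambda]

theorem term_twistedLambda {q : ℕ} (χ : DirichletCharacter ℂ q) (s : ℂ) (n : ℕ) :
    LSeries.term (twistedLambda χ) s n = twistedLambda χ n * exp (-(Real.log n : ℝ) * s) := by
  rcases eq_or_ne n 0 with rfl | hn
  · simp [twistedLambda_zero]
  · have hn' : (n : ℂ) ≠ 0 := by exact_mod_cast hn
    rw [LSeries.term_of_ne_zero hn, cpow_def_of_ne_zero hn', ← natCast_log, div_eq_mul_inv,
      ← exp_neg, neg_mul]

theorem neg_logDeriv_LFunction (χ : DirichletCharacter ℂ q) {s : ℂ} (hs : 1 < s.re) :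
    -logDeriv χ.LFunction s = ∑' n : ℕ, twistedLambda χ n * exp (-(Real.log n : ℝ) * s) := by
  have h := LSeries_twist_vonMangoldt_eq χ hs
  rw [logDeriv_apply, deriv_LFunction_eq_deriv_LSeries χ hs, LFunction_eq_LSeries χ hs, ← neg_div,
    ← h, LSeries]
  exact tsum_congr fun n => term_twistedLambda χ s n

theorem summable_norm_twistedLambda {q : ℕ} (χ : DirichletCharacter ℂ q) {σ : ℝ} (hσ : 1 < σ) :
    Summable fun n : ℕ => ‖twistedLambda χ n‖ * Real.exp (-Real.log n * σ) := by
  have h := (LSeriesSummable_twist_vonMangoldt χ (s := σ) (by simpa using hσ)).norm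
  refine h.congr fun n => ?_
  have := term_twistedLambda χ σ n
  change LSeries.term (twistedLambda χ) σ n = _ at this
  change ‖LSeries.term (twistedLambda χ) σ n‖ = _
  rw [this, norm_mul, norm_exp, ← ofReal_neg, ← ofReal_mul, ofReal_re]

theorem continuous_logDeriv_LFunction_vertical {χ : DirichletCharacter ℂ q} (hχ : χ ≠ 1) {γ : ℝ → ℂ}
    (hγ : Continuous γ) (hre : ∀ t, 1 ≤ (γ t).re) :
    Continuous fun t => logDeriv χ.LFunction (γ t) := by
  have hd := differentiable_LFunction hχ
  simp only [logDeriv_apply]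
  exact Continuous.div (hd.deriv.continuous.comp hγ) (hd.continuous.comp hγ)
    fun t => LFunction_ne_zero_of_one_le_re χ (Or.inl hχ) (hre t)

theorem norm_add_mul_I_ge (c t : ℝ) : |c| ≤ ‖(c + t * I : ℂ)‖ := by
  simpa using abs_re_le_norm (c + t * I : ℂ)

/-- The prime side of the explicit formula. -/
theorem tendsto_integral_logDeriv_right (χ : DirichletCharacter ℂ q) {k : ℕ} (hk : 1 ≤ k) {ℓ : ℝ}
    (hℓ : ℓ = Real.log (k + 1 / 2)) :
    Tendsto (fun T : ℝ => ∫ t : ℝ in (-T)..T, -logDeriv χ.LFunction ((3 / 2 : ℝ) + t * I) *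
      (exp (ℓ * ((3 / 2 : ℝ) + t * I)) / ((3 / 2 : ℝ) + t * I))) atTop
      (𝓝 (2 * Real.pi * ∑ n ∈ Finset.range (k + 1), twistedLambda χ n)) := by
  have hk0 : (1 : ℝ) ≤ k := by exact_mod_cast hk
  -- The cut-off `k + 1/2` avoids the integers: `|ℓ - log n| ≥ δ` for all `n ≥ 1`, so the Perron
  -- errors are summable with total `O(1/T)`.
  set δ := min (ℓ - Real.log k) (Real.log (k + 1) - ℓ) with hδ
  have hδ0 : 0 < δ := by
    refine lt_min ?_ ?_
    · rw [sub_pos, hℓ]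
      exact Real.log_lt_log (by linarith) (by linarith)
    · rw [sub_pos, hℓ]
      exact Real.log_lt_log (by linarith) (by linarith)
  set f : ℕ → ℝ → ℂ := fun n t => twistedLambda χ n *
    (exp ((ℓ - Real.log n : ℝ) * ((3 / 2 : ℝ) + t * I)) / ((3 / 2 : ℝ) + t * I)) with hf
  have hne : ∀ t : ℝ, (((3 / 2 : ℝ) : ℂ) + t * I) ≠ 0 := fun t => by
    rw [← norm_pos_iff]
    exact lt_of_lt_of_le (by norm_num) (norm_add_mul_I_ge (3 / 2) t)
  have hsum := summable_norm_twistedLambda χ (σ := 3 / 2) (by norm_num)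
  set E := Real.exp (ℓ * (3 / 2)) with hE
  have hexp : ∀ n : ℕ, Real.exp ((ℓ - Real.log n) * (3 / 2)) =
      E * Real.exp (-Real.log n * (3 / 2)) := fun n => by
    rw [hE, ← Real.exp_add]
    ring_nf
  set v : ℕ → ℂ := fun n => if n ∈ Finset.range (k + 1) then 2 * Real.pi * twistedLambda χ n else 0
    with hv
  have key := tendsto_integral_tsum_of_le (f := f)
    (b := fun n => E * (‖twistedLambda χ n‖ * Real.exp (-Real.log n * (3 / 2))))
    (B := fun n => 2 / δ * E * (‖twistedLambda χ n‖ * Real.exp (-Real.log n * (3 / 2))))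
    (v := v) ?_ (hsum.mul_left _) (hsum.mul_left _) ?_ ?_ ?_
  · have hv' : ∑' n, v n = 2 * Real.pi * ∑ n ∈ Finset.range (k + 1), twistedLambda χ n := by
      rw [tsum_eq_sum (s := Finset.range (k + 1)) (fun n hn => by simp only [hv, if_neg hn]),
        Finset.mul_sum]
      exact Finset.sum_congr rfl fun n hn => by simp only [hv, if_pos hn]
    rw [← hv']
    refine key.congr fun T => ?_
    refine intervalIntegral.integral_congr fun t _ => ?_
    rw [neg_logDeriv_LFunction χ (by norm_num), ← tsum_mul_right]
    refine tsum_congr fun n => ?_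
    simp only [hf]
    rw [show ((ℓ - Real.log n : ℝ) : ℂ) * ((3 / 2 : ℝ) + t * I) = -(Real.log n : ℝ) *
      ((3 / 2 : ℝ) + t * I) + ℓ * ((3 / 2 : ℝ) + t * I) by push_cast; ring, exp_add]
    ring
  · intro n
    exact continuous_const.mul (Continuous.div (by fun_prop) (by fun_prop) hne)
  · exact summable_of_ne_finset_zero (s := Finset.range (k + 1)) fun n hn => by
      simp only [hv, if_neg hn]
  · intro n t
    simp only [hf]
    rw [norm_mul, norm_div, norm_exp_mul_add_mul_I, hexp]
    have h1 : (1 : ℝ) ≤ ‖(((3 / 2 : ℝ) : ℂ) + t * I)‖ :=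
      le_trans (by norm_num) (norm_add_mul_I_ge (3 / 2) t)
    have h2 := div_le_self (show 0 ≤ E * Real.exp (-Real.log n * (3 / 2)) by positivity) h1
    calc _ ≤ ‖twistedLambda χ n‖ * (E * Real.exp (-Real.log n * (3 / 2))) := by gcongr
      _ = _ := by ring
  · intro n T hT
    simp only [hf]
    rw [intervalIntegral.integral_const_mul]
    rcases eq_or_ne n 0 with rfl | hn0
    · simp [hv, twistedLambda_zero]
    have hn1 : (1 : ℝ) ≤ n := by exact_mod_cast Nat.one_le_iff_ne_zero.2 hn0
    have hfin : ∀ m : ℝ, δ ≤ m → ‖twistedLambda χ n‖ * (2 * Real.exp ((ℓ - Real.log n) * (3 / 2)) /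
        (m * T)) ≤ 2 / δ * E * (‖twistedLambda χ n‖ * Real.exp (-Real.log n * (3 / 2))) / T := by
      intro m hm
      rw [hexp]
      calc _ ≤ ‖twistedLambda χ n‖ * (2 * (E * Real.exp (-Real.log n * (3 / 2))) / (δ * T)) := by
            gcongr
        _ = _ := by field_simp
    by_cases hn : n ∈ Finset.range (k + 1)
    · have hnk : (n : ℝ) ≤ k := by exact_mod_cast Nat.lt_succ_iff.1 (Finset.mem_range.1 hn)
      have h1 : δ ≤ ℓ - Real.log n :=
        (min_le_left _ _).trans (sub_le_sub_left (Real.log_le_log (by linarith) hnk) _)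
      have h2 := norm_integral_exp_div_sub_le (hδ0.trans_le h1) (c := 3 / 2) (T := T) (by norm_num) hT
      rw [if_pos (by norm_num)] at h2
      simp only [hv, if_pos hn]
      rw [mul_comm (2 * Real.pi : ℂ), ← mul_sub, norm_mul]
      refine le_trans ?_ (hfin _ h1)
      gcongr
    · have hnk : (k : ℝ) + 1 ≤ n := by
        rw [Finset.mem_range, not_lt] at hn
        exact_mod_cast hn
      have h1 : δ ≤ -(ℓ - Real.log n) := by
        have := Real.log_le_log (by linarith) hnk
        have h3 : δ ≤ Real.log (k + 1) - ℓ := min_le_right _ _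
        linarith
      have h2 := norm_integral_exp_div_le_of_neg (ℓ := ℓ - Real.log n) (by linarith) (c := 3 / 2)
        (T := T) (by norm_num) hT
      simp only [hv, if_neg hn]
      rw [sub_zero, norm_mul]
      refine le_trans ?_ (hfin _ h1)
      gcongr

/-- The Dirichlet series on the left of the critical strip does not contribute. -/
theorem tendsto_integral_logDeriv_left (χ : DirichletCharacter ℂ q) {ℓ : ℝ} (hℓ : 0 < ℓ) :
    Tendsto (fun T : ℝ => ∫ t : ℝ in (-T)..T, -logDeriv χ.LFunction ((3 / 2 : ℝ) + (-t : ℝ) * I) *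
      (exp (ℓ * ((-1 / 2 : ℝ) + t * I)) / ((-1 / 2 : ℝ) + t * I))) atTop (𝓝 0) := by
  -- With `s = -1/2 + it` one has `n^(-(1-s)) e^(ℓ s) = n^(-1) e^((ℓ + log n) s)`. Each term is a
  -- Perron integral with positive exponent to the left of the pole, so it tends to `0`.
  set f : ℕ → ℝ → ℂ := fun n t => twistedLambda χ n * Real.exp (-Real.log n) *
    (exp ((ℓ + Real.log n : ℝ) * ((-1 / 2 : ℝ) + t * I)) / ((-1 / 2 : ℝ) + t * I)) with hf
  have hne : ∀ t : ℝ, (((-1 / 2 : ℝ) : ℂ) + t * I) ≠ 0 := fun t => by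
    rw [← norm_pos_iff]
    exact lt_of_lt_of_le (by norm_num) (norm_add_mul_I_ge (-1 / 2) t)
  have hsum := summable_norm_twistedLambda χ (σ := 3 / 2) (by norm_num)
  set E := Real.exp (ℓ * (-1 / 2)) with hE
  have hexp : ∀ n : ℕ, Real.exp (-Real.log n) * Real.exp ((ℓ + Real.log n) * (-1 / 2)) =
      E * Real.exp (-Real.log n * (3 / 2)) := fun n => by
    rw [hE, ← Real.exp_add, ← Real.exp_add]
    ring_nf
  have hlogn : ∀ n : ℕ, 0 ≤ Real.log n := fun n => Real.log_natCast_nonneg n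
  have key := tendsto_integral_tsum_of_le (f := f)
    (b := fun n => 2 * E * (‖twistedLambda χ n‖ * Real.exp (-Real.log n * (3 / 2))))
    (B := fun n => 2 / ℓ * E * (‖twistedLambda χ n‖ * Real.exp (-Real.log n * (3 / 2))))
    (v := 0) ?_ (hsum.mul_left _) (hsum.mul_left _) summable_zero ?_ ?_
  · rw [show ∑' n : ℕ, (0 : ℕ → ℂ) n = 0 by simp] at key
    refine key.congr fun T => ?_
    refine intervalIntegral.integral_congr fun t _ => ?_
    rw [neg_logDeriv_LFunction χ (by norm_num), ← tsum_mul_right]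
    refine tsum_congr fun n => ?_
    simp only [hf]
    have hx : (Real.exp (-Real.log n) : ℂ) * exp ((ℓ + Real.log n : ℝ) * ((-1 / 2 : ℝ) + t * I)) =
        exp (-(Real.log n : ℝ) * ((3 / 2 : ℝ) + (-t : ℝ) * I)) *
          exp (ℓ * ((-1 / 2 : ℝ) + t * I)) := by
      rw [ofReal_exp, ← exp_add, ← exp_add]
      congr 1
      push_cast
      ring
    rw [mul_assoc, ← mul_div_assoc, hx]
    ring
  · intro n
    exact continuous_const.mul (Continuous.div (by fun_prop) (by fun_prop) hne)
  · intro n t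
    simp only [hf]
    rw [norm_mul, norm_mul, norm_div, norm_exp_mul_add_mul_I, norm_real,
      Real.norm_of_nonneg (Real.exp_pos _).le]
    have h1 : (1 / 2 : ℝ) ≤ ‖(((-1 / 2 : ℝ) : ℂ) + t * I)‖ :=
      le_trans (by norm_num [abs_of_neg]) (norm_add_mul_I_ge (-1 / 2) t)
    calc _ ≤ ‖twistedLambda χ n‖ * Real.exp (-Real.log n) *
          (Real.exp ((ℓ + Real.log n) * (-1 / 2)) / (1 / 2)) := by gcongr
      _ = ‖twistedLambda χ n‖ * (2 * (Real.exp (-Real.log n) *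
          Real.exp ((ℓ + Real.log n) * (-1 / 2)))) := by ring
      _ = _ := by rw [hexp]; ring
  · intro n T hT
    simp only [hf]
    have h0 : 0 < ℓ + Real.log n := by linarith [hlogn n]
    have h2 := norm_integral_exp_div_sub_le h0 (c := -1 / 2) (T := T) (by norm_num) hT
    rw [if_neg (by norm_num), sub_zero] at h2
    rw [intervalIntegral.integral_const_mul, Pi.zero_apply, sub_zero, norm_mul, norm_mul, norm_real,
      Real.norm_of_nonneg (Real.exp_pos _).le]
    calc _ ≤ ‖twistedLambda χ n‖ * Real.exp (-Real.log n) *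
          (2 * Real.exp ((ℓ + Real.log n) * (-1 / 2)) / ((ℓ + Real.log n) * T)) := by gcongr
      _ ≤ ‖twistedLambda χ n‖ * Real.exp (-Real.log n) *
          (2 * Real.exp ((ℓ + Real.log n) * (-1 / 2)) / (ℓ * T)) := by
          gcongr
          linarith [hlogn n]
      _ = 2 / ℓ * (‖twistedLambda χ n‖ * (Real.exp (-Real.log n) *
          Real.exp ((ℓ + Real.log n) * (-1 / 2)))) / T := by field_simp
      _ = _ := by rw [hexp]; ring

end PrimeSide

/-! ### Counting zeros and choosing heights away from them. -/

section GoodHeights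

open Complex MeasureTheory DirichletCharacter

variable {q : ℕ} [NeZero q]

/-- Separation is measured between `|t|` and `|Im p|`, so that a single height serves both `t = T`
and `t = -T`, and also `χ⁻¹`, whose strip zeros are the `1 - p`. -/
theorem exists_norm_logDeriv_completedLFunction_le {χ : DirichletCharacter ℂ q} (hχ : χ ≠ 1) :
    ∃ C : ℝ, 0 < C ∧ ∀ t δ : ℝ, 0 < δ → δ ≤ 1 →
      (∀ p, χ.LFunction p = 0 → 0 < p.re → δ ≤ |(|t| - |p.im|)|) →
      ∀ σ ∈ Set.Icc (1 / 2 : ℝ) (3 / 2), χ.LFunction (σ + t * I) ≠ 0 ∧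
        ‖logDeriv (completedLFunction χ) (σ + t * I)‖ ≤
          C * (Real.log (|t| + 4) / δ + (|t| + 2) ^ (3 / 4 : ℝ)) := by
  obtain ⟨C, hC, -, hb⟩ := exists_logDeriv_LFunction_bounds hχ
  obtain ⟨D, hD, hd⟩ := exists_norm_archLogDeriv_le (archParity_nonneg χ)
  refine ⟨C + D, by positivity, fun t δ hδ hδ1 hz σ hσ => ?_⟩
  obtain ⟨hσ1, hσ2⟩ := hσ
  have hs0 : 0 < ((σ : ℂ) + t * I).re := by simp; linarith
  have hne : χ.LFunction (σ + t * I) ≠ 0 := by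
    intro h0
    have := hz _ h0 hs0
    simp at this
    linarith
  refine ⟨hne, ?_⟩
  rw [logDeriv_completedLFunction hχ hs0 hne]
  have h1 := hb (2 + t * I) (by simp) δ hδ hδ1 (σ + t * I) ?_ ?_
  · have h2 := (hd (σ + t * I) (by simp; linarith)).1
    have h3 : ‖(σ + t * I : ℂ)‖ ≤ |t| + 2 := by
      refine (norm_add_le _ _).trans ?_
      rw [norm_mul, norm_I, mul_one, norm_real, norm_real, Real.norm_eq_abs, Real.norm_eq_abs,
        abs_of_nonneg (by linarith)]
      linarith
    have h4 : ‖(σ + t * I : ℂ)‖ ^ (3 / 4 : ℝ) ≤ (|t| + 2) ^ (3 / 4 : ℝ) :=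
      Real.rpow_le_rpow (norm_nonneg _) h3 (by norm_num)
    have h5 : 0 ≤ Real.log (|t| + 4) / δ :=
      div_nonneg (Real.log_nonneg (by linarith [abs_nonneg t])) hδ.le
    have h6 : 0 ≤ (|t| + 2) ^ (3 / 4 : ℝ) := by positivity
    have h7 : |(2 + t * I : ℂ).im| = |t| := by simp
    rw [h7, mul_div_assoc] at h1
    have h8 : D * ‖(σ + t * I : ℂ)‖ ^ (3 / 4 : ℝ) ≤ D * (|t| + 2) ^ (3 / 4 : ℝ) :=
      mul_le_mul_of_nonneg_left h4 hD.le
    refine (norm_add_le _ _).trans ?_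
    nlinarith [mul_nonneg hC.le h6, mul_nonneg hD.le h5]
  · rw [Metric.mem_closedBall, dist_eq, show (σ + t * I - (2 + t * I) : ℂ) = ((σ - 2 : ℝ) : ℂ) by
      push_cast; ring, norm_real, Real.norm_eq_abs, abs_le]
    constructor <;> linarith
  · intro p hp h0
    have hpre : 0 < p.re := by
      rw [Metric.mem_closedBall, dist_eq] at hp
      have := (abs_re_le_norm _).trans hp
      simp [abs_le] at this
      linarith
    refine (hz p h0 hpre).trans ((abs_abs_sub_abs_le t p.im).trans ?_)
    simpa using abs_im_le_norm (σ + t * I - p)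

theorem one_le_analyticOrderNatAt {f : ℂ → ℂ} (hf : Differentiable ℂ f) {w : ℂ} (hw : f w ≠ 0) {p : ℂ}
    (hp : f p = 0) : 1 ≤ analyticOrderNatAt f p := by
  have h1 := analyticOrderAt_ne_top_of_entire hf hw p
  rw [Nat.one_le_iff_ne_zero]
  intro h
  have h2 : analyticOrderAt f p = 0 := by
    rw [← Nat.cast_analyticOrderNatAt h1, h, Nat.cast_zero]
  exact ((hf.analyticAt p).analyticOrderAt_eq_zero.1 h2) hp

theorem LFunction_two_ne_zero {χ : DirichletCharacter ℂ q} (hχ : χ ≠ 1) : χ.LFunction 2 ≠ 0 :=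
  LFunction_ne_zero_of_one_le_re χ (Or.inl hχ) (by norm_num)

/-- Under GRH there are `O(log k)` zeros at height between `k` and `k + 1`. -/
theorem exists_sum_order_le (hG : GRH) {χ : DirichletCharacter ℂ q} (hχ : χ ≠ 1) :
    ∃ C : ℝ, 0 < C ∧ ∀ (k : ℕ) (Z : Finset ℂ),
      (∀ p ∈ Z, χ.LFunction p = 0 ∧ 0 < p.re ∧ p.re < 1 ∧ (k : ℝ) ≤ |p.im| ∧ |p.im| ≤ k + 1) →
      ∑ p ∈ Z, (analyticOrderNatAt χ.LFunction p : ℝ) ≤ C * Real.log (k + 5) := by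
  obtain ⟨C, hC, hb, -⟩ := exists_logDeriv_LFunction_bounds hχ
  refine ⟨2 * C, by positivity, fun k Z hZ => ?_⟩
  have hk0 : (0 : ℝ) ≤ k := k.cast_nonneg
  -- On the critical line with `|Im p - t| ≤ 1/2`, the distance to `2 + it` is at most `√(5/2) <
  -- 8/5`. The two half planes are counted separately.
  have key : ∀ (t : ℝ), |t| = k + 1 / 2 → ∀ Y : Finset ℂ,
      (∀ p ∈ Y, p.re = 1 / 2 ∧ |p.im - t| ≤ 1 / 2) →
      ∑ p ∈ Y, (analyticOrderNatAt χ.LFunction p : ℝ) ≤ C * Real.log (k + 5) := by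
    intro t ht Y hY
    have h1 := hb (2 + t * I) (by simp) Y ?_
    · refine h1.trans (mul_le_mul_of_nonneg_left (Real.log_le_log (by positivity) ?_) hC.le)
      simp only [add_im, im_ofNat, mul_im, ofReal_re, I_im, mul_one, ofReal_im, I_re, mul_zero,
        add_zero, zero_add]
      rw [ht]
      linarith
    · intro p hp
      obtain ⟨h2, h3⟩ := hY p hp
      rw [Metric.mem_closedBall, dist_eq, ← abs_of_nonneg (show (0 : ℝ) ≤ 8 / 5 by norm_num),
        ← abs_norm, ← sq_le_sq, Complex.sq_norm, normSq_apply]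
      simp only [sub_re, add_re, re_ofNat, mul_re, ofReal_re, I_re, mul_zero, ofReal_im, I_im,
        mul_one, sub_self, add_zero, sub_im, add_im, im_ofNat, mul_im, zero_add]
      rw [h2]
      have := sq_le_sq' (abs_le.1 h3).1 (abs_le.1 h3).2
      nlinarith
  have hsplit := Finset.sum_filter_add_sum_filter_not Z (fun p => 0 ≤ p.im)
    (fun p => (analyticOrderNatAt χ.LFunction p : ℝ))
  rw [← hsplit]
  have h1 := key (k + 1 / 2) (abs_of_nonneg (by positivity)) (Z.filter fun p => 0 ≤ p.im) ?_
  · have h2 := key (-(k + 1 / 2)) (by rw [abs_neg, abs_of_nonneg (by positivity)])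
      (Z.filter fun p => ¬ 0 ≤ p.im) ?_
    · linarith
    · intro p hp
      rw [Finset.mem_filter] at hp
      obtain ⟨h0, hr, hr1, hl, hu⟩ := hZ p hp.1
      rw [abs_of_neg (not_le.1 hp.2)] at hl hu
      exact ⟨hG q χ p hr hr1 h0, abs_le.2 ⟨by linarith, by linarith⟩⟩
  · intro p hp
    rw [Finset.mem_filter] at hp
    obtain ⟨h0, hr, hr1, hl, hu⟩ := hZ p hp.1
    rw [abs_of_nonneg hp.2] at hl hu
    exact ⟨hG q χ p hr hr1 h0, abs_le.2 ⟨by linarith, by linarith⟩⟩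

theorem tendsto_log_sq_add_rpow_div (A : ℝ) :
    Tendsto (fun k : ℕ => A * (Real.log (k + 5) ^ 2 + (k + 5 : ℝ) ^ (3 / 4 : ℝ)) / k) atTop
      (𝓝 0) := by
  have h1 : Tendsto (fun y : ℝ => Real.log y ^ 2 / y) atTop (𝓝 0) :=
    Real.isLittleO_pow_log_id_atTop.tendsto_div_nhds_zero
  have h2 : Tendsto (fun y : ℝ => y ^ (3 / 4 : ℝ) / y) atTop (𝓝 0) := by
    refine (tendsto_rpow_neg_atTop (show (0 : ℝ) < 1 / 4 by norm_num)).congr' ?_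
    filter_upwards [eventually_gt_atTop 0] with y hy
    rw [eq_div_iff hy.ne', ← Real.rpow_add_one hy.ne']
    norm_num
  have h3 : Tendsto (fun k : ℕ => (k : ℝ) + 5) atTop atTop :=
    tendsto_atTop_add_const_right _ _ tendsto_natCast_atTop_atTop
  have h4 : Tendsto (fun k : ℕ => ((k : ℝ) + 5) / k) atTop (𝓝 1) := by
    have : Tendsto (fun k : ℕ => 1 + 5 / (k : ℝ)) atTop (𝓝 (1 + 0)) :=
      tendsto_const_nhds.add (tendsto_const_div_atTop_nhds_zero_nat 5)
    rw [add_zero] at this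
    refine this.congr' ?_
    filter_upwards [eventually_gt_atTop 0] with k hk
    have : (k : ℝ) ≠ 0 := by exact_mod_cast hk.ne'
    field_simp
  have h5 := ((((h1.comp h3).add (h2.comp h3)).mul h4).const_mul A)
  rw [add_zero, zero_mul, mul_zero] at h5
  refine h5.congr fun k => ?_
  have : (0 : ℝ) < k + 5 := by positivity
  simp only [Function.comp]
  field_simp

theorem LFunction_eq_zero_of_inv {χ : DirichletCharacter ℂ q} (hχ : χ ≠ 1) (hp : χ.IsPrimitive)
    {p : ℂ} (h0 : χ⁻¹.LFunction p = 0) (hre : 0 < p.re) :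
    χ.LFunction (1 - p) = 0 ∧ 0 < (1 - p).re ∧ (1 - p).re < 1 := by
  rw [← completedLFunction_eq_zero_iff _ hre, ← completedLFunction_one_sub_eq_zero_iff hχ hp] at h0
  have h1 := mem_strip_of_completedLFunction_eq_zero hχ hp h0
  exact ⟨(completedLFunction_eq_zero_iff χ h1.1).1 h0, h1⟩

/-- Good heights for the horizontal sides of the contour. -/
theorem exists_good_heights (hG : GRH) {χ : DirichletCharacter ℂ q} (hχ : χ ≠ 1)
    (hp : χ.IsPrimitive) : ∃ B : ℕ → ℝ, Tendsto (fun k => B k / k) atTop (𝓝 0) ∧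
      ∀ k : ℕ, ∃ T ∈ Set.Icc (k : ℝ) (k + 1), ∀ t : ℝ, |t| = T → ∀ σ ∈ Set.Icc (-1 / 2 : ℝ) (3 / 2),
        completedLFunction χ (σ + t * I) ≠ 0 ∧
          ‖logDeriv (completedLFunction χ) (σ + t * I)‖ ≤ B k := by
  obtain ⟨C, hC, hN⟩ := exists_sum_order_le hG hχ
  obtain ⟨D, hD, hd⟩ := exists_norm_logDeriv_completedLFunction_le hχ
  obtain ⟨D', hD', hd'⟩ := exists_norm_logDeriv_completedLFunction_le (inv_ne_one_of_ne_one hχ)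
  have hent := differentiable_LFunction hχ
  have hlogq : 0 ≤ Real.log q := Real.log_natCast_nonneg q
  have hE : 0 < D + D' := by positivity
  refine ⟨fun k => ((D + D') * (2 * (C + 3)) + Real.log q) *
    (Real.log (k + 5) ^ 2 + (k + 5 : ℝ) ^ (3 / 4 : ℝ)), tendsto_log_sq_add_rpow_div _, fun k => ?_⟩
  have hk0 : (0 : ℝ) ≤ k := k.cast_nonneg
  have hfin := finite_zeros_of_entire hent (LFunction_two_ne_zero hχ)
    (K := Set.Icc (0 : ℝ) 1 ×ℂ Set.Icc (-(k + 1 : ℝ)) (k + 1)) (isCompact_Icc.reProdIm isCompact_Icc)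
  set Z := hfin.toFinset.filter fun p => (k : ℝ) ≤ |p.im| with hZ
  have hmemZ : ∀ p, p ∈ Z ↔ (p.re ∈ Set.Icc (0 : ℝ) 1 ∧ |p.im| ≤ k + 1) ∧ χ.LFunction p = 0 ∧
      (k : ℝ) ≤ |p.im| := by
    intro p
    rw [hZ, Finset.mem_filter, Set.Finite.mem_toFinset, Set.mem_ofPred_eq, mem_reProdIm, abs_le,
      Set.mem_Icc (a := (-(k + 1) : ℝ))]
    tauto
  set Z' := Z.filter fun p => 0 < p.re ∧ p.re < 1 with hZ'
  have hcard : (Z'.card : ℝ) ≤ C * Real.log (k + 5) := by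
    refine le_trans ?_ (hN k Z' ?_)
    · rw [Finset.card_eq_sum_ones, Nat.cast_sum]
      refine Finset.sum_le_sum fun p hp => ?_
      rw [hZ', Finset.mem_filter, hmemZ] at hp
      exact_mod_cast one_le_analyticOrderNatAt hent (LFunction_two_ne_zero hχ) hp.1.2.1
    · intro p hp
      rw [hZ', Finset.mem_filter, hmemZ] at hp
      exact ⟨hp.1.2.1, hp.2.1, hp.2.2, hp.1.2.2, hp.1.1.2⟩
  -- Including the endpoints `k` and `k + 1` also keeps `T` away from the zeros outside this band.
  -- As `S` has `O(log k)` elements, the gap `δ` is `≫ 1/log k`.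
  set S : Finset ℝ := insert (k : ℝ) (insert (k + 1 : ℝ) (Z'.image fun p => |p.im|)) with hS
  have hScard : (S.card : ℝ) ≤ C * Real.log (k + 5) + 2 := by
    have h1 : S.card ≤ Z'.card + 2 := by
      refine (Finset.card_insert_le _ _).trans ?_
      have h2 := Finset.card_insert_le (k + 1 : ℝ) (Z'.image fun p => |p.im|)
      have h3 := Finset.card_image_le (s := Z') (f := fun p : ℂ => |p.im|)
      omega
    have h4 : (S.card : ℝ) ≤ Z'.card + 2 := by exact_mod_cast h1
    linarith
  obtain ⟨T, hT, hTS⟩ := exists_far_point S k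
  have hT0 : 0 ≤ T := hk0.trans hT.1
  set δ := 1 / (2 * ((S.card : ℝ) + 1)) with hδ
  have hlog1 : 1 ≤ Real.log (k + 5) := by
    rw [Real.le_log_iff_exp_le (by positivity)]
    linarith [Real.exp_one_lt_d9]
  have hδ0 : 0 < δ := by positivity
  have hδ1 : δ ≤ 1 := by
    rw [hδ, div_le_one (by positivity)]
    linarith [(S.card.cast_nonneg : (0 : ℝ) ≤ _)]
  have hδinv : 1 / δ ≤ 2 * (C + 3) * Real.log (k + 5) := by
    rw [hδ, one_div_one_div]
    nlinarith
  have hfar : ∀ p, χ.LFunction p = 0 → 0 < p.re → p.re < 1 → δ ≤ |T - (|p.im|)| := by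
    intro p h0 hre hre1
    by_cases h1 : |p.im| < k
    · have h2 := hTS k (by simp [hS])
      rw [abs_of_nonneg (by linarith [hT.1])] at h2
      exact h2.trans ((by linarith : T - k ≤ T - |p.im|).trans (le_abs_self _))
    by_cases h2 : k + 1 < |p.im|
    · have h3 := hTS (k + 1) (by simp [hS])
      rw [abs_of_nonpos (by linarith [hT.2])] at h3
      exact h3.trans ((by linarith : -(T - (k + 1)) ≤ -(T - |p.im|)).trans (neg_le_abs _))
    · refine hTS _ ?_
      rw [hS, Finset.mem_insert, Finset.mem_insert, Finset.mem_image]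
      refine Or.inr (Or.inr ⟨p, ?_, rfl⟩)
      rw [hZ', Finset.mem_filter, hmemZ]
      exact ⟨⟨⟨⟨hre.le, hre1.le⟩, not_lt.1 h2⟩, h0, not_lt.1 h1⟩, hre, hre1⟩
  have hbound : ∀ t : ℝ, |t| = T → Real.log (|t| + 4) / δ + (|t| + 2) ^ (3 / 4 : ℝ) ≤
      2 * (C + 3) * (Real.log (k + 5) ^ 2 + (k + 5 : ℝ) ^ (3 / 4 : ℝ)) := by
    intro t ht
    rw [ht]
    have h1 : Real.log (T + 4) ≤ Real.log (k + 5) :=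
      Real.log_le_log (by linarith) (by linarith [hT.2])
    have h2 : (T + 2) ^ (3 / 4 : ℝ) ≤ (k + 5 : ℝ) ^ (3 / 4 : ℝ) :=
      Real.rpow_le_rpow (by linarith) (by linarith [hT.2]) (by norm_num)
    have h3 : Real.log (T + 4) / δ ≤ Real.log (k + 5) * (2 * (C + 3) * Real.log (k + 5)) := by
      rw [div_eq_mul_one_div]
      exact mul_le_mul h1 hδinv (by positivity) (by linarith)
    have h4 : 0 ≤ (k + 5 : ℝ) ^ (3 / 4 : ℝ) := by positivity
    nlinarith [mul_nonneg hC.le h4]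
  have hX0 : 1 ≤ Real.log (k + 5) ^ 2 + (k + 5 : ℝ) ^ (3 / 4 : ℝ) := by
    have h4 : 0 ≤ (k + 5 : ℝ) ^ (3 / 4 : ℝ) := by positivity
    nlinarith
  set X := Real.log (k + 5) ^ 2 + (k + 5 : ℝ) ^ (3 / 4 : ℝ) with hX
  refine ⟨T, hT, fun t ht σ hσ => ?_⟩
  -- Right of the critical line the bound is direct; left of it the functional equation reduces to
  -- `χ⁻¹` at `1 - s`.
  rcases le_total (1 / 2) σ with hσ1 | hσ1
  · obtain ⟨h1, h2⟩ := hd t δ hδ0 hδ1 (fun p h0 hre => by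
      rw [ht]
      refine hfar p h0 hre ?_
      by_contra! h
      exact LFunction_ne_zero_of_one_le_re χ (Or.inl hχ) h h0) σ ⟨hσ1, hσ.2⟩
    refine ⟨?_, h2.trans ?_⟩
    · rwa [Ne, completedLFunction_eq_zero_iff χ (by simp; linarith)]
    · have h3 := mul_le_mul_of_nonneg_left (hbound t ht) hD.le
      have h4 : 0 ≤ D' * (2 * (C + 3) * X) := by positivity
      have h5 : 0 ≤ Real.log q * X := by positivity
      linarith
  · have h1s : (σ + t * I : ℂ) = 1 - ((1 - σ : ℝ) + (-t : ℝ) * I) := by push_cast; ring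
    obtain ⟨h1, h2⟩ := hd' (-t) δ hδ0 hδ1 (fun p h0 hre => by
      rw [abs_neg, ht]
      obtain ⟨h3, h4, h5⟩ := LFunction_eq_zero_of_inv hχ hp h0 hre
      simpa using hfar (1 - p) h3 h4 h5) (1 - σ) ⟨by linarith, by linarith [hσ.1]⟩
    have h3 : completedLFunction χ⁻¹ ((1 - σ : ℝ) + (-t : ℝ) * I) ≠ 0 := by
      rwa [Ne, completedLFunction_eq_zero_iff _ (by simp; linarith)]
    rw [h1s]
    refine ⟨?_, ?_⟩
    · rwa [Ne, completedLFunction_one_sub_eq_zero_iff hχ hp]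
    · rw [logDeriv_completedLFunction_one_sub hχ hp h3, norm_neg]
      refine (norm_add_le _ _).trans ?_
      rw [norm_real, Real.norm_of_nonneg hlogq]
      have h4 := h2.trans (mul_le_mul_of_nonneg_left (hbound (-t) (by rw [abs_neg, ht])) hD'.le)
      have h5 : 0 ≤ D * (2 * (C + 3) * X) := by positivity
      have h6 : Real.log q * 1 ≤ Real.log q * X := mul_le_mul_of_nonneg_left hX0 hlogq
      linarith

end GoodHeights

/-! ### The explicit formula for primitive characters. -/

section PrimitiveCharacters

open Complex MeasureTheory DirichletCharacter

variable {q : ℕ} [NeZero q]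

theorem truncatedZeroSum_eq_sum {χ : DirichletCharacter ℂ q} (hχ : χ ≠ 1) (x T : ℝ) :
    truncatedZeroSum χ x T = ∑ ρ ∈ (finite_nonrealZeros hχ T).toFinset,
      (analyticOrderNatAt χ.LFunction ρ : ℂ) * ((x : ℂ) ^ ρ / ρ) :=
  finsum_mem_eq_finite_toFinset_sum _ _

/-- Between heights `n` and `n + 1` there are `O(log n)` zeros, each contributing at most `√x / n`
under GRH. -/
theorem exists_norm_truncatedZeroSum_sub_le (hG : GRH) {χ : DirichletCharacter ℂ q} (hχ : χ ≠ 1)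
    {x : ℝ} (hx : 0 < x) : ∃ C : ℝ, ∀ n : ℕ, 1 ≤ n → ∀ T ∈ Set.Icc (n : ℝ) (n + 1),
      ∀ T' ∈ Set.Icc (n : ℝ) (n + 1),
      ‖truncatedZeroSum χ x T' - truncatedZeroSum χ x T‖ ≤ C * Real.log (n + 5) / n := by
  obtain ⟨C, hC, hN⟩ := exists_sum_order_le hG hχ
  refine ⟨x ^ (1 / 2 : ℝ) * C, fun n hn => ?_⟩
  have hn0 : (0 : ℝ) < n := by exact_mod_cast hn
  have key : ∀ T ∈ Set.Icc (n : ℝ) (n + 1), ∀ T' ∈ Set.Icc (n : ℝ) (n + 1), T ≤ T' →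
      ‖truncatedZeroSum χ x T' - truncatedZeroSum χ x T‖ ≤
        x ^ (1 / 2 : ℝ) * C * Real.log (n + 5) / n := by
    intro T hT T' hT' hTT'
    have hsub : (finite_nonrealZeros hχ T).toFinset ⊆ (finite_nonrealZeros hχ T').toFinset := by
      rw [Set.Finite.toFinset_subset_toFinset]
      rintro ρ ⟨h1, h2, h3, h4, h5⟩
      exact ⟨h1, h2, h3, h4, h5.trans hTT'⟩
    rw [truncatedZeroSum_eq_sum hχ, truncatedZeroSum_eq_sum hχ, ← Finset.sum_sdiff hsub,
      add_sub_cancel_right]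
    have hmem : ∀ p ∈ (finite_nonrealZeros hχ T').toFinset \ (finite_nonrealZeros hχ T).toFinset,
        χ.LFunction p = 0 ∧ 0 < p.re ∧ p.re < 1 ∧ (n : ℝ) ≤ |p.im| ∧ |p.im| ≤ n + 1 := by
      intro p hp
      rw [Finset.mem_sdiff, Set.Finite.mem_toFinset, Set.Finite.mem_toFinset] at hp
      obtain ⟨⟨h1, h2, h3, h4, h5⟩, h6⟩ := hp
      refine ⟨h1, h2, h3, ?_, h5.trans hT'.2⟩
      by_contra! h7
      exact h6 ⟨h1, h2, h3, h4, h7.le.trans hT.1⟩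
    calc _ ≤ ∑ p ∈ (finite_nonrealZeros hχ T').toFinset \ (finite_nonrealZeros hχ T).toFinset,
          (analyticOrderNatAt χ.LFunction p : ℝ) * (x ^ (1 / 2 : ℝ) / n) := by
          refine norm_sum_le_of_le _ fun p hp => ?_
          obtain ⟨h1, h2, h3, h4, h5⟩ := hmem p hp
          rw [norm_mul, Complex.norm_natCast, norm_div, norm_cpow_eq_rpow_re_of_pos hx,
            hG q χ p h2 h3 h1]
          have h6 := h4.trans (abs_im_le_norm p)
          gcongr
      _ = (∑ p ∈ (finite_nonrealZeros hχ T').toFinset \ (finite_nonrealZeros hχ T).toFinset,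
          (analyticOrderNatAt χ.LFunction p : ℝ)) * (x ^ (1 / 2 : ℝ) / n) :=
          (Finset.sum_mul _ _ _).symm
      _ ≤ C * Real.log (n + 5) * (x ^ (1 / 2 : ℝ) / n) := by
          gcongr
          exact hN n _ hmem
      _ = _ := by ring
  intro T hT T' hT'
  rcases le_total T T' with h | h
  · exact key T hT T' hT' h
  · rw [norm_sub_rev]
    exact key T' hT' T hT h

/-- Convergence along good heights gives the full limit in `T`, as the truncated sum hardly changes
within a unit interval. -/
theorem isNonrealZeroSum_of_tendsto (hG : GRH) {χ : DirichletCharacter ℂ q} (hχ : χ ≠ 1)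
    {x : ℝ} (hx : 0 < x) {T : ℕ → ℝ} (hT : ∀ n : ℕ, T n ∈ Set.Icc (n : ℝ) (n + 1)) {S : ℂ}
    (h : Tendsto (fun n => truncatedZeroSum χ x (T n)) atTop (𝓝 S)) : IsNonrealZeroSum χ x S := by
  obtain ⟨C, hC⟩ := exists_norm_truncatedZeroSum_sub_le hG hχ hx
  have hfloor : Tendsto (fun y : ℝ => ⌊y⌋₊) atTop atTop := tendsto_nat_floor_atTop
  have hlog : Tendsto (fun n : ℕ => C * Real.log (n + 5) / n) atTop (𝓝 0) := by
    have h1 := (tendsto_log_sq_add_rpow_div |C|)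
    refine squeeze_zero_norm (fun n => ?_) h1
    rw [norm_div, norm_mul, Real.norm_eq_abs, Real.norm_natCast]
    have h2 : 1 ≤ Real.log ((n : ℝ) + 5) := by
      rw [Real.le_log_iff_exp_le (by positivity)]
      linarith [Real.exp_one_lt_d9, (n.cast_nonneg : (0 : ℝ) ≤ n)]
    have h3 : 0 ≤ ((n : ℝ) + 5) ^ (3 / 4 : ℝ) := by positivity
    gcongr
    rw [Real.norm_of_nonneg (by linarith)]
    nlinarith
  have h2 : Tendsto (fun y : ℝ => truncatedZeroSum χ x y - truncatedZeroSum χ x (T ⌊y⌋₊)) atTop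
      (𝓝 0) := by
    refine squeeze_zero_norm' ?_ (hlog.comp hfloor)
    filter_upwards [eventually_ge_atTop 1] with y hy
    exact hC _ (Nat.le_floor (by simpa using hy)) _ (hT _) _
      ⟨Nat.floor_le (by linarith), (Nat.lt_floor_add_one y).le⟩
  have h3 := h2.add (h.comp hfloor)
  rw [zero_add] at h3
  exact h3.congr fun y => by simp

theorem exp_log_mul_eq_cpow {u : ℝ} (hu : 0 < u) (s : ℂ) :
    exp (Real.log u * s) = (u : ℂ) ^ s := by
  rw [cpow_def_of_ne_zero (by exact_mod_cast hu.ne'), ofReal_log hu.le]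

/-- The zeros of the completed `L`-function up to a given height, split into real and nonreal
ones. -/
theorem sum_zeros_eq (hG : GRH) {χ : DirichletCharacter ℂ q} (hχ : χ ≠ 1) {u T : ℝ}
    (hu : 0 < u) (hT : 0 ≤ T) (Z : Finset ℂ) (hZ : ∀ p, p ∈ Z ↔ χ.LFunction p = 0 ∧ 0 < p.re ∧
      p.re < 1 ∧ |p.im| ≤ T) :
    ∑ p ∈ Z, (analyticOrderNatAt (completedLFunction χ) p : ℂ) * (exp (Real.log u * p) / p) =
      truncatedZeroSum χ u T + 2 * z χ * Real.sqrt u := by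
  have h1 : ∀ p ∈ Z, (analyticOrderNatAt (completedLFunction χ) p : ℂ) *
      (exp (Real.log u * p) / p) = (analyticOrderNatAt χ.LFunction p : ℂ) * ((u : ℂ) ^ p / p) := by
    intro p hp
    rw [analyticOrderNatAt_completedLFunction hχ ((hZ p).1 hp).2.1, exp_log_mul_eq_cpow hu]
  rw [Finset.sum_congr rfl h1, ← Finset.sum_filter_add_sum_filter_not Z (fun p => p.im ≠ 0),
    truncatedZeroSum_eq_sum hχ]
  have h2 : (Z.filter fun p => p.im ≠ 0) = (finite_nonrealZeros hχ T).toFinset := by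
    ext p
    rw [Finset.mem_filter, Set.Finite.mem_toFinset, hZ]
    constructor
    · rintro ⟨⟨h1, h2, h3, h4⟩, h5⟩
      exact ⟨h1, h2, h3, h5, h4⟩
    · rintro ⟨h1, h2, h3, h4, h5⟩
      exact ⟨⟨h1, h2, h3, h5⟩, h4⟩
  rw [h2]
  congr 1
  have hsq : ((u : ℂ) ^ (1 / 2 : ℂ)) = Real.sqrt u := by
    rw [Real.sqrt_eq_rpow, ofReal_cpow hu.le]
    push_cast
    rfl
  -- Under GRH the only possible real zero is `1/2`, with term `z χ · √u / (1/2)`; if `L` does not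
  -- vanish there, the order is `0`.
  have h3 : (Z.filter fun p => ¬ p.im ≠ 0) ⊆ {1 / 2} := by
    intro p hp
    rw [Finset.mem_filter, hZ, not_not] at hp
    obtain ⟨⟨h1, h2, h3, -⟩, h5⟩ := hp
    rw [Finset.mem_singleton]
    apply Complex.ext
    · rw [hG q χ p h2 h3 h1]
      norm_num
    · rw [h5]
      norm_num
  rw [Finset.sum_subset h3, Finset.sum_singleton, hsq, z]
  · ring
  · intro p hp hp'
    rw [Finset.mem_singleton] at hp
    subst hp
    have hne : χ.LFunction (1 / 2) ≠ 0 := by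
      intro h0
      refine hp' ?_
      rw [Finset.mem_filter, hZ, not_not]
      refine ⟨⟨h0, ?_, ?_, ?_⟩, ?_⟩ <;> norm_num [hT]
    have h4 : analyticOrderAt χ.LFunction (1 / 2) = 0 :=
      ((differentiable_LFunction hχ).analyticAt _).analyticOrderAt_eq_zero.2 hne
    rw [analyticOrderNatAt, h4]
    simp

/-- The two vertical sides of the contour. -/
theorem tendsto_vertical_sides {χ : DirichletCharacter ℂ q} (hχ : χ ≠ 1) (hp : χ.IsPrimitive) {k : ℕ}
    (hk : 1 ≤ k) {ℓ : ℝ} (hℓ : ℓ = Real.log (k + 1 / 2)) (hℓ0 : 0 < ℓ) {J₁ J₂ : ℂ}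
    (h₁ : Tendsto (fun T : ℝ => ∫ t : ℝ in (-T)..T, archLogDeriv (archParity χ)
      ((3 / 2 : ℝ) + t * I) * (exp (ℓ * ((3 / 2 : ℝ) + t * I)) / ((3 / 2 : ℝ) + t * I)))
      atTop (𝓝 J₁))
    (h₂ : Tendsto (fun T : ℝ => ∫ t : ℝ in (-T)..T, archLogDeriv (archParity χ)
      ((3 / 2 : ℝ) + (-t : ℝ) * I) * (exp (ℓ * ((-1 / 2 : ℝ) + t * I)) / ((-1 / 2 : ℝ) + t * I)))
      atTop (𝓝 J₂)) :
    Tendsto (fun T : ℝ => (∫ t : ℝ in (-T)..T, logDeriv (completedLFunction χ)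
        ((3 / 2 : ℝ) + t * I) * (exp (ℓ * ((3 / 2 : ℝ) + t * I)) / ((3 / 2 : ℝ) + t * I))) -
      ∫ t : ℝ in (-T)..T, logDeriv (completedLFunction χ) ((-1 / 2 : ℝ) + t * I) *
        (exp (ℓ * ((-1 / 2 : ℝ) + t * I)) / ((-1 / 2 : ℝ) + t * I))) atTop
      (𝓝 (-(2 * Real.pi * ∑ n ∈ Finset.range (k + 1), twistedLambda χ n) + (J₁ + J₂))) := by
  have hχ' := inv_ne_one_of_ne_one hχ
  have hne : ∀ c : ℝ, c ≠ 0 → ∀ t : ℝ, ((c : ℂ) + t * I) ≠ 0 := fun c hc t => by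
    rw [← norm_pos_iff]
    exact lt_of_lt_of_le (abs_pos.2 hc) (norm_add_mul_I_ge c t)
  have hkc : ∀ c : ℝ, c ≠ 0 → Continuous fun t : ℝ => exp (ℓ * (c + t * I)) / ((c : ℂ) + t * I) :=
    fun c hc => Continuous.div (by fun_prop) (by fun_prop) (hne c hc)
  have hac : ∀ {γ : ℝ → ℂ}, Continuous γ → (∀ t, 0 < (γ t).re) →
      Continuous fun t => archLogDeriv (archParity χ) (γ t) := by
    intro γ hγ hre
    refine continuous_iff_continuousAt.2 fun t => ?_
    exact ContinuousAt.comp (g := archLogDeriv (archParity χ)) (f := γ)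
      (hasDerivAt_archLogDeriv (archParity_nonneg χ) (hre t)).continuousAt hγ.continuousAt
  have hR := tendsto_integral_logDeriv_right χ hk hℓ
  have hL := tendsto_integral_logDeriv_left χ⁻¹ hℓ0
  -- The term `log q` of the functional equation multiplies a Perron integral left of the pole,
  -- which vanishes in the limit.
  have hP : Tendsto (fun T : ℝ => ∫ t : ℝ in (-T)..T,
      exp (ℓ * ((-1 / 2 : ℝ) + t * I)) / (((-1 / 2 : ℝ) : ℂ) + t * I)) atTop (𝓝 0) := by
    have hb : Tendsto (fun T : ℝ => 2 * Real.exp (ℓ * (-1 / 2)) / ℓ * T⁻¹) atTop (𝓝 0) := by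
      simpa using tendsto_inv_atTop_zero.const_mul (2 * Real.exp (ℓ * (-1 / 2)) / ℓ)
    refine squeeze_zero_norm' ?_ hb
    filter_upwards [eventually_gt_atTop 0] with T hT
    have h2 := norm_integral_exp_div_sub_le hℓ0 (c := -1 / 2) (T := T) (by norm_num) hT
    rw [if_neg (by norm_num), sub_zero] at h2
    refine h2.trans (le_of_eq ?_)
    field_simp
  have hsum := (hR.neg.add h₁).add (((hP.const_mul (Real.log q : ℂ)).add hL.neg).add h₂)
  convert! hsum using 1
  · funext T
    have e1 : (∫ t : ℝ in (-T)..T, logDeriv (completedLFunction χ)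
        ((3 / 2 : ℝ) + t * I) * (exp (ℓ * ((3 / 2 : ℝ) + t * I)) / ((3 / 2 : ℝ) + t * I))) =
        -(∫ t : ℝ in (-T)..T, -logDeriv χ.LFunction ((3 / 2 : ℝ) + t * I) *
          (exp (ℓ * ((3 / 2 : ℝ) + t * I)) / ((3 / 2 : ℝ) + t * I))) +
        ∫ t : ℝ in (-T)..T, archLogDeriv (archParity χ) ((3 / 2 : ℝ) + t * I) *
          (exp (ℓ * ((3 / 2 : ℝ) + t * I)) / ((3 / 2 : ℝ) + t * I)) := by
      rw [← intervalIntegral.integral_neg, ← intervalIntegral.integral_add]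
      · refine intervalIntegral.integral_congr fun t _ => ?_
        rw [logDeriv_completedLFunction hχ (by norm_num)
          (LFunction_ne_zero_of_one_le_re χ (Or.inl hχ) (by norm_num))]
        ring
      · refine Continuous.intervalIntegrable ?_ _ _
        exact ((continuous_logDeriv_LFunction_vertical hχ (γ := fun t : ℝ => (3 / 2 : ℝ) + t * I)
          (by fun_prop) (fun t => by norm_num)).neg.mul (hkc (3 / 2) (by norm_num))).neg
      · refine Continuous.intervalIntegrable ?_ _ _
        exact (hac (γ := fun t : ℝ => (3 / 2 : ℝ) + t * I)
          (by fun_prop) (fun t => by norm_num)).mul (hkc (3 / 2) (by norm_num))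
    have e2 : -(∫ t : ℝ in (-T)..T, logDeriv (completedLFunction χ) ((-1 / 2 : ℝ) + t * I) *
        (exp (ℓ * ((-1 / 2 : ℝ) + t * I)) / ((-1 / 2 : ℝ) + t * I))) =
        ((Real.log q : ℂ) * (∫ t : ℝ in (-T)..T,
          exp (ℓ * ((-1 / 2 : ℝ) + t * I)) / (((-1 / 2 : ℝ) : ℂ) + t * I)) +
        -(∫ t : ℝ in (-T)..T, -logDeriv χ⁻¹.LFunction ((3 / 2 : ℝ) + (-t : ℝ) * I) *
          (exp (ℓ * ((-1 / 2 : ℝ) + t * I)) / ((-1 / 2 : ℝ) + t * I)))) +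
        ∫ t : ℝ in (-T)..T, archLogDeriv (archParity χ) ((3 / 2 : ℝ) + (-t : ℝ) * I) *
          (exp (ℓ * ((-1 / 2 : ℝ) + t * I)) / ((-1 / 2 : ℝ) + t * I)) := by
      have i1 : Continuous fun t : ℝ => (Real.log q : ℂ) * (exp (ℓ * ((-1 / 2 : ℝ) + t * I)) /
          (((-1 / 2 : ℝ) : ℂ) + t * I)) := (hkc (-1 / 2) (by norm_num)).const_mul _
      have i2 : Continuous fun t : ℝ => -(-logDeriv χ⁻¹.LFunction ((3 / 2 : ℝ) + (-t : ℝ) * I) *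
          (exp (ℓ * ((-1 / 2 : ℝ) + t * I)) / ((-1 / 2 : ℝ) + t * I))) :=
        ((continuous_logDeriv_LFunction_vertical hχ' (γ := fun t : ℝ => (3 / 2 : ℝ) + (-t : ℝ) * I)
          (by fun_prop) (fun t => by norm_num)).neg.mul (hkc (-1 / 2) (by norm_num))).neg
      have i3 : Continuous fun t : ℝ => archLogDeriv (archParity χ) ((3 / 2 : ℝ) + (-t : ℝ) * I) *
          (exp (ℓ * ((-1 / 2 : ℝ) + t * I)) / ((-1 / 2 : ℝ) + t * I)) :=
        (hac (γ := fun t : ℝ => (3 / 2 : ℝ) + (-t : ℝ) * I)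
          (by fun_prop) (fun t => by norm_num)).mul (hkc (-1 / 2) (by norm_num))
      rw [← intervalIntegral.integral_neg, ← intervalIntegral.integral_neg,
        ← intervalIntegral.integral_const_mul,
        ← intervalIntegral.integral_add (i1.intervalIntegrable _ _) (i2.intervalIntegrable _ _),
        ← intervalIntegral.integral_add (by exact (i1.add i2).intervalIntegrable _ _)
          (i3.intervalIntegrable _ _)]
      refine intervalIntegral.integral_congr fun t _ => ?_
      have hL0 : χ⁻¹.LFunction ((3 / 2 : ℝ) + (-t : ℝ) * I) ≠ 0 :=
        LFunction_ne_zero_of_one_le_re _ (Or.inl hχ') (by norm_num)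
      have hs : ((-1 / 2 : ℝ) : ℂ) + t * I = 1 - ((3 / 2 : ℝ) + (-t : ℝ) * I) := by
        push_cast
        ring
      have hlog : logDeriv (completedLFunction χ) ((-1 / 2 : ℝ) + t * I) =
          -(Real.log q + (logDeriv χ⁻¹.LFunction ((3 / 2 : ℝ) + (-t : ℝ) * I) +
            archLogDeriv (archParity χ) ((3 / 2 : ℝ) + (-t : ℝ) * I))) := by
        rw [hs, logDeriv_completedLFunction_one_sub hχ hp
          (by rwa [Ne, completedLFunction_eq_zero_iff _ (by norm_num)]),
          logDeriv_completedLFunction hχ' (by norm_num) hL0, archParity_inv]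
      rw [hlog]
      ring
    rw [e1, sub_eq_add_neg, e2]
  · congr 1
    ring

/-- The horizontal sides of the contour are negligible. -/
theorem norm_horizontal_side_le {f : ℂ → ℂ} {ℓ B T t : ℝ} (hℓ : 0 < ℓ) (hB : 0 ≤ B) (hT : 0 < T)
    (ht : |t| = T) (hf : ∀ σ ∈ Set.Icc (-1 / 2 : ℝ) (3 / 2), ‖f (σ + t * I)‖ ≤ B) :
    ‖∫ σ : ℝ in (-1 / 2 : ℝ)..(3 / 2), f (σ + t * I) *
      (exp (ℓ * (σ + t * I)) / (σ + t * I))‖ ≤ 2 * Real.exp (ℓ * (3 / 2)) * (B / T) := by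
  have h := intervalIntegral.norm_integral_le_of_norm_le_const (a := (-1 / 2 : ℝ)) (b := 3 / 2)
    (f := fun σ : ℝ => f (σ + t * I) * (exp (ℓ * (σ + t * I)) / (σ + t * I)))
    (C := B * (Real.exp (ℓ * (3 / 2)) / T)) ?_
  · refine h.trans (le_of_eq ?_)
    rw [abs_of_nonneg (by norm_num)]
    ring
  · intro σ hσ
    rw [Set.uIoc_of_le (by norm_num)] at hσ
    rw [norm_mul, norm_div, norm_exp_mul_add_mul_I]
    have h1 : T ≤ ‖(σ + t * I : ℂ)‖ := by
      rw [← ht]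
      simpa using abs_im_le_norm (σ + t * I : ℂ)
    have h2 := hf σ ⟨hσ.1.le, hσ.2⟩
    have h3 : Real.exp (ℓ * σ) ≤ Real.exp (ℓ * (3 / 2)) :=
      Real.exp_le_exp.2 (mul_le_mul_of_nonneg_left hσ.2 hℓ.le)
    gcongr

/-- For a primitive character the zeros of the completed function all lie in the open strip, so the
point `0` is not a zero; the pole of `1/s` there contributes the constant `logDeriv` at `0`. -/
theorem logDeriv_completedLFunction_contour (hG : GRH) {χ : DirichletCharacter ℂ q} (hχ : χ ≠ 1)
    (hp : χ.IsPrimitive) {u T : ℝ} (hu : 0 < u) (hT : 0 < T)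
    (hne : ∀ t : ℝ, |t| = T → ∀ σ ∈ Set.Icc (-1 / 2 : ℝ) (3 / 2),
      completedLFunction χ (σ + t * I) ≠ 0) :
    rectIntegral (fun s => logDeriv (completedLFunction χ) s * (exp (Real.log u * s) / s))
      (-1 / 2) (3 / 2) (-T) T = 2 * Real.pi * I * (truncatedZeroSum χ u T + 2 * z χ * Real.sqrt u +
        logDeriv (completedLFunction χ) 0) := by
  have hstrip : ∀ {s : ℂ}, completedLFunction χ s = 0 → 0 < s.re ∧ s.re < 1 :=
    fun h => mem_strip_of_completedLFunction_eq_zero hχ hp h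
  have h0 : completedLFunction χ 0 ≠ 0 := fun h => by simpa using (hstrip h).1
  have hfin := finite_zeros_of_entire (differentiable_completedLFunction hχ) h0
    (K := Set.Icc (-1 / 2 : ℝ) (3 / 2) ×ℂ Set.Icc (-T) T) (isCompact_Icc.reProdIm isCompact_Icc)
  have hmem : ∀ p, p ∈ hfin.toFinset ↔ χ.LFunction p = 0 ∧ 0 < p.re ∧ p.re < 1 ∧ |p.im| ≤ T := by
    intro p
    rw [Set.Finite.mem_toFinset, Set.mem_ofPred_eq, mem_reProdIm, abs_le]
    constructor
    · rintro ⟨⟨-, h2⟩, h3⟩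
      have h4 := hstrip h3
      exact ⟨(completedLFunction_eq_zero_iff χ h4.1).1 h3, h4.1, h4.2, h2⟩
    · rintro ⟨h1, h2, h3, h4⟩
      exact ⟨⟨⟨by linarith, by linarith⟩, h4⟩, (completedLFunction_eq_zero_iff χ h2).2 h1⟩
  have hrect := rectIntegral_logDeriv_mul (a := -1 / 2) (b := 3 / 2) (c := -T) (d := T)
    (by norm_num) (by norm_num) (by linarith) hT (differentiable_completedLFunction hχ)
    (g := fun s => exp (Real.log u * s)) (by fun_prop) h0 hfin.toFinset ?_ ?_
  · rw [hrect, sum_zeros_eq hG hχ hu hT.le hfin.toFinset hmem]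
    simp
  · intro p hp
    obtain ⟨h1, h2, h3, h4⟩ := (hmem p).1 hp
    have h5 := (completedLFunction_eq_zero_iff χ h2).2 h1
    have h6 : |p.im| ≠ T := by
      intro h6
      refine hne p.im h6 p.re ⟨by linarith, by linarith⟩ ?_
      rwa [re_add_im]
    rw [mem_reProdIm]
    exact ⟨⟨⟨by linarith, by linarith⟩, abs_lt.1 (lt_of_le_of_ne h4 h6)⟩, h5⟩
  · intro p hp h0
    rw [Set.Finite.mem_toFinset]
    exact ⟨hp, h0⟩

/-- The explicit formula for primitive characters, under GRH. -/
theorem explicit_formula_of_isPrimitive (hG : GRH) : ∃ D : ℝ, 0 ≤ D ∧ ∀ (q : ℕ) [NeZero q]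
    (χ : DirichletCharacter ℂ q), χ ≠ 1 → χ.IsPrimitive → ∃ b : ℂ, ∀ k : ℕ, 1 ≤ k →
      ∃ S : ℂ, IsNonrealZeroSum χ (k + 1 / 2) S ∧
        ‖S + ∑ n ∈ Finset.range (k + 1), twistedLambda χ n + 2 * z χ * Real.sqrt (k + 1 / 2) + b‖ ≤
          D * (k + 1 / 2 : ℝ) ^ (1 / 8 : ℝ) := by
  obtain ⟨D₀, hD₀, hA₀⟩ := exists_archimedean_terms (a := 0) le_rfl
  obtain ⟨D₁, hD₁, hA₁⟩ := exists_archimedean_terms (a := 1) zero_le_one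
  -- The archimedean factor depends only on the parity of `χ`, so two constants cover all
  -- characters. The constant `b`, for which no uniform bound is claimed, does not depend on `k` and
  -- will cancel in differences.
  refine ⟨D₀ + D₁, by positivity, fun q _ χ hχ hp =>
    ⟨logDeriv (completedLFunction χ) 0, fun k hk => ?_⟩⟩
  have hk1 : (1 : ℝ) ≤ k := by exact_mod_cast hk
  set u : ℝ := k + 1 / 2 with hu
  have hu0 : 0 < u := by positivity
  set ℓ := Real.log u with hℓ
  have hℓ1 : Real.log (3 / 2) ≤ ℓ := Real.log_le_log (by norm_num) (by linarith)
  have hℓ0 : 0 < ℓ := (Real.log_pos (by norm_num)).trans_le hℓ1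
  have hexp : Real.exp (ℓ / 8) = u ^ (1 / 8 : ℝ) := by
    rw [Real.rpow_def_of_pos hu0, hℓ]
    ring_nf
  obtain ⟨J₁, J₂, hJ₁, hJ₂, hJ⟩ : ∃ J₁ J₂ : ℂ,
      Tendsto (fun T : ℝ => ∫ t : ℝ in (-T)..T, archLogDeriv (archParity χ) ((3 / 2 : ℝ) + t * I) *
        (exp (ℓ * ((3 / 2 : ℝ) + t * I)) / ((3 / 2 : ℝ) + t * I))) atTop (𝓝 J₁) ∧
      Tendsto (fun T : ℝ => ∫ t : ℝ in (-T)..T, archLogDeriv (archParity χ)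
        ((3 / 2 : ℝ) + (-t : ℝ) * I) *
        (exp (ℓ * ((-1 / 2 : ℝ) + t * I)) / ((-1 / 2 : ℝ) + t * I))) atTop (𝓝 J₂) ∧
      ‖J₁ + J₂‖ ≤ (D₀ + D₁) * Real.exp (ℓ / 8) := by
    rcases archParity_eq_zero_or_one χ with h | h
    · obtain ⟨J₁, J₂, h1, h2, h3⟩ := hA₀ ℓ hℓ1
      rw [h]
      exact ⟨J₁, J₂, h1, h2, h3.trans
        (mul_le_mul_of_nonneg_right (le_add_of_nonneg_right hD₁) (Real.exp_pos _).le)⟩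
    · obtain ⟨J₁, J₂, h1, h2, h3⟩ := hA₁ ℓ hℓ1
      rw [h]
      exact ⟨J₁, J₂, h1, h2, h3.trans
        (mul_le_mul_of_nonneg_right (le_add_of_nonneg_left hD₀) (Real.exp_pos _).le)⟩
  obtain ⟨B, hB, hheights⟩ := exists_good_heights hG hχ hp
  choose T hT hTB using hheights
  have hB0 : ∀ n, 0 ≤ B n := fun n =>
    (norm_nonneg _).trans (hTB n (T n) (abs_of_nonneg ((n.cast_nonneg).trans (hT n).1)) 0
      ⟨by norm_num, by norm_num⟩).2
  have hTtop : Tendsto T atTop atTop :=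
    tendsto_atTop_mono (fun n => (hT n).1) tendsto_natCast_atTop_atTop
  have hvert := (tendsto_vertical_sides hχ hp hk hℓ hℓ0 hJ₁ hJ₂).comp hTtop
  have hhor : ∀ s : ℝ, |s| = 1 → Tendsto (fun n => ∫ σ : ℝ in (-1 / 2 : ℝ)..(3 / 2),
      logDeriv (completedLFunction χ) (σ + (s * T n : ℝ) * I) *
        (exp (ℓ * (σ + (s * T n : ℝ) * I)) / (σ + (s * T n : ℝ) * I))) atTop (𝓝 0) := by
    intro s hs
    have h1 := hB.const_mul (2 * Real.exp (ℓ * (3 / 2)))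
    rw [mul_zero] at h1
    refine squeeze_zero_norm' ?_ h1
    filter_upwards [eventually_ge_atTop 1] with n hn
    have hn0 : (0 : ℝ) < n := by exact_mod_cast hn
    have hTn : 0 < T n := hn0.trans_le (hT n).1
    have habs : |s * T n| = T n := by rw [abs_mul, hs, one_mul, abs_of_pos hTn]
    refine (norm_horizontal_side_le hℓ0 (hB0 n) hTn habs
      fun σ hσ => (hTB n _ habs σ hσ).2).trans ?_
    have h3 := hB0 n
    have h4 := (hT n).1
    gcongr
  have hbot := hhor (-1) (by simp)
  have htop := hhor 1 (by simp)
  have htotal : Tendsto (fun n => truncatedZeroSum χ u (T n)) atTop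
      (𝓝 ((2 * Real.pi * I)⁻¹ * (0 - 0 + I * (-(2 * Real.pi * ∑ n ∈ Finset.range (k + 1),
        twistedLambda χ n) + (J₁ + J₂))) - (2 * z χ * Real.sqrt u +
          logDeriv (completedLFunction χ) 0))) := by
    refine Tendsto.congr' ?_ ((((hbot.sub htop).add (hvert.const_mul I)).const_mul
      ((2 * Real.pi * I)⁻¹)).sub_const _)
    filter_upwards [eventually_ge_atTop 1] with n hn
    have hn0 : (0 : ℝ) < n := by exact_mod_cast hn
    have hTn : 0 < T n := hn0.trans_le (hT n).1
    have h1 := logDeriv_completedLFunction_contour hG hχ hp hu0 hTn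
      (fun t ht σ hσ => (hTB n t ht σ hσ).1)
    have h2 : (2 * Real.pi * I : ℂ) ≠ 0 := two_pi_I_ne_zero
    rw [rectIntegral] at h1
    rw [sub_eq_iff_eq_add, inv_mul_eq_iff_eq_mul₀ h2, ← add_assoc, ← h1]
    simp only [Function.comp, neg_mul, one_mul]
    ring
  refine ⟨_, isNonrealZeroSum_of_tendsto hG hχ hu0 hT htotal, ?_⟩
  have hpi : (Real.pi : ℂ) ≠ 0 := by exact_mod_cast Real.pi_ne_zero
  have hval : (2 * Real.pi * I : ℂ)⁻¹ * (0 - 0 + I * (-(2 * Real.pi *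
      ∑ n ∈ Finset.range (k + 1), twistedLambda χ n) + (J₁ + J₂))) - (2 * z χ * Real.sqrt u +
      logDeriv (completedLFunction χ) 0) + ∑ n ∈ Finset.range (k + 1), twistedLambda χ n +
      2 * z χ * Real.sqrt u + logDeriv (completedLFunction χ) 0 = (J₁ + J₂) / (2 * Real.pi) := by
    field_simp
    ring
  rw [hval, norm_div, norm_mul, Complex.norm_ofNat, norm_real, Real.norm_of_nonneg Real.pi_pos.le,
    ← hexp]
  refine (div_le_self (norm_nonneg _) ?_).trans hJ
  linarith [Real.pi_gt_three]

end PrimitiveCharacters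

/-! ### From primitive to arbitrary characters. -/

section GeneralCharacters

open Complex MeasureTheory DirichletCharacter

section ChangeLevel

/-- `|χ(p) p^(-s)| < 1` for `Re s > 0`. Hence raising the level creates no zeros in the open strip
and leaves `z` and the zero sums unchanged. -/
theorem eulerFactor_ne_zero {M : ℕ} (χ : DirichletCharacter ℂ M) {p : ℕ} (hp : p.Prime) {s : ℂ}
    (hs : 0 < s.re) : 1 - χ p * (p : ℂ) ^ (-s) ≠ 0 := by
  have hp1 : (1 : ℝ) < p := by exact_mod_cast hp.one_lt
  intro h
  have h1 : ‖χ p * (p : ℂ) ^ (-s)‖ = 1 := by rw [← sub_eq_zero.1 h, norm_one]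
  rw [norm_mul, norm_natCast_cpow_of_pos hp.pos, neg_re] at h1
  have h2 : (p : ℝ) ^ (-s.re) < 1 := Real.rpow_lt_one_of_one_lt_of_neg hp1 (by linarith)
  have h3 := χ.norm_le_one p
  have h4 : 0 ≤ (p : ℝ) ^ (-s.re) := by positivity
  nlinarith [norm_nonneg (χ p)]

theorem eulerProduct_ne_zero {M N : ℕ} (χ : DirichletCharacter ℂ M) {s : ℂ} (hs : 0 < s.re) :
    ∏ p ∈ N.primeFactors, (1 - χ p * (p : ℂ) ^ (-s)) ≠ 0 :=
  Finset.prod_ne_zero_iff.2 fun _ hp => eulerFactor_ne_zero χ (Nat.prime_of_mem_primeFactors hp) hs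

variable {M N : ℕ} [NeZero M] [NeZero N]

theorem analyticOrderNatAt_LFunction_changeLevel (hMN : M ∣ N) (χ : DirichletCharacter ℂ M) {s : ℂ}
    (hs : 0 < s.re) (h : χ ≠ 1 ∨ s ≠ 1) :
    analyticOrderNatAt (changeLevel hMN χ).LFunction s = analyticOrderNatAt χ.LFunction s := by
  have hE : Differentiable ℂ fun s : ℂ => ∏ p ∈ N.primeFactors, (1 - χ p * (p : ℂ) ^ (-s)) := by
    refine Differentiable.fun_finsetProd fun p hp => ?_
    have : NeZero p := ⟨(Nat.prime_of_mem_primeFactors hp).ne_zero⟩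
    fun_prop
  have hev : (changeLevel hMN χ).LFunction =ᶠ[𝓝 s] χ.LFunction *
      fun s : ℂ => ∏ p ∈ N.primeFactors, (1 - χ p * (p : ℂ) ^ (-s)) := by
    rcases h with h | h
    · exact Eventually.of_forall fun w => LFunction_changeLevel hMN χ (Or.inl h)
    · filter_upwards [isOpen_compl_singleton.mem_nhds h] with w hw
      exact LFunction_changeLevel hMN χ (Or.inr hw)
  have hL : AnalyticAt ℂ χ.LFunction s := by
    rcases h with h | h
    · exact (differentiable_LFunction h).analyticAt s
    · refine DifferentiableOn.analyticAt (s := {1}ᶜ) (fun w hw => ?_)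
        (isOpen_compl_singleton.mem_nhds h)
      exact (differentiableAt_LFunction _ _ (Or.inl hw)).differentiableWithinAt
  unfold analyticOrderNatAt
  rw [analyticOrderAt_congr hev, analyticOrderAt_mul hL (hE.analyticAt s),
    (hE.analyticAt s).analyticOrderAt_eq_zero.2 (eulerProduct_ne_zero χ hs), add_zero]

theorem z_changeLevel (hMN : M ∣ N) (χ : DirichletCharacter ℂ M) : z (changeLevel hMN χ) = z χ :=
  analyticOrderNatAt_LFunction_changeLevel hMN χ (by norm_num) (Or.inr (by norm_num))

theorem nonrealZeros_changeLevel (hMN : M ∣ N) (χ : DirichletCharacter ℂ M) (T : ℝ) :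
    nonrealZeros (changeLevel hMN χ) T = nonrealZeros χ T := by
  ext ρ
  refine and_congr_left fun h => ?_
  have h1 : ρ ≠ 1 := by
    rintro rfl
    simpa using h.2.1
  rw [LFunction_changeLevel hMN χ (Or.inr h1), mul_eq_zero,
    or_iff_left (eulerProduct_ne_zero χ h.1)]

theorem truncatedZeroSum_changeLevel (hMN : M ∣ N) (χ : DirichletCharacter ℂ M) (x T : ℝ) :
    truncatedZeroSum (changeLevel hMN χ) x T = truncatedZeroSum χ x T := by
  unfold truncatedZeroSum
  rw [nonrealZeros_changeLevel]
  refine finsum_mem_congr rfl fun ρ hρ => ?_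
  rw [analyticOrderNatAt_LFunction_changeLevel hMN χ hρ.2.1]
  right
  rintro rfl
  simpa using hρ.2.2.1

theorem isNonrealZeroSum_changeLevel_iff (hMN : M ∣ N) (χ : DirichletCharacter ℂ M) (x : ℝ) (S : ℂ) :
    IsNonrealZeroSum (changeLevel hMN χ) x S ↔ IsNonrealZeroSum χ x S := by
  unfold IsNonrealZeroSum
  simp only [truncatedZeroSum_changeLevel]

end ChangeLevel

/-- The prime powers `n ≤ k` divisible by a given prime contribute at most `log k` to `∑ Λ(n)`. -/
theorem sum_vonMangoldt_dvd_le {p : ℕ} (hp : p.Prime) {k : ℕ} (hk : 1 ≤ k) :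
    ∑ n ∈ Finset.range (k + 1) with p ∣ n, ArithmeticFunction.vonMangoldt n ≤ Real.log k := by
  have hp1 : (1 : ℝ) < p := by exact_mod_cast hp.one_lt
  have h1 : ∑ n ∈ Finset.range (k + 1) with p ∣ n, ArithmeticFunction.vonMangoldt n ≤
      ∑ n ∈ (Finset.Icc 1 (Nat.log p k)).image (fun j => p ^ j), Real.log p := by
    rw [← Finset.sum_filter_ne_zero]
    have hmem : ∀ n ∈ (Finset.range (k + 1)).filter (fun n => p ∣ n),
        ArithmeticFunction.vonMangoldt n ≠ 0 → ∃ j, 1 ≤ j ∧ j ≤ Nat.log p k ∧ p ^ j = n := by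
      intro n hn h0
      rw [Finset.mem_filter, Finset.mem_range] at hn
      rw [ArithmeticFunction.vonMangoldt_ne_zero_iff, isPrimePow_nat_iff] at h0
      obtain ⟨r, j, hr, hj, rfl⟩ := h0
      have : p = r := (Nat.prime_dvd_prime_iff_eq hp hr).1 (hp.dvd_of_dvd_pow hn.2)
      subst this
      exact ⟨j, hj, Nat.le_log_of_pow_le hp.one_lt (by omega), rfl⟩
    refine (Finset.sum_le_sum (g := fun _ => Real.log p) ?_).trans
      (Finset.sum_le_sum_of_subset_of_nonneg ?_ fun _ _ _ => (Real.log_pos hp1).le)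
    · intro n hn
      rw [Finset.mem_filter] at hn
      obtain ⟨j, hj, -, rfl⟩ := hmem n hn.1 hn.2
      rw [ArithmeticFunction.vonMangoldt_apply_pow (by omega),
        ArithmeticFunction.vonMangoldt_apply_prime hp]
    · intro n hn
      rw [Finset.mem_filter] at hn
      obtain ⟨j, hj, hj', rfl⟩ := hmem n hn.1 hn.2
      exact Finset.mem_image_of_mem _ (Finset.mem_Icc.2 ⟨hj, hj'⟩)
  refine h1.trans ?_
  rw [Finset.sum_const, nsmul_eq_mul]
  have h2 : (((Finset.Icc 1 (Nat.log p k)).image (fun j => p ^ j)).card : ℝ) ≤ Nat.log p k := by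
    have := Finset.card_image_le (s := Finset.Icc 1 (Nat.log p k)) (f := fun j => p ^ j)
    rw [Nat.card_Icc, Nat.add_sub_cancel] at this
    exact_mod_cast this
  refine (mul_le_mul_of_nonneg_right h2 (Real.log_pos hp1).le).trans ?_
  rw [← Real.log_pow]
  refine Real.log_le_log (by positivity) ?_
  exact_mod_cast Nat.pow_log_le_self p (by omega)

theorem card_primeFactors_le {q : ℕ} (hq : q ≠ 0) : (q.primeFactors.card : ℝ) ≤ 2 * Real.log q := by
  have h1 : 2 ^ q.primeFactors.card ≤ q := by
    refine le_trans ?_ (Nat.le_of_dvd (Nat.pos_of_ne_zero hq) (Nat.prod_primeFactors_dvd q))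
    exact Finset.pow_card_le_prod _ _ _ fun p hp => (Nat.prime_of_mem_primeFactors hp).two_le
  have h2 : ((2 : ℝ) ^ q.primeFactors.card) ≤ q := by exact_mod_cast h1
  have h3 := Real.log_le_log (by positivity) h2
  rw [Real.log_pow] at h3
  have h4 := Real.log_two_gt_d9
  nlinarith [(q.primeFactors.card.cast_nonneg : (0 : ℝ) ≤ _)]

/-- The characters differ only at `n` divisible by a prime factor of `N`. Each such prime
contributes at most `log k`, and there are at most `2 log N` of them. -/
theorem norm_sum_twistedLambda_changeLevel_sub_le {M N : ℕ} [NeZero N] (hMN : M ∣ N)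
    (χ : DirichletCharacter ℂ M) {k : ℕ} (hk : 1 ≤ k) :
    ‖∑ n ∈ Finset.range (k + 1), twistedLambda (changeLevel hMN χ) n -
      ∑ n ∈ Finset.range (k + 1), twistedLambda χ n‖ ≤ 2 * Real.log N * Real.log k := by
  rw [← Finset.sum_sub_distrib]
  have hlogk : 0 ≤ Real.log k := Real.log_natCast_nonneg k
  calc _ ≤ ∑ n ∈ Finset.range (k + 1), ∑ p ∈ N.primeFactors,
        (if p ∣ n then ArithmeticFunction.vonMangoldt n else 0) := by
        refine norm_sum_le_of_le _ fun n _ => ?_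
        have hΛ : 0 ≤ ArithmeticFunction.vonMangoldt n := ArithmeticFunction.vonMangoldt_nonneg
        have hnn : ∀ p ∈ N.primeFactors,
            0 ≤ if p ∣ n then ArithmeticFunction.vonMangoldt n else 0 := by
          intro p _
          split_ifs
          exacts [hΛ, le_rfl]
        rw [twistedLambda, twistedLambda, ← sub_mul, norm_mul, norm_real, Real.norm_of_nonneg hΛ]
        by_cases hc : n.Coprime N
        · have hu : IsUnit (n : ZMod N) := (ZMod.isUnit_iff_coprime n N).2 hc
          have h1 := changeLevel_eq_cast_of_dvd χ hMN hu.unit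
          rw [IsUnit.unit_spec, ZMod.cast_natCast hMN] at h1
          rw [h1, sub_self, norm_zero, zero_mul]
          exact Finset.sum_nonneg hnn
        · obtain ⟨p, hp, hpn, hpN⟩ := Nat.Prime.not_coprime_iff_dvd.1 hc
          have hmem : p ∈ N.primeFactors := Nat.mem_primeFactors.2 ⟨hp, hpN, NeZero.ne N⟩
          have hz : changeLevel hMN χ (n : ZMod N) = 0 :=
            MulChar.map_nonunit _ (by rwa [ZMod.isUnit_iff_coprime])
          rw [hz, zero_sub, norm_neg]
          refine le_trans ?_ (Finset.single_le_sum hnn hmem)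
          rw [if_pos hpn]
          exact mul_le_of_le_one_left hΛ (χ.norm_le_one _)
    _ = ∑ p ∈ N.primeFactors, ∑ n ∈ Finset.range (k + 1) with p ∣ n,
        ArithmeticFunction.vonMangoldt n := by
        rw [Finset.sum_comm]
        simp only [Finset.sum_filter]
    _ ≤ ∑ p ∈ N.primeFactors, Real.log k :=
        Finset.sum_le_sum fun p hp => sum_vonMangoldt_dvd_le (Nat.prime_of_mem_primeFactors hp) hk
    _ = N.primeFactors.card * Real.log k := by rw [Finset.sum_const, nsmul_eq_mul]
    _ ≤ _ := mul_le_mul_of_nonneg_right (card_primeFactors_le (NeZero.ne N)) hlogk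

/-- The explicit formula for nonprincipal characters, under GRH. -/
theorem explicit_formula (hG : GRH) : ∃ D : ℝ, 0 ≤ D ∧ ∀ (q : ℕ) [NeZero q]
    (χ : DirichletCharacter ℂ q), χ ≠ 1 → ∃ b : ℂ, ∀ k : ℕ, 1 ≤ k →
      ∃ S : ℂ, IsNonrealZeroSum χ (k + 1 / 2) S ∧
        ‖S + ∑ n ∈ Finset.range (k + 1), twistedLambda χ n + 2 * z χ * Real.sqrt (k + 1 / 2) + b‖ ≤
          D * (k + 1 / 2 : ℝ) ^ (1 / 8 : ℝ) + 2 * Real.log q * Real.log k := by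
  obtain ⟨D, hD, hprim⟩ := explicit_formula_of_isPrimitive hG
  refine ⟨D, hD, fun q _ χ hχ => ?_⟩
  have : NeZero χ.conductor := ⟨χ.conductor_ne_zero⟩
  have hcl := χ.changeLevel_primitiveCharacter
  have hne : χ.primitiveCharacter ≠ 1 := by
    intro h
    rw [h, map_one] at hcl
    exact hχ hcl.symm
  obtain ⟨b, hb⟩ := hprim _ χ.primitiveCharacter hne χ.primitiveCharacter_isPrimitive
  refine ⟨b, fun k hk => ?_⟩
  obtain ⟨S, hS, hSb⟩ := hb k hk
  have hd := norm_sum_twistedLambda_changeLevel_sub_le χ.conductor_dvd_level χ.primitiveCharacter hk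
  have hz := z_changeLevel χ.conductor_dvd_level χ.primitiveCharacter
  rw [← isNonrealZeroSum_changeLevel_iff χ.conductor_dvd_level, hcl] at hS
  rw [hcl] at hd hz
  refine ⟨S, hS, ?_⟩
  rw [hz]
  refine le_trans (le_of_eq ?_) ((norm_add_le _ _).trans (add_le_add hSb hd))
  congr 1
  ring

end GeneralCharacters

/-! ### Sums of `1/φ` over dyadic ranges. -/

section TotientSums

/-- By multiplicativity it suffices that `p ≤ (p - 1)^2` for `p ≥ 3`. The prime `2` fails this and
costs the factor `2` in `le_two_mul_totient_sq`. -/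
theorem le_totient_sq_of_odd {n : ℕ} (hn : Odd n) : n ≤ n.totient ^ 2 := by
  induction n using Nat.recOnPosPrimePosCoprime with
  | prime_pow p k hp hk =>
    have hp3 : 3 ≤ p := by
      have h2 := hp.two_le
      rcases h2.lt_or_eq with h | h
      · exact h
      · rw [← h] at hn
        exact absurd hn (by simp [Nat.odd_pow_iff hk.ne'])
    rw [Nat.totient_prime_pow hp hk, mul_pow]
    have h1 : p ≤ (p - 1) ^ 2 := by
      obtain ⟨m, rfl⟩ := Nat.exists_eq_add_of_le hp3
      rw [show 3 + m - 1 = m + 2 by omega]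
      nlinarith
    have h2 : p ^ (k - 1) ≤ (p ^ (k - 1)) ^ 2 := Nat.le_self_pow two_ne_zero _
    calc p ^ k = p ^ (k - 1) * p := by rw [← pow_succ, Nat.sub_add_cancel hk]
      _ ≤ _ := Nat.mul_le_mul h2 h1
  | zero => simp at hn
  | one => simp
  | coprime a b _ _ hab iha ihb =>
    rw [Nat.odd_mul] at hn
    rw [Nat.totient_mul hab, mul_pow]
    exact Nat.mul_le_mul (iha hn.1) (ihb hn.2)

theorem le_two_mul_totient_sq (n : ℕ) : n ≤ 2 * n.totient ^ 2 := by
  rcases eq_or_ne n 0 with rfl | hn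
  · simp
  obtain ⟨k, m, hm, rfl⟩ := Nat.exists_eq_two_pow_mul_odd hn
  have h1 := le_totient_sq_of_odd hm
  have hcop : (2 ^ k).Coprime m := Nat.Coprime.pow_left _ (Nat.coprime_two_left.2 hm)
  rw [Nat.totient_mul hcop, mul_pow, ← mul_assoc]
  refine Nat.mul_le_mul ?_ h1
  rcases k with _ | k
  · simp
  · rw [Nat.totient_prime_pow_succ Nat.prime_two]
    simp only [Nat.add_one_sub_one, mul_one]
    rw [pow_succ, mul_comm]
    exact Nat.mul_le_mul_left _ (Nat.le_self_pow two_ne_zero _)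

theorem inv_totient_le {n : ℕ} (hn : n ≠ 0) : (n.totient : ℝ)⁻¹ ≤ 2 * (n : ℝ) ^ (-(1 / 2) : ℝ) := by
  have hn0 : (0 : ℝ) < n := by exact_mod_cast Nat.pos_of_ne_zero hn
  have hφ : (0 : ℝ) < n.totient := by exact_mod_cast Nat.totient_pos.2 (Nat.pos_of_ne_zero hn)
  have h1 : (n : ℝ) ≤ 2 * (n.totient : ℝ) ^ 2 := by exact_mod_cast le_two_mul_totient_sq n
  rw [Real.rpow_neg hn0.le, ← Real.sqrt_eq_rpow, inv_le_comm₀ hφ (by positivity), mul_inv, inv_inv,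
    inv_mul_le_iff₀ (by norm_num), Real.sqrt_le_left (by positivity)]
  nlinarith

theorem totient_prod_primes {t : Finset ℕ} (ht : ∀ p ∈ t, p.Prime) :
    (∏ p ∈ t, p).totient = ∏ p ∈ t, p.totient := by
  induction t using Finset.induction_on with
  | empty => simp
  | insert p t hpt ih =>
    rw [Finset.prod_insert hpt, Finset.prod_insert hpt, Nat.totient_mul,
      ih fun r hr => ht r (Finset.mem_insert_of_mem hr)]
    refine Nat.Coprime.prod_right fun r hr => ?_
    rw [Nat.coprime_primes (ht p (Finset.mem_insert_self _ _))
      (ht r (Finset.mem_insert_of_mem hr))]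
    rintro rfl
    exact hpt hr

/-- The coefficients `μ²(d) / φ(d)`. -/
def totientWeight (d : ℕ) : ℝ := if Squarefree d then (d.totient : ℝ)⁻¹ else 0

theorem totientWeight_nonneg (d : ℕ) : 0 ≤ totientWeight d := by
  unfold totientWeight
  split_ifs <;> positivity

theorem totientWeight_le {d : ℕ} (hd : d ≠ 0) : totientWeight d ≤ 2 * (d : ℝ) ^ (-(1 / 2) : ℝ) := by
  unfold totientWeight
  split_ifs
  · exact inv_totient_le hd
  · positivity

/-- `n/φ(n)` is the product over `p ∣ n` of `1 + 1/(p - 1)`; expanding it gives the sum of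
`μ²(d)/φ(d)` over `d ∣ n`. -/
theorem inv_totient_eq_sum {n : ℕ} (hn : n ≠ 0) :
    (n.totient : ℝ)⁻¹ = ∑ d ∈ n.divisors, totientWeight d / n := by
  have hn0 : (n : ℝ) ≠ 0 := by exact_mod_cast hn
  have h1 : ∑ d ∈ n.divisors, totientWeight d =
      ∏ p ∈ n.primeFactors, (1 + (p.totient : ℝ)⁻¹) := by
    simp only [totientWeight]
    rw [← Finset.sum_filter, Nat.sum_divisors_filter_squarefree hn, Finset.prod_one_add,
      show n.primeFactors = (UniqueFactorizationMonoid.normalizedFactors n).toFinset by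
        rw [Nat.factors_eq]; rfl]
    refine Finset.sum_congr rfl fun t ht => ?_
    have ht' : ∀ p ∈ t, p.Prime := by
      intro p hp
      have := Finset.mem_powerset.1 ht hp
      rw [Nat.factors_eq] at this
      exact Nat.prime_of_mem_primeFactorsList (by simpa using this)
    rw [Finset.prod_val, show t.prod id = ∏ p ∈ t, p from rfl, totient_prod_primes ht', Nat.cast_prod, Finset.prod_inv_distrib]
  have h2 : (n.totient : ℝ) = n * ∏ p ∈ n.primeFactors, (1 - (p : ℝ)⁻¹) := by
    have := Nat.totient_eq_mul_prod_factors n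
    have h3 := congrArg (fun r : ℚ => (r : ℝ)) this
    push_cast at h3
    exact h3
  have h3 : (∏ p ∈ n.primeFactors, (1 - (p : ℝ)⁻¹))⁻¹ =
      ∏ p ∈ n.primeFactors, (1 + (p.totient : ℝ)⁻¹) := by
    rw [← Finset.prod_inv_distrib]
    refine Finset.prod_congr rfl fun p hp => ?_
    have hp' := Nat.prime_of_mem_primeFactors hp
    have hp1 : (1 : ℝ) < p := by exact_mod_cast hp'.one_lt
    rw [Nat.totient_prime hp', Nat.cast_sub hp'.one_le, Nat.cast_one]
    have : (p : ℝ) - 1 ≠ 0 := by linarith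
    field_simp
    ring
  rw [← Finset.sum_div, h1, h2, mul_inv, h3]
  ring

theorem sum_inv_Ico_bounds {a b : ℕ} (ha : 1 ≤ a) (hab : a ≤ b) :
    Real.log (b / a) ≤ ∑ e ∈ Finset.Ico a b, (e : ℝ)⁻¹ ∧
      ∑ e ∈ Finset.Ico a b, (e : ℝ)⁻¹ ≤ Real.log (b / a) + (a : ℝ)⁻¹ - (b : ℝ)⁻¹ := by
  have ha0 : (0 : ℝ) < a := by exact_mod_cast ha
  induction b, hab using Nat.le_induction with
  | base => simp [ha0.ne']
  | succ b hab ih =>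
    have hb0 : (0 : ℝ) < b := by exact_mod_cast (by omega : 0 < b)
    have h1 : Real.log ((b + 1 : ℕ) / a) = Real.log (b / a) + Real.log ((b + 1) / b) := by
      rw [← Real.log_mul (by positivity) (by positivity)]
      push_cast
      congr 1
      field_simp
    have h2 : Real.log ((b + 1) / b) ≤ (b : ℝ)⁻¹ := by
      refine (Real.log_le_sub_one_of_pos (by positivity)).trans (le_of_eq ?_)
      field_simp
      ring
    have h3 : ((b : ℝ) + 1)⁻¹ ≤ Real.log ((b + 1) / b) := by
      have := Real.log_le_sub_one_of_pos (show 0 < (b : ℝ) / (b + 1) by positivity)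
      rw [← inv_div, Real.log_inv, inv_div] at this
      have h4 : (b : ℝ) / (b + 1) - 1 = -((b : ℝ) + 1)⁻¹ := by
        field_simp
        ring
      linarith
    rw [Finset.sum_Ico_succ_top hab, h1]
    push_cast
    constructor <;> linarith [ih.1, ih.2]

/-- For `t ≥ 1` this compares the sum with the logarithm. The range `t < 1`, where at most the term
`e = 1` survives, is needed because `t = y/d` for every `d`. -/
theorem abs_sum_inv_dyadic_sub_le {t : ℝ} (ht : 0 < t) :
    |∑ e ∈ Finset.Ico ⌈t⌉₊ ⌈2 * t⌉₊, (e : ℝ)⁻¹ - Real.log 2| ≤ 2 * min 1 t⁻¹ := by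
  have hlog2 := Real.log_two_lt_d9
  have hlog2' := Real.log_two_gt_d9
  rcases lt_or_ge t 1 with h | h
  · have hmin : min 1 t⁻¹ = 1 := min_eq_left ((one_le_inv₀ ht).2 h.le)
    rw [hmin]
    have h1 : ⌈t⌉₊ = 1 := by
      rw [Nat.ceil_eq_iff one_ne_zero]
      constructor <;> simp <;> linarith
    have h2 : ⌈2 * t⌉₊ ≤ 2 := by
      rw [Nat.ceil_le]
      push_cast
      linarith
    have h3 : ∑ e ∈ Finset.Ico ⌈t⌉₊ ⌈2 * t⌉₊, (e : ℝ)⁻¹ ≤ 1 := by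
      rw [h1]
      refine (Finset.sum_le_sum_of_subset_of_nonneg (Finset.Ico_subset_Ico_right h2)
        fun _ _ _ => by positivity).trans ?_
      simp
    have h4 : 0 ≤ ∑ e ∈ Finset.Ico ⌈t⌉₊ ⌈2 * t⌉₊, (e : ℝ)⁻¹ :=
      Finset.sum_nonneg fun _ _ => by positivity
    rw [abs_le]
    constructor <;> linarith
  · have hmin : min 1 t⁻¹ = t⁻¹ := min_eq_right (inv_le_one_of_one_le₀ h)
    rw [hmin]
    have ha1 := Nat.le_ceil t
    have ha2 := Nat.ceil_lt_add_one ht.le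
    have hb1 := Nat.le_ceil (2 * t)
    have hb2 := Nat.ceil_lt_add_one (show 0 ≤ 2 * t by linarith)
    have hab : ⌈t⌉₊ ≤ ⌈2 * t⌉₊ := Nat.ceil_mono (by linarith)
    have ha : 1 ≤ ⌈t⌉₊ := Nat.one_le_ceil_iff.2 ht
    set a := ⌈t⌉₊
    set b := ⌈2 * t⌉₊
    have ha0 : (0 : ℝ) < a := by linarith
    have hb0 : (0 : ℝ) < b := by linarith
    obtain ⟨h1, h2⟩ := sum_inv_Ico_bounds ha hab
    have h3 : Real.log (b / a) ≤ Real.log 2 + t⁻¹ / 2 := by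
      have h4 : (b : ℝ) / a ≤ 2 * (1 + t⁻¹ / 2) := by
        rw [div_le_iff₀ ha0]
        have : t * t⁻¹ = 1 := mul_inv_cancel₀ ht.ne'
        have h5 : 0 < t⁻¹ := by positivity
        nlinarith
      refine (Real.log_le_log (by positivity) h4).trans ?_
      rw [Real.log_mul (by norm_num) (by positivity)]
      have := Real.log_le_sub_one_of_pos (show 0 < 1 + t⁻¹ / 2 by positivity)
      linarith
    have h4 : Real.log 2 - t⁻¹ ≤ Real.log (b / a) := by
      have h5 : 2 / (1 + t⁻¹) ≤ (b : ℝ) / a := by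
        rw [div_le_div_iff₀ (by positivity) ha0]
        have : t * t⁻¹ = 1 := mul_inv_cancel₀ ht.ne'
        have h5 : 0 < t⁻¹ := by positivity
        nlinarith
      have h6 := Real.log_le_log (by positivity) h5
      rw [Real.log_div (by norm_num) (by positivity)] at h6
      have := Real.log_le_sub_one_of_pos (show 0 < 1 + t⁻¹ by positivity)
      linarith
    have h5 : (a : ℝ)⁻¹ ≤ t⁻¹ := inv_anti₀ ht ha1
    have h6 : 0 < (b : ℝ)⁻¹ := by positivity
    have h7 : 0 < t⁻¹ := by positivity
    rw [abs_le]
    constructor <;> linarith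

theorem min_one_inv_le_rpow {t α : ℝ} (ht : 0 < t) (h0 : 0 ≤ α) (h1 : α ≤ 1) :
    min 1 t⁻¹ ≤ t ^ (-α) := by
  rcases le_total t 1 with h | h
  · exact (min_le_left _ _).trans (Real.one_le_rpow_of_pos_of_le_one_of_nonpos ht h (by linarith))
  · refine (min_le_right _ _).trans ?_
    rw [← Real.rpow_neg_one]
    exact Real.rpow_le_rpow_of_exponent_le h (by linarith)

theorem sum_dyadic_dvd {y : ℝ} {d : ℕ} (hd : d ≠ 0) :
    ∑ m ∈ Finset.Ico ⌈y⌉₊ ⌈2 * y⌉₊ with d ∣ m, totientWeight d / m =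
      totientWeight d / d * ∑ e ∈ Finset.Ico ⌈y / d⌉₊ ⌈2 * (y / d)⌉₊, (e : ℝ)⁻¹ := by
  have hd0 : (0 : ℝ) < d := by exact_mod_cast Nat.pos_of_ne_zero hd
  rw [Finset.mul_sum]
  symm
  refine Finset.sum_nbij (fun e => d * e) ?_ ?_ ?_ ?_
  · intro e he
    rw [Finset.mem_Ico, Nat.ceil_le, Nat.lt_ceil, ← mul_div_assoc, div_le_iff₀ hd0,
      lt_div_iff₀ hd0] at he
    rw [Finset.mem_filter, Finset.mem_Ico, Nat.ceil_le, Nat.lt_ceil]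
    push_cast
    exact ⟨⟨by linarith [he.1], by linarith [he.2]⟩, dvd_mul_right _ _⟩
  · intro e _ e' _ h
    exact Nat.eq_of_mul_eq_mul_left (Nat.pos_of_ne_zero hd) h
  · intro m hm
    rw [Finset.mem_coe, Finset.mem_filter, Finset.mem_Ico, Nat.ceil_le, Nat.lt_ceil] at hm
    obtain ⟨⟨h1, h2⟩, e, rfl⟩ := hm
    push_cast at h1 h2
    refine ⟨e, ?_, rfl⟩
    rw [Finset.mem_coe, Finset.mem_Ico, Nat.ceil_le, Nat.lt_ceil, ← mul_div_assoc,
      div_le_iff₀ hd0, lt_div_iff₀ hd0]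
    exact ⟨by linarith, by linarith⟩
  · intro e _
    push_cast
    rw [div_mul_eq_div_div, div_eq_mul_inv _ (e : ℝ)]

/-- For `d > 2y` the inner sum is empty. Summing over all `d` nevertheless allows a termwise
comparison with the convergent series defining the limiting constant. -/
theorem sum_inv_totient_dyadic_eq_tsum {y : ℝ} (hy : 0 < y) :
    ∑ m ∈ Finset.Ico ⌈y⌉₊ ⌈2 * y⌉₊, (m.totient : ℝ)⁻¹ =
      ∑' d : ℕ, totientWeight d / d *
        ∑ e ∈ Finset.Ico ⌈y / d⌉₊ ⌈2 * (y / d)⌉₊, (e : ℝ)⁻¹ := by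
  rw [tsum_eq_sum (s := Finset.Icc 1 ⌈2 * y⌉₊)]
  · have h1 : ∀ m ∈ Finset.Ico ⌈y⌉₊ ⌈2 * y⌉₊, (m.totient : ℝ)⁻¹ =
        ∑ d ∈ Finset.Icc 1 ⌈2 * y⌉₊, if d ∣ m then totientWeight d / m else 0 := by
      intro m hm
      rw [Finset.mem_Ico] at hm
      have hm0 : m ≠ 0 := by
        have := Nat.one_le_ceil_iff.2 hy
        omega
      rw [inv_totient_eq_sum hm0, ← Finset.sum_filter]
      refine Finset.sum_congr ?_ fun _ _ => rfl
      ext d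
      rw [Nat.mem_divisors, Finset.mem_filter, Finset.mem_Icc]
      constructor
      · rintro ⟨h, -⟩
        exact ⟨⟨Nat.pos_of_dvd_of_pos h (Nat.pos_of_ne_zero hm0),
          (Nat.le_of_dvd (Nat.pos_of_ne_zero hm0) h).trans hm.2.le⟩, h⟩
      · exact fun h => ⟨h.2, hm0⟩
    rw [Finset.sum_congr rfl h1, Finset.sum_comm]
    refine Finset.sum_congr rfl fun d hd => ?_
    rw [← sum_dyadic_dvd (by rw [Finset.mem_Icc] at hd; omega), Finset.sum_filter]
  · intro d hd
    rcases eq_or_ne d 0 with rfl | hd0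
    · simp
    have hd' : (0 : ℝ) < d := by exact_mod_cast Nat.pos_of_ne_zero hd0
    rw [Finset.mem_Icc, not_and, not_le] at hd
    have h2 : (2 * y : ℝ) < d := (Nat.lt_of_ceil_lt (hd (by omega)))
    have h3 : ⌈2 * (y / d)⌉₊ ≤ 1 := by
      rw [Nat.ceil_le, ← mul_div_assoc, div_le_iff₀ hd']
      push_cast
      linarith
    have h4 : 1 ≤ ⌈y / d⌉₊ := Nat.one_le_ceil_iff.2 (by positivity)
    rw [Finset.Ico_eq_empty (by omega)]
    simp

/-- The sum of `1 / φ(m)` over a dyadic range is nearly constant. -/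
theorem exists_sum_inv_totient_dyadic {α : ℝ} (h0 : 0 ≤ α) (h1 : α < 1 / 2) :
    ∃ c C : ℝ, 0 ≤ C ∧ ∀ y : ℝ, 0 < y →
      |∑ m ∈ Finset.Ico ⌈y⌉₊ ⌈2 * y⌉₊, (m.totient : ℝ)⁻¹ - c| ≤ C * y ^ (-α) := by
  -- The weak bound `φ(d) ≫ √d` makes the terms `O(d^(α - 3/2))`, summable exactly because `α <
  -- 1/2`.
  have hsum : Summable fun d : ℕ => totientWeight d / d * (d : ℝ) ^ α := by
    refine Summable.of_nonneg_of_le (fun d => ?_) (fun d => ?_)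
      ((Real.summable_nat_rpow.2 (show α - 3 / 2 < -1 by linarith)).mul_left 2)
    · have := totientWeight_nonneg d
      positivity
    · rcases eq_or_ne d 0 with rfl | hd0
      · simp
        positivity
      have hd' : (0 : ℝ) < d := by exact_mod_cast Nat.pos_of_ne_zero hd0
      calc _ ≤ 2 * (d : ℝ) ^ (-(1 / 2) : ℝ) / d * (d : ℝ) ^ α := by
            gcongr
            exact totientWeight_le hd0
        _ = 2 * ((d : ℝ) ^ (-(1 / 2) : ℝ) * (d : ℝ) ^ (-1 : ℝ) * (d : ℝ) ^ α) := by
            rw [Real.rpow_neg_one]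
            ring
        _ = _ := by
            rw [← Real.rpow_add hd', ← Real.rpow_add hd']
            congr 2
            ring
  have hsum0 : Summable fun d : ℕ => totientWeight d / d * Real.log 2 := by
    refine Summable.mul_right _ (Summable.of_nonneg_of_le (fun d => ?_) (fun d => ?_) hsum)
    · have := totientWeight_nonneg d
      positivity
    · rcases eq_or_ne d 0 with rfl | hd0
      · simp
      have hd' : (1 : ℝ) ≤ d := by exact_mod_cast Nat.one_le_iff_ne_zero.2 hd0
      have := totientWeight_nonneg d
      exact le_mul_of_one_le_right (by positivity) (Real.one_le_rpow hd' h0)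
  refine ⟨∑' d : ℕ, totientWeight d / d * Real.log 2,
    2 * ∑' d : ℕ, totientWeight d / d * (d : ℝ) ^ α, ?_, fun y hy => ?_⟩
  · refine mul_nonneg zero_le_two (tsum_nonneg fun d => ?_)
    have := totientWeight_nonneg d
    positivity
  have hterm : ∀ d : ℕ, |totientWeight d / d *
      ∑ e ∈ Finset.Ico ⌈y / d⌉₊ ⌈2 * (y / d)⌉₊, (e : ℝ)⁻¹ - totientWeight d / d * Real.log 2| ≤
      2 * y ^ (-α) * (totientWeight d / d * (d : ℝ) ^ α) := by
    intro d
    rcases eq_or_ne d 0 with rfl | hd0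
    · simp
    have hd' : (0 : ℝ) < d := by exact_mod_cast Nat.pos_of_ne_zero hd0
    have hw := totientWeight_nonneg d
    rw [← mul_sub, abs_mul, abs_of_nonneg (by positivity)]
    have h2 := (abs_sum_inv_dyadic_sub_le (t := y / d) (by positivity)).trans
      (mul_le_mul_of_nonneg_left (min_one_inv_le_rpow (by positivity) h0 (by linarith)) zero_le_two)
    calc _ ≤ totientWeight d / d * (2 * (y / d) ^ (-α)) := by gcongr
      _ = _ := by
        rw [Real.div_rpow hy.le hd'.le, Real.rpow_neg hd'.le, div_inv_eq_mul]
        ring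
  have hsum1 : Summable fun d : ℕ => totientWeight d / d *
      ∑ e ∈ Finset.Ico ⌈y / d⌉₊ ⌈2 * (y / d)⌉₊, (e : ℝ)⁻¹ - totientWeight d / d * Real.log 2 :=
    Summable.of_norm_bounded (hsum.mul_left (2 * y ^ (-α))) fun d => by
      simpa only [Real.norm_eq_abs] using hterm d
  have hsum2 : Summable fun d : ℕ => totientWeight d / d *
      ∑ e ∈ Finset.Ico ⌈y / d⌉₊ ⌈2 * (y / d)⌉₊, (e : ℝ)⁻¹ := by
    simpa using hsum1.add hsum0
  rw [sum_inv_totient_dyadic_eq_tsum hy, ← hsum2.tsum_sub hsum0, ← Real.norm_eq_abs]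
  refine (tsum_of_norm_bounded (hsum.mul_left (2 * y ^ (-α))).hasSum fun d => by
      simpa only [Real.norm_eq_abs] using hterm d).trans (le_of_eq ?_)
  rw [tsum_mul_left]
  ring

end TotientSums

/-! ### Primes congruent to 1 modulo `q` and the mean order of vanishing. -/

section PrimesOneMod

open Complex DirichletCharacter ArithmeticFunction

theorem sum_Ioc_eq_sum_range_sub {R : Type*} [AddCommGroup R] (f : ℕ → R) {A B : ℕ} (h : A ≤ B) :
    ∑ n ∈ Finset.Ioc A B, f n = ∑ n ∈ Finset.range (B + 1), f n - ∑ n ∈ Finset.range (A + 1), f n := by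
  rw [← Finset.sum_Ico_eq_sub f (by omega : A + 1 ≤ B + 1)]
  refine Finset.sum_congr ?_ fun _ _ => rfl
  ext n
  simp only [Finset.mem_Ioc, Finset.mem_Ico]
  omega

theorem sum_characters_apply {q : ℕ} [NeZero q] (a : ZMod q) :
    ∑ χ : DirichletCharacter ℂ q, χ a = if a = 1 then (q.totient : ℂ) else 0 := by
  rw [← sum_characters_eq ℂ a]

theorem card_characters (q : ℕ) [NeZero q] :
    Fintype.card (DirichletCharacter ℂ q) = q.totient := by
  rw [← card_eq_totient_of_hasEnoughRootsOfUnity ℂ q, Nat.card_eq_fintype_card]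

open Classical in
/-- The average over the nonprincipal characters modulo `q` of the order of vanishing at `1/2`. -/
def meanOrder (q : ℕ) : ℝ :=
  if h : q = 0 then 0 else
    have : NeZero q := ⟨h⟩
    (q.totient : ℝ)⁻¹ * ∑ χ : DirichletCharacter ℂ q with χ ≠ 1, (z χ : ℝ)

open Classical in
theorem meanOrder_eq (q : ℕ) [NeZero q] :
    meanOrder q = (q.totient : ℝ)⁻¹ * ∑ χ : DirichletCharacter ℂ q with χ ≠ 1, (z χ : ℝ) :=
  dif_neg (NeZero.ne q)

theorem meanOrder_nonneg (q : ℕ) : 0 ≤ meanOrder q := by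
  unfold meanOrder
  split_ifs <;> positivity

open Classical in
theorem sum_nonprincipal_twistedLambda {q : ℕ} [NeZero q] {A B : ℕ} (hA : 1 ≤ A) :
    ∑ χ : DirichletCharacter ℂ q with χ ≠ 1, ∑ n ∈ Finset.Ioc A B, twistedLambda χ n =
      q.totient * ((∑ n ∈ Finset.Ioc A B with q ∣ n - 1, vonMangoldt n : ℝ) : ℂ) -
        ∑ n ∈ Finset.Ioc A B, twistedLambda (1 : DirichletCharacter ℂ q) n := by
  rw [eq_sub_iff_add_eq, Finset.filter_ne', Finset.sum_erase_add _ _ (Finset.mem_univ _),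
    Finset.sum_comm, ofReal_sum, Finset.mul_sum, Finset.sum_filter]
  refine Finset.sum_congr rfl fun n hn => ?_
  simp only [twistedLambda]
  rw [← Finset.sum_mul, sum_characters_apply]
  have hn1 : 1 ≤ n := by
    rw [Finset.mem_Ioc] at hn
    omega
  have hiff : (n : ZMod q) = 1 ↔ q ∣ n - 1 := by
    rw [← Nat.cast_one, eq_comm, ZMod.natCast_eq_natCast_iff, Nat.modEq_iff_dvd' hn1]
  by_cases h : q ∣ n - 1
  · rw [if_pos (hiff.2 h), if_pos h]
  · rw [if_neg (mt hiff.1 h), if_neg h, zero_mul]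

/-- The principal character mod `q` is the character of level 1 raised to level `q`, and at level 1
the twisted coefficients are `Λ(n)` itself. -/
theorem norm_sum_principal_sub_le {q : ℕ} [NeZero q] {A B : ℕ} (hA : 1 ≤ A) (hAB : A ≤ B) :
    ‖∑ n ∈ Finset.Ioc A B, twistedLambda (1 : DirichletCharacter ℂ q) n -
      ((∑ n ∈ Finset.Ioc A B, vonMangoldt n : ℝ) : ℂ)‖ ≤ 4 * Real.log q * Real.log B := by
  have hone : ∀ n, twistedLambda (1 : DirichletCharacter ℂ 1) n = (vonMangoldt n : ℂ) := by
    intro n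
    rw [twistedLambda, MulChar.one_apply (isUnit_of_subsingleton _), one_mul]
  have key : ∀ k : ℕ, 1 ≤ k →
      ‖∑ n ∈ Finset.range (k + 1), twistedLambda (1 : DirichletCharacter ℂ q) n -
        ∑ n ∈ Finset.range (k + 1), (vonMangoldt n : ℂ)‖ ≤ 2 * Real.log q * Real.log k := by
    intro k hk
    have := norm_sum_twistedLambda_changeLevel_sub_le (one_dvd q) (1 : DirichletCharacter ℂ 1) hk
    rw [map_one] at this
    simpa only [hone] using this
  have hlog : Real.log A ≤ Real.log B :=
    Real.log_le_log (by exact_mod_cast hA) (by exact_mod_cast hAB)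
  have hq : 0 ≤ Real.log q := Real.log_natCast_nonneg q
  rw [ofReal_sum, sum_Ioc_eq_sum_range_sub _ hAB, sum_Ioc_eq_sum_range_sub _ hAB, sub_sub_sub_comm]
  refine (norm_sub_le _ _).trans ((add_le_add (key B (hA.trans hAB)) (key A hA)).trans ?_)
  nlinarith

/-- The errors of the explicit formula are `O(B^(1/6))`, and `q ≤ B^(2/3)` gives `√q ≤ B^(1/3)`. As
`1/6 + 1/3 = 1/2`, they are absorbed into the error of the Montgomery conjecture. The exponent `2/3`
exceeds `1/2`, which the recursion will require. -/
theorem exists_error_le {D ε : ℝ} (hD : 0 ≤ D) (hε : 0 < ε) : ∃ C : ℝ, 0 ≤ C ∧ ∀ q B : ℕ,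
    q ≠ 0 → 1 ≤ B → (q : ℝ) ≤ (B : ℝ) ^ (2 / 3 : ℝ) →
      2 * (D * (B + 1 / 2 : ℝ) ^ (1 / 8 : ℝ) + 2 * Real.log q * Real.log B) +
        4 * Real.log q * Real.log B ≤ C * ((B : ℝ) ^ (1 / 2 + ε) / (q : ℝ) ^ (1 / 2 : ℝ)) := by
  refine ⟨4 * D + 8 * 144, by positivity, fun q B hq hB hqB => ?_⟩
  have hB1 : (1 : ℝ) ≤ B := by exact_mod_cast hB
  have hB0 : (0 : ℝ) < B := by linarith
  have hq1 : (1 : ℝ) ≤ q := by exact_mod_cast Nat.one_le_iff_ne_zero.2 hq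
  have hq0 : (0 : ℝ) < q := by linarith
  have h1 : (B + 1 / 2 : ℝ) ^ (1 / 8 : ℝ) ≤ 2 * (B : ℝ) ^ (1 / 6 : ℝ) := by
    calc (B + 1 / 2 : ℝ) ^ (1 / 8 : ℝ) ≤ (2 * B : ℝ) ^ (1 / 8 : ℝ) :=
          Real.rpow_le_rpow (by positivity) (by linarith) (by norm_num)
      _ = 2 ^ (1 / 8 : ℝ) * (B : ℝ) ^ (1 / 8 : ℝ) := Real.mul_rpow (by norm_num) hB0.le
      _ ≤ 2 * (B : ℝ) ^ (1 / 6 : ℝ) := by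
          refine mul_le_mul ?_ (Real.rpow_le_rpow_of_exponent_le hB1 (by norm_num))
            (by positivity) (by norm_num)
          calc (2 : ℝ) ^ (1 / 8 : ℝ) ≤ 2 ^ (1 : ℝ) :=
                Real.rpow_le_rpow_of_exponent_le (by norm_num) (by norm_num)
            _ = 2 := Real.rpow_one 2
  have hlogB : Real.log B ≤ 12 * (B : ℝ) ^ (1 / 12 : ℝ) := by
    have := Real.log_le_rpow_div hB0.le (show (0 : ℝ) < 1 / 12 by norm_num)
    linarith
  have hlogB0 : 0 ≤ Real.log B := Real.log_nonneg hB1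
  have hlogq : Real.log q ≤ Real.log B := by
    refine Real.log_le_log hq0 (hqB.trans ?_)
    calc (B : ℝ) ^ (2 / 3 : ℝ) ≤ (B : ℝ) ^ (1 : ℝ) :=
          Real.rpow_le_rpow_of_exponent_le hB1 (by norm_num)
      _ = B := Real.rpow_one _
  have h2 : Real.log q * Real.log B ≤ 144 * (B : ℝ) ^ (1 / 6 : ℝ) := by
    calc Real.log q * Real.log B ≤ (12 * (B : ℝ) ^ (1 / 12 : ℝ)) * (12 * (B : ℝ) ^ (1 / 12 : ℝ)) :=
          mul_le_mul (hlogq.trans hlogB) hlogB hlogB0 (by positivity)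
      _ = 144 * ((B : ℝ) ^ (1 / 12 : ℝ) * (B : ℝ) ^ (1 / 12 : ℝ)) := by ring
      _ = _ := by
          rw [← Real.rpow_add hB0]
          norm_num
  have h3 : (B : ℝ) ^ (1 / 6 : ℝ) ≤ (B : ℝ) ^ (1 / 2 + ε) / (q : ℝ) ^ (1 / 2 : ℝ) := by
    rw [le_div_iff₀ (by positivity)]
    calc (B : ℝ) ^ (1 / 6 : ℝ) * (q : ℝ) ^ (1 / 2 : ℝ) ≤
          (B : ℝ) ^ (1 / 6 : ℝ) * ((B : ℝ) ^ (2 / 3 : ℝ)) ^ (1 / 2 : ℝ) := by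
          gcongr
      _ = (B : ℝ) ^ (1 / 2 : ℝ) := by
          rw [← Real.rpow_mul hB0.le, ← Real.rpow_add hB0]
          norm_num
      _ ≤ _ := Real.rpow_le_rpow_of_exponent_le hB1 (by linarith)
  calc _ ≤ (4 * D + 8 * 144) * (B : ℝ) ^ (1 / 6 : ℝ) := by nlinarith
    _ ≤ _ := mul_le_mul_of_nonneg_left h3 (by positivity)

open Classical in
/-- The distribution of primes `≡ 1 (mod q)` in terms of the order of vanishing at `1/2`. -/
theorem exists_primes_one_mod_bound {η : ℝ} (hη : 0 < η) (hG : GRH) (hMM : ModifiedMontgomery η)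
    {ε : ℝ} (hε : 0 < ε) : ∃ C : ℝ, 0 ≤ C ∧ ∀ q A B : ℕ, q ≠ 0 → 1 ≤ A → A ≤ B →
      (q : ℝ) ≤ (A : ℝ) ^ η → (q : ℝ) ≤ (A : ℝ) ^ (2 / 3 : ℝ) →
      |∑ n ∈ Finset.Ioc A B with q ∣ n - 1, vonMangoldt n -
        (∑ n ∈ Finset.Ioc A B, vonMangoldt n) / q.totient +
        2 * (Real.sqrt (B + 1 / 2) - Real.sqrt (A + 1 / 2)) * meanOrder q| ≤
      C * ((B : ℝ) ^ (1 / 2 + ε) / (q : ℝ) ^ (1 / 2 : ℝ)) := by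
  obtain ⟨D, hD, hEF⟩ := explicit_formula hG
  obtain ⟨C₁, hC₁⟩ := hMM ε hε
  obtain ⟨C₂, hC₂0, hC₂⟩ := exists_error_le hD hε
  refine ⟨2 * (|C₁| * 2 ^ (1 / 2 + ε)) + C₂, by positivity, fun q A B hq hA hAB hqη hq23 => ?_⟩
  have : NeZero q := ⟨hq⟩
  have hA1 : (1 : ℝ) ≤ A := by exact_mod_cast hA
  have hAB' : (A : ℝ) ≤ B := by exact_mod_cast hAB
  have hB0 : (0 : ℝ) < B := by linarith
  have hlogq : 0 ≤ Real.log q := Real.log_natCast_nonneg q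
  have hlogAB : Real.log A ≤ Real.log B := Real.log_le_log (by linarith) hAB'
  have hφ1 : (1 : ℝ) ≤ q.totient := by
    exact_mod_cast Nat.totient_pos.2 (Nat.pos_of_ne_zero hq)
  have hφ0 : (q.totient : ℂ) ≠ 0 := by
    exact_mod_cast (Nat.totient_pos.2 (Nat.pos_of_ne_zero hq)).ne'
  set R := 2 * (D * (B + 1 / 2 : ℝ) ^ (1 / 8 : ℝ) + 2 * Real.log q * Real.log B) with hR
  set Δ := Real.sqrt (B + 1 / 2) - Real.sqrt (A + 1 / 2) with hΔ
  -- Subtracting the formulas at `A` and `B` removes the constant `b`, the one quantity not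
  -- controlled uniformly in `χ`.
  have hex : ∀ χ : DirichletCharacter ℂ q, ∃ SA SB : ℂ, χ ≠ 1 →
      IsNonrealZeroSum χ (A + 1 / 2) SA ∧ IsNonrealZeroSum χ (B + 1 / 2) SB ∧
      ‖SB - SA + ∑ n ∈ Finset.Ioc A B, twistedLambda χ n + 2 * Δ * z χ‖ ≤ R := by
    intro χ
    by_cases hχ : χ = 1
    · exact ⟨0, 0, fun h => absurd hχ h⟩
    obtain ⟨b, hb⟩ := hEF q χ hχ
    obtain ⟨SA, hSA, hA'⟩ := hb A hA
    obtain ⟨SB, hSB, hB'⟩ := hb B (hA.trans hAB)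
    refine ⟨SA, SB, fun _ => ⟨hSA, hSB, ?_⟩⟩
    rw [sum_Ioc_eq_sum_range_sub _ hAB]
    have h1 : (A + 1 / 2 : ℝ) ^ (1 / 8 : ℝ) ≤ (B + 1 / 2 : ℝ) ^ (1 / 8 : ℝ) :=
      Real.rpow_le_rpow (by positivity) (by linarith) (by norm_num)
    have h2 : D * (A + 1 / 2 : ℝ) ^ (1 / 8 : ℝ) + 2 * Real.log q * Real.log A ≤
        D * (B + 1 / 2 : ℝ) ^ (1 / 8 : ℝ) + 2 * Real.log q * Real.log B := by gcongr
    refine le_trans (le_of_eq ?_) ((norm_sub_le _ _).trans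
      ((add_le_add hB' (hA'.trans h2)).trans (le_of_eq (by rw [hR]; ring))))
    congr 1
    rw [hΔ]
    push_cast
    ring
  choose SA SB hS using hex
  set X := (Finset.univ : Finset (DirichletCharacter ℂ q)).filter (fun χ => χ ≠ 1) with hX
  set P := ∑ n ∈ Finset.Ioc A B with q ∣ n - 1, vonMangoldt n with hP
  set P0 := ∑ n ∈ Finset.Ioc A B, vonMangoldt n with hP0
  set ψ := ∑ n ∈ Finset.Ioc A B, twistedLambda (1 : DirichletCharacter ℂ q) n with hψ
  have hMMbound : ∀ (k : ℕ) (S : DirichletCharacter ℂ q → ℂ), A ≤ k → k ≤ B →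
      (∀ χ, χ ≠ 1 → IsNonrealZeroSum χ (k + 1 / 2) (S χ)) →
      ‖(1 / (q.totient : ℂ)) * ∑ χ ∈ X, S χ‖ ≤
        |C₁| * 2 ^ (1 / 2 + ε) * ((B : ℝ) ^ (1 / 2 + ε) / (q : ℝ) ^ (1 / 2 : ℝ)) := by
    intro k S hAk hkB hS
    have hAk' : (A : ℝ) ≤ k := by exact_mod_cast hAk
    have hkB' : (k : ℝ) ≤ B := by exact_mod_cast hkB
    -- The conjecture is used only at the residue class `a = 1`; the factor `2^(1/2 + ε)` comes from
    -- `k + 1/2 ≤ 2B`.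
    have h1 := hC₁ q (k + 1 / 2) (by linarith)
      (hqη.trans (Real.rpow_le_rpow (by linarith) (by linarith) hη.le)) 1 S hS
    simp only [Units.val_one, map_one, one_mul] at h1
    refine h1.trans ?_
    rw [mul_assoc, ← mul_div_assoc ((2 : ℝ) ^ (1 / 2 + ε)), ← Real.mul_rpow zero_le_two hB0.le]
    refine mul_le_mul (le_abs_self _) ?_ (by positivity) (abs_nonneg _)
    have : (k : ℝ) + 1 / 2 ≤ 2 * B := by linarith
    gcongr
  have hSA := hMMbound A SA le_rfl hAB fun χ h => (hS χ h).1
  have hSB := hMMbound B SB hAB le_rfl fun χ h => (hS χ h).2.1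
  have hcard : (X.card : ℝ) ≤ q.totient := by
    have := Finset.card_filter_le (Finset.univ : Finset (DirichletCharacter ℂ q)) (fun χ => χ ≠ 1)
    rw [Finset.card_univ, card_characters] at this
    exact_mod_cast this
  have hR0 : 0 ≤ R := by
    have : 0 ≤ Real.log B := Real.log_natCast_nonneg B
    positivity
  have havg : ‖(1 / (q.totient : ℂ)) * ∑ χ ∈ X,
      (SB χ - SA χ + ∑ n ∈ Finset.Ioc A B, twistedLambda χ n + 2 * Δ * z χ)‖ ≤ R := by
    rw [norm_mul, norm_div, norm_one, Complex.norm_natCast, one_div_mul_eq_div, div_le_iff₀ (by linarith)]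
    refine (norm_sum_le_of_le X (f := _) (n := fun _ => R) fun χ hχ =>
      (hS χ (Finset.mem_filter.1 hχ).2).2.2).trans ?_
    rw [Finset.sum_const, nsmul_eq_mul, mul_comm]
    exact mul_le_mul_of_nonneg_left hcard hR0
  have hprin : ‖(1 / (q.totient : ℂ)) * (ψ - P0)‖ ≤ 4 * Real.log q * Real.log B := by
    rw [norm_mul, norm_div, norm_one, Complex.norm_natCast, one_div_mul_eq_div]
    exact (div_le_self (norm_nonneg _) hφ1).trans (norm_sum_principal_sub_le hA hAB)
  have hid : ((P - P0 / q.totient + 2 * Δ * meanOrder q : ℝ) : ℂ) =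
      (1 / (q.totient : ℂ)) * ∑ χ ∈ X,
        (SB χ - SA χ + ∑ n ∈ Finset.Ioc A B, twistedLambda χ n + 2 * Δ * z χ) -
      (1 / (q.totient : ℂ)) * ∑ χ ∈ X, SB χ + (1 / (q.totient : ℂ)) * ∑ χ ∈ X, SA χ +
      (1 / (q.totient : ℂ)) * (ψ - P0) := by
    have h1 : ∑ χ ∈ X, ∑ n ∈ Finset.Ioc A B, twistedLambda χ n = q.totient * (P : ℂ) - ψ :=
      sum_nonprincipal_twistedLambda hA
    have h2 : (meanOrder q : ℂ) = (q.totient : ℂ)⁻¹ * ∑ χ ∈ X, (z χ : ℂ) := by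
      rw [meanOrder_eq]
      push_cast
      rfl
    rw [Finset.sum_add_distrib, Finset.sum_add_distrib, Finset.sum_sub_distrib, h1,
      ← Finset.mul_sum]
    push_cast
    rw [h2]
    field_simp
    ring
  rw [← Real.norm_eq_abs, ← norm_real, hid]
  have herr := hC₂ q B hq (hA.trans hAB)
    (hq23.trans (Real.rpow_le_rpow (by linarith) hAB' (by norm_num)))
  calc _ ≤ R + |C₁| * 2 ^ (1 / 2 + ε) * ((B : ℝ) ^ (1 / 2 + ε) / (q : ℝ) ^ (1 / 2 : ℝ)) +
        |C₁| * 2 ^ (1 / 2 + ε) * ((B : ℝ) ^ (1 / 2 + ε) / (q : ℝ) ^ (1 / 2 : ℝ)) +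
        4 * Real.log q * Real.log B :=
        (norm_add_le _ _).trans (add_le_add ((norm_add_le _ _).trans (add_le_add
          ((norm_sub_le _ _).trans (add_le_add havg hSB)) hSA)) hprin)
    _ ≤ _ := by linarith

end PrimesOneMod

/-! ### Switching to the complementary divisor. -/

section Switching

open ArithmeticFunction

/-- Passing to the complementary divisor. -/
theorem card_divisors_switch {Q r n : ℕ} (hn : 2 ≤ n) (hn' : n ≤ 2 * Q * r) :
    ((Finset.Ioc Q (2 * Q)).filter (fun q => q ∣ n - 1)).card =
      ((Finset.Icc 1 (2 * r)).filter
        (fun m => (Q * m + 1 < n ∧ n ≤ 2 * Q * m + 1) ∧ m ∣ n - 1)).card := by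
  obtain ⟨N, rfl⟩ : ∃ N, n = N + 1 := ⟨n - 1, by omega⟩
  have hN : 0 < N := by omega
  simp only [Nat.add_sub_cancel]
  refine Finset.card_nbij' (fun q => N / q) (fun m => N / m) ?_ ?_ ?_ ?_
  · intro q hq
    rw [Finset.mem_coe, Finset.mem_filter, Finset.mem_Ioc] at hq
    obtain ⟨⟨h1, h2⟩, m, rfl⟩ := hq
    have hq0 : 0 < q := by omega
    have hm0 : 0 < m := Nat.pos_of_mul_pos_left hN
    rw [Finset.mem_coe, Finset.mem_filter, Finset.mem_Icc]
    beta_reduce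
    rw [Nat.mul_div_cancel_left _ hq0]
    have h3 : Q * m < q * m := Nat.mul_lt_mul_of_pos_right h1 hm0
    have h4 : q * m ≤ 2 * Q * m := Nat.mul_le_mul_right m h2
    refine ⟨⟨hm0, ?_⟩, ⟨by omega, by omega⟩, dvd_mul_left _ _⟩
    by_contra! h5
    have : Q * (2 * r) ≤ Q * m := Nat.mul_le_mul_left Q h5.le
    have h6 : 2 * Q * r = Q * (2 * r) := by ring
    omega
  · intro m hm
    rw [Finset.mem_coe, Finset.mem_filter, Finset.mem_Icc] at hm
    obtain ⟨⟨h1, -⟩, ⟨h3, h4⟩, q, rfl⟩ := hm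
    rw [Finset.mem_coe, Finset.mem_filter, Finset.mem_Ioc]
    beta_reduce
    rw [Nat.mul_div_cancel_left _ (by omega)]
    refine ⟨⟨?_, ?_⟩, dvd_mul_left _ _⟩
    · have : Q * m < q * m := by
        rw [mul_comm q m]
        omega
      exact Nat.lt_of_mul_lt_mul_right this
    · have : q * m ≤ 2 * Q * m := by
        rw [mul_comm q m]
        omega
      exact Nat.le_of_mul_le_mul_right this (by omega)
  · intro q hq
    rw [Finset.mem_coe, Finset.mem_filter] at hq
    exact Nat.div_div_self hq.2 hN.ne'
  · intro m hm
    rw [Finset.mem_coe, Finset.mem_filter] at hm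
    exact Nat.div_div_self hm.2.2 hN.ne'

theorem Ioc_max_min_eq_filter (A B a b : ℕ) : Finset.Ioc (max A a) (min B b) =
    (Finset.Ioc A B).filter (fun n => a < n ∧ n ≤ b) := by
  ext n
  simp only [Finset.mem_Ioc, Finset.mem_filter, max_lt_iff, le_min_iff]
  tauto

/-- Write `n - 1 = q m`. For fixed `m` the condition `Q < q ≤ 2Q` becomes `Qm + 1 < n ≤ 2Qm + 1`,
and `m ≤ 2r` follows from the size of `n`. -/
theorem sum_primes_switch {Q r : ℕ} (hQ : 1 ≤ Q) (hr : 1 ≤ r) :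
    ∑ q ∈ Finset.Ioc Q (2 * Q), ∑ n ∈ Finset.Ioc (Q * r) (2 * Q * r) with q ∣ n - 1, vonMangoldt n =
      ∑ m ∈ Finset.Icc 1 (2 * r), ∑ n ∈ Finset.Ioc (max (Q * r) (Q * m + 1))
        (min (2 * Q * r) (2 * Q * m + 1)) with m ∣ n - 1, vonMangoldt n := by
  simp only [Ioc_max_min_eq_filter, Finset.filter_filter, Finset.sum_filter]
  rw [Finset.sum_comm, Finset.sum_comm (s := Finset.Icc 1 (2 * r))]
  refine Finset.sum_congr rfl fun n hn => ?_
  rw [Finset.mem_Ioc] at hn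
  have h1 : 1 ≤ Q * r := Nat.mul_pos hQ hr
  rw [← Finset.sum_filter, ← Finset.sum_filter, Finset.sum_const, Finset.sum_const,
    card_divisors_switch (by omega) hn.2]

/-- The half-integer `y = Q + 1/2` turns `(Q, 2Q]` into the integers of `[y, 2y)`, the shape treated
by `exists_sum_inv_totient_dyadic`. -/
theorem Ioc_eq_Ico_ceil (Q : ℕ) :
    Finset.Ioc Q (2 * Q) = Finset.Ico ⌈(Q + 1 / 2 : ℝ)⌉₊ ⌈2 * (Q + 1 / 2 : ℝ)⌉₊ := by
  ext n
  rw [Finset.mem_Ioc, Finset.mem_Ico, Nat.ceil_le, Nat.lt_ceil]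
  constructor
  · rintro ⟨h1, h2⟩
    have h3 : (Q : ℝ) + 1 ≤ n := by exact_mod_cast h1
    have h4 : (n : ℝ) ≤ 2 * Q := by exact_mod_cast h2
    exact ⟨by linarith, by linarith⟩
  · rintro ⟨h1, h2⟩
    have h3 : (Q : ℝ) < n := by linarith
    have h4 : (n : ℝ) < 2 * Q + 1 := by linarith
    exact ⟨by exact_mod_cast h3, Nat.lt_succ_iff.1 (by exact_mod_cast h4)⟩

/-- For fixed `n` the complementary divisors again fill a dyadic range `[y, 2y)`, with `y = (n -
1)/(2Q)`. This is what makes the two main terms comparable. -/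
theorem filter_eq_Ico_ceil {Q r n : ℕ} (hQ : 1 ≤ Q) (hn : 2 ≤ n) (hn' : n ≤ 2 * Q * r) :
    (Finset.Icc 1 (2 * r)).filter (fun m => Q * m + 1 < n ∧ n ≤ 2 * Q * m + 1) =
      Finset.Ico ⌈((n : ℝ) - 1) / (2 * Q)⌉₊ ⌈2 * (((n : ℝ) - 1) / (2 * Q))⌉₊ := by
  have hQ0 : (0 : ℝ) < Q := by exact_mod_cast hQ
  ext m
  rw [Finset.mem_filter, Finset.mem_Icc, Finset.mem_Ico, Nat.ceil_le, Nat.lt_ceil,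
    div_le_iff₀ (by positivity), show 2 * (((n : ℝ) - 1) / (2 * Q)) = ((n : ℝ) - 1) / Q by
      field_simp, lt_div_iff₀ hQ0]
  have e1 : ((n : ℝ) - 1 ≤ m * (2 * Q)) ↔ n ≤ 2 * Q * m + 1 := by
    rw [← Nat.cast_le (α := ℝ)]
    push_cast
    constructor <;> intro h <;> linarith
  have e2 : ((m : ℝ) * Q < (n : ℝ) - 1) ↔ Q * m + 1 < n := by
    rw [← Nat.cast_lt (α := ℝ)]
    push_cast
    constructor <;> intro h <;> linarith
  rw [e1, e2]
  constructor
  · exact fun h => ⟨h.2.2, h.2.1⟩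
  · rintro ⟨h1, h2⟩
    refine ⟨⟨?_, ?_⟩, h2, h1⟩
    · by_contra! h3
      have : m = 0 := by omega
      subst this
      omega
    · by_contra! h3
      have : Q * (2 * r) ≤ Q * m := Nat.mul_le_mul_left Q h3.le
      have h6 : 2 * Q * r = Q * (2 * r) := by ring
      omega

theorem sum_main_switch {Q r : ℕ} (hQ : 1 ≤ Q) (hr : 1 ≤ r) :
    ∑ m ∈ Finset.Icc 1 (2 * r), (∑ n ∈ Finset.Ioc (max (Q * r) (Q * m + 1))
        (min (2 * Q * r) (2 * Q * m + 1)), vonMangoldt n) / m.totient =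
      ∑ n ∈ Finset.Ioc (Q * r) (2 * Q * r), vonMangoldt n *
        ∑ m ∈ Finset.Ico ⌈((n : ℝ) - 1) / (2 * Q)⌉₊ ⌈2 * (((n : ℝ) - 1) / (2 * Q))⌉₊,
          (m.totient : ℝ)⁻¹ := by
  have h1 : 1 ≤ Q * r := Nat.mul_pos hQ hr
  simp only [Ioc_max_min_eq_filter, Finset.sum_filter, Finset.sum_div]
  rw [Finset.sum_comm]
  refine Finset.sum_congr rfl fun n hn => ?_
  rw [Finset.mem_Ioc] at hn
  rw [← filter_eq_Ico_ceil hQ (by omega) hn.2, Finset.mul_sum, Finset.sum_filter]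
  refine Finset.sum_congr rfl fun m _ => ?_
  split_ifs
  · rw [div_eq_mul_inv]
  · rw [zero_div]

theorem sum_rpow_neg_half_le (M : ℕ) :
    ∑ m ∈ Finset.Icc 1 M, ((m : ℝ) ^ (1 / 2 : ℝ))⁻¹ ≤ 2 * Real.sqrt M := by
  induction M with
  | zero => simp
  | succ M ih =>
    rw [Finset.sum_Icc_succ_top (by omega), ← Real.sqrt_eq_rpow]
    push_cast
    have h1 : Real.sqrt M ^ 2 = M := Real.sq_sqrt M.cast_nonneg
    have h2 : Real.sqrt (M + 1) ^ 2 = M + 1 := Real.sq_sqrt (by positivity)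
    have h3 : 0 < Real.sqrt ((M : ℝ) + 1) := Real.sqrt_pos.2 (by positivity)
    have h4 : Real.sqrt M ≤ Real.sqrt ((M : ℝ) + 1) := Real.sqrt_le_sqrt (by linarith)
    have h5 : (Real.sqrt ((M : ℝ) + 1))⁻¹ ≤ 2 * (Real.sqrt ((M : ℝ) + 1) - Real.sqrt M) := by
      rw [inv_le_iff_one_le_mul₀ h3]
      nlinarith [Real.sqrt_nonneg (M : ℝ)]
    linarith

theorem sum_vonMangoldt_mul_sub_le {A B : ℕ} (hAB : B ≤ 2 * A) {f : ℕ → ℝ} {E : ℝ} (hE : 0 ≤ E)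
    (hf : ∀ n ∈ Finset.Ioc A B, f n ≤ E) :
    ∑ n ∈ Finset.Ioc A B, vonMangoldt n * f n ≤ A * Real.log B * E := by
  have hlogB : 0 ≤ Real.log B := Real.log_natCast_nonneg B
  calc _ ≤ ∑ n ∈ Finset.Ioc A B, Real.log B * E := by
        refine Finset.sum_le_sum fun n hn => ?_
        have h1 := hf n hn
        rw [Finset.mem_Ioc] at hn
        have h2 : vonMangoldt n ≤ Real.log B :=
          vonMangoldt_le_log.trans (Real.log_le_log (by exact_mod_cast (by omega : 0 < n))
            (by exact_mod_cast hn.2))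
        exact (mul_le_mul_of_nonneg_left h1 vonMangoldt_nonneg).trans
          (mul_le_mul_of_nonneg_right h2 hE)
    _ = ((B - A : ℕ) : ℝ) * (Real.log B * E) := by
        rw [Finset.sum_const, Nat.card_Ioc, nsmul_eq_mul]
    _ ≤ A * (Real.log B * E) := by
        refine mul_le_mul_of_nonneg_right ?_ (by positivity)
        exact_mod_cast (by omega : B - A ≤ A)
    _ = _ := by ring

/-- The recursive inequality for sums of `meanOrder` over dyadic ranges, before the choice of the
parameters. -/
theorem exists_dyadic_inequality {η : ℝ} (hη : 0 < η) (hG : GRH) (hMM : ModifiedMontgomery η)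
    {δ : ℝ} (hδ : 0 < δ) (hδ' : δ ≤ 1 / 2) : ∃ C : ℝ, 0 ≤ C ∧ ∀ Q r : ℕ, 1 ≤ r → r ≤ Q →
      (2 * Q : ℝ) ≤ ((Q * r : ℕ) : ℝ) ^ η → (2 * Q : ℝ) ≤ ((Q * r : ℕ) : ℝ) ^ (2 / 3 : ℝ) →
      2 * (Real.sqrt ((2 * Q * r : ℕ) + 1 / 2) - Real.sqrt ((Q * r : ℕ) + 1 / 2)) *
        (∑ q ∈ Finset.Ioc Q (2 * Q), meanOrder q - ∑ m ∈ Finset.Icc 1 (2 * r), meanOrder m) ≤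
      C * (((2 * Q * r : ℕ) : ℝ) ^ (1 / 2 + δ) * Real.sqrt Q +
        ((Q * r : ℕ) : ℝ) * Real.log (2 * Q * r : ℕ) * (r / 2 : ℝ) ^ (-(1 / 2 - δ))) := by
  obtain ⟨C₁, hC₁0, hC₁⟩ := exists_primes_one_mod_bound hη hG hMM hδ
  obtain ⟨c, C₂, hC₂0, hC₂⟩ := exists_sum_inv_totient_dyadic (α := 1 / 2 - δ) (by linarith)
    (by linarith)
  refine ⟨5 * C₁ + 2 * C₂, by positivity, fun Q r hr hrQ hcond hcond' => ?_⟩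
  have hQ : 1 ≤ Q := hr.trans hrQ
  have hQ0 : (0 : ℝ) < Q := by exact_mod_cast hQ
  have hr0 : (0 : ℝ) < r := by exact_mod_cast hr
  have hrQ' : (r : ℝ) ≤ Q := by exact_mod_cast hrQ
  have hA : 1 ≤ Q * r := Nat.mul_pos hQ hr
  have hB2 : 2 * Q * r = 2 * (Q * r) := by ring
  have hAB : Q * r ≤ 2 * Q * r := by omega
  set A := Q * r with hAdef
  set B := 2 * Q * r with hBdef
  set W := 2 * (Real.sqrt (B + 1 / 2) - Real.sqrt (A + 1 / 2)) with hW
  set G := (B : ℝ) ^ (1 / 2 + δ) with hGdef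
  have hG0 : 0 ≤ G := by positivity
  set P0 := ∑ n ∈ Finset.Ioc A B, vonMangoldt n with hP0
  have hA0 : (1 : ℝ) ≤ A := by exact_mod_cast hA
  have hAB' : (A : ℝ) ≤ B := by exact_mod_cast hAB
  -- For the large moduli the formula is solved for the deficit; below, for the small moduli `m`, it
  -- bounds the prime sum from below.
  have hq : ∀ q ∈ Finset.Ioc Q (2 * Q), W * meanOrder q ≤ P0 * (q.totient : ℝ)⁻¹ -
      ∑ n ∈ Finset.Ioc A B with q ∣ n - 1, vonMangoldt n + C₁ * (G / (Q : ℝ) ^ (1 / 2 : ℝ)) := by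
    intro q hq
    rw [Finset.mem_Ioc] at hq
    have hq2 : (q : ℝ) ≤ 2 * Q := by exact_mod_cast hq.2
    have hq1 : (Q : ℝ) ≤ q := by exact_mod_cast hq.1.le
    have h1 := (abs_le.1 (hC₁ q A B (by omega) hA hAB (hq2.trans hcond) (hq2.trans hcond'))).2
    have h2 : G / (q : ℝ) ^ (1 / 2 : ℝ) ≤ G / (Q : ℝ) ^ (1 / 2 : ℝ) := by gcongr
    have h3 := mul_le_mul_of_nonneg_left h2 hC₁0
    rw [← div_eq_mul_inv]
    linarith
  -- Here `n` runs over a subinterval of `(A, B]`, whose square root difference is at most that of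
  -- the whole. As `meanOrder m ≥ 0`, the deficit is at most `W * meanOrder m`; when the interval is
  -- empty the left side is nonpositive.
  have hm : ∀ m ∈ Finset.Icc 1 (2 * r), (∑ n ∈ Finset.Ioc (max A (Q * m + 1))
        (min B (2 * Q * m + 1)), vonMangoldt n) / m.totient -
      W * meanOrder m - C₁ * G * ((m : ℝ) ^ (1 / 2 : ℝ))⁻¹ ≤
      ∑ n ∈ Finset.Ioc (max A (Q * m + 1)) (min B (2 * Q * m + 1)) with m ∣ n - 1,
        vonMangoldt n := by
    intro m hm
    rw [Finset.mem_Icc] at hm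
    have hm0 : (0 : ℝ) < m := by exact_mod_cast hm.1
    have hm2 : (m : ℝ) ≤ 2 * Q := by exact_mod_cast (by omega : m ≤ 2 * Q)
    have hZ := meanOrder_nonneg m
    have hmA : (A : ℝ) ≤ (max A (Q * m + 1) : ℕ) := by exact_mod_cast le_max_left _ _
    have hmB : ((min B (2 * Q * m + 1) : ℕ) : ℝ) ≤ B := by exact_mod_cast min_le_left _ _
    have hsq : Real.sqrt (A + 1 / 2) ≤ Real.sqrt (B + 1 / 2) := Real.sqrt_le_sqrt (by linarith)
    rcases le_or_gt (max A (Q * m + 1)) (min B (2 * Q * m + 1)) with h | h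
    · have h1 := (abs_le.1 (hC₁ m _ _ (by omega) (hA.trans (le_max_left _ _)) h
        (hm2.trans (hcond.trans (Real.rpow_le_rpow (by positivity) hmA hη.le)))
        (hm2.trans (hcond'.trans (Real.rpow_le_rpow (by positivity) hmA (by norm_num)))))).1
      have h2 : ((min B (2 * Q * m + 1) : ℕ) : ℝ) ^ (1 / 2 + δ) ≤ G :=
        Real.rpow_le_rpow (by positivity) hmB (by linarith)
      have h3 : C₁ * (((min B (2 * Q * m + 1) : ℕ) : ℝ) ^ (1 / 2 + δ) / (m : ℝ) ^ (1 / 2 : ℝ)) ≤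
          C₁ * G * ((m : ℝ) ^ (1 / 2 : ℝ))⁻¹ := by
        rw [mul_assoc C₁ G, ← div_eq_mul_inv]
        exact mul_le_mul_of_nonneg_left (div_le_div_of_nonneg_right h2 (by positivity)) hC₁0
      have h4 : 2 * (Real.sqrt ((min B (2 * Q * m + 1) : ℕ) + 1 / 2) -
          Real.sqrt ((max A (Q * m + 1) : ℕ) + 1 / 2)) * meanOrder m ≤ W * meanOrder m := by
        refine mul_le_mul_of_nonneg_right ?_ hZ
        have h5 : Real.sqrt ((min B (2 * Q * m + 1) : ℕ) + 1 / 2) ≤ Real.sqrt (B + 1 / 2) :=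
          Real.sqrt_le_sqrt (by linarith)
        have h6 : Real.sqrt (A + 1 / 2) ≤ Real.sqrt ((max A (Q * m + 1) : ℕ) + 1 / 2) :=
          Real.sqrt_le_sqrt (by linarith)
        rw [hW]
        linarith
      linarith
    · rw [Finset.Ioc_eq_empty (by omega)]
      simp only [Finset.filter_empty, Finset.sum_empty, zero_div, zero_sub]
      have hW0 : 0 ≤ W := by
        rw [hW]
        linarith
      have h1 : 0 ≤ C₁ * G * ((m : ℝ) ^ (1 / 2 : ℝ))⁻¹ := by positivity
      have h2 := mul_nonneg hW0 hZ
      linarith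
  have hsumq := Finset.sum_le_sum hq
  have hsumm := Finset.sum_le_sum hm
  rw [Finset.sum_add_distrib, Finset.sum_sub_distrib, ← Finset.mul_sum, ← Finset.mul_sum,
    sum_primes_switch hQ hr, Finset.sum_const, Nat.card_Ioc, nsmul_eq_mul] at hsumq
  rw [Finset.sum_sub_distrib, Finset.sum_sub_distrib, ← Finset.mul_sum, ← Finset.mul_sum,
    sum_main_switch hQ hr] at hsumm
  -- For each `n` two dyadic sums of `1/φ` are compared. Both starting points are at least `r/2`, so
  -- the constant `c` cancels and twice the error remains.
  have hbr : P0 * ∑ q ∈ Finset.Ioc Q (2 * Q), (q.totient : ℝ)⁻¹ -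
      ∑ n ∈ Finset.Ioc A B, vonMangoldt n *
        ∑ m ∈ Finset.Ico ⌈((n : ℝ) - 1) / (2 * Q)⌉₊ ⌈2 * (((n : ℝ) - 1) / (2 * Q))⌉₊,
          (m.totient : ℝ)⁻¹ ≤ A * Real.log B * (2 * C₂ * (r / 2 : ℝ) ^ (-(1 / 2 - δ))) := by
    rw [hP0, Finset.sum_mul, ← Finset.sum_sub_distrib]
    simp only [← mul_sub]
    refine sum_vonMangoldt_mul_sub_le (by omega) (by positivity) fun n hn => ?_
    rw [Finset.mem_Ioc] at hn
    have hn1 : (A : ℝ) + 1 ≤ n := by exact_mod_cast hn.1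
    have hy : (r / 2 : ℝ) ≤ ((n : ℝ) - 1) / (2 * Q) := by
      rw [le_div_iff₀ (by positivity)]
      have : (A : ℝ) = Q * r := by rw [hAdef]; push_cast; ring
      nlinarith
    have hmono : ∀ y : ℝ, (r / 2 : ℝ) ≤ y → y ^ (-(1 / 2 - δ)) ≤ (r / 2 : ℝ) ^ (-(1 / 2 - δ)) :=
      fun y hy => Real.rpow_le_rpow_of_nonpos (by positivity) hy (by linarith)
    have h1 := (abs_le.1 (hC₂ (Q + 1 / 2) (by positivity))).2
    have h2 := (abs_le.1 (hC₂ (((n : ℝ) - 1) / (2 * Q)) (lt_of_lt_of_le (by positivity) hy))).1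
    rw [← Ioc_eq_Ico_ceil] at h1
    have h3 := mul_le_mul_of_nonneg_left (hmono (Q + 1 / 2) (by linarith)) hC₂0
    have h4 := mul_le_mul_of_nonneg_left (hmono _ hy) hC₂0
    linarith
  have hQsq : ((2 * Q - Q : ℕ) : ℝ) * (C₁ * (G / (Q : ℝ) ^ (1 / 2 : ℝ))) =
      C₁ * (G * Real.sqrt Q) := by
    rw [show 2 * Q - Q = Q by omega, ← Real.sqrt_eq_rpow]
    have h1 : Real.sqrt Q ^ 2 = Q := Real.sq_sqrt hQ0.le
    have h2 : 0 < Real.sqrt Q := Real.sqrt_pos.2 hQ0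
    field_simp
    rw [h1]
    ring
  have hMsq : C₁ * G * ∑ m ∈ Finset.Icc 1 (2 * r), ((m : ℝ) ^ (1 / 2 : ℝ))⁻¹ ≤
      4 * (C₁ * (G * Real.sqrt Q)) := by
    have h1 := sum_rpow_neg_half_le (2 * r)
    have h2 : Real.sqrt ((2 * r : ℕ) : ℝ) ≤ 2 * Real.sqrt Q := by
      rw [Real.sqrt_le_left (by positivity), mul_pow, Real.sq_sqrt hQ0.le]
      push_cast
      linarith
    calc _ ≤ C₁ * G * (4 * Real.sqrt Q) := by
          refine mul_le_mul_of_nonneg_left ?_ (by positivity)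
          linarith
      _ = _ := by ring
  have hX0 : 0 ≤ G * Real.sqrt Q := by positivity
  have hlogB : 0 ≤ Real.log B := Real.log_natCast_nonneg B
  have hY0 : 0 ≤ (A : ℝ) * Real.log B * (r / 2 : ℝ) ^ (-(1 / 2 - δ)) := by positivity
  rw [hQsq] at hsumq
  have e1 := mul_nonneg hC₂0 hX0
  have e2 := mul_nonneg hC₁0 hY0
  linarith

end Switching

/-! ### The recursion for the mean orders and the conclusion. -/

section Recursion

open DirichletCharacter

/-- Moduli up to `2Q` against `x ≥ Q²/128`: admissible because `2θ > 1`. This is where `η > 1/2`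
enters. -/
theorem eventually_two_mul_le_rpow {θ : ℝ} (hθ : 1 / 2 < θ) :
    ∀ᶠ Q : ℕ in atTop, (2 * Q : ℝ) ≤ ((Q : ℝ) ^ 2 / 128) ^ θ := by
  have h1 : Tendsto (fun Q : ℕ => (Q : ℝ) ^ (2 * θ - 1)) atTop atTop :=
    (tendsto_rpow_atTop (by linarith)).comp tendsto_natCast_atTop_atTop
  filter_upwards [h1.eventually_ge_atTop (2 * 128 ^ θ), eventually_gt_atTop 0] with Q hQ hQ0
  have hQ0' : (0 : ℝ) < Q := by exact_mod_cast hQ0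
  rw [Real.div_rpow (by positivity) (by norm_num), le_div_iff₀ (by positivity)]
  calc (2 * Q : ℝ) * 128 ^ θ = 2 * 128 ^ θ * Q := by ring
    _ ≤ (Q : ℝ) ^ (2 * θ - 1) * Q := by gcongr
    _ = ((Q : ℝ) ^ 2) ^ θ := by
      rw [← Real.rpow_add_one hQ0'.ne', ← Real.rpow_natCast, ← Real.rpow_mul hQ0'.le]
      norm_num

/-- The difference of the two roots times their sum is `a`, and the sum is at most `4 √a`. -/
theorem sqrt_div_two_le {a : ℝ} (ha : 1 ≤ a) :
    Real.sqrt a / 2 ≤ 2 * (Real.sqrt (2 * a + 1 / 2) - Real.sqrt (a + 1 / 2)) := by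
  have h1 : Real.sqrt (2 * a + 1 / 2) ^ 2 = 2 * a + 1 / 2 := Real.sq_sqrt (by linarith)
  have h2 : Real.sqrt (a + 1 / 2) ^ 2 = a + 1 / 2 := Real.sq_sqrt (by linarith)
  have h3 : Real.sqrt a ^ 2 = a := Real.sq_sqrt (by linarith)
  have h4 : Real.sqrt (2 * a + 1 / 2) ≤ 2 * Real.sqrt a := by
    rw [Real.sqrt_le_left (by positivity), mul_pow, h3]
    linarith
  have h5 : Real.sqrt (a + 1 / 2) ≤ Real.sqrt (2 * a + 1 / 2) := Real.sqrt_le_sqrt (by linarith)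
  have h6 : 0 < Real.sqrt a := Real.sqrt_pos.2 (by linarith)
  have h7 : 0 ≤ Real.sqrt (a + 1 / 2) := Real.sqrt_nonneg _
  by_contra! h
  nlinarith

theorem exists_recursion {η : ℝ} (hη : 1 / 2 < η) (hG : GRH) (hMM : ModifiedMontgomery η)
    {δ : ℝ} (hδ : 0 < δ) (hδ' : δ ≤ 1 / 2) : ∃ C : ℝ, 0 ≤ C ∧ ∃ Q₀ : ℕ, ∀ Q : ℕ, Q₀ ≤ Q →
      ∑ q ∈ Finset.Ioc Q (2 * Q), meanOrder q ≤
        ∑ m ∈ Finset.Icc 1 (2 * (Q / 64)), meanOrder m + C * (Q : ℝ) ^ (1 / 2 + 3 * δ) := by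
  obtain ⟨C, hC0, hC⟩ := exists_dyadic_inequality (by linarith) hG hMM hδ hδ'
  obtain ⟨Q₁, hQ₁⟩ := eventually_atTop.1 ((eventually_two_mul_le_rpow hη).and
    (eventually_two_mul_le_rpow (show (1 : ℝ) / 2 < 2 / 3 by norm_num)))
  refine ⟨C * (4 + 32 / δ), by positivity, max Q₁ 128, fun Q hQ => ?_⟩
  have hQ128 : 128 ≤ Q := (le_max_right _ _).trans hQ
  obtain ⟨hcond, hcond'⟩ := hQ₁ Q ((le_max_left _ _).trans hQ)
  -- `r ≍ Q` makes `x = Qr ≍ Q²`. After division by `√x` the two errors become about `√Q` and `√x ·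
  -- r^(-1/2) ≍ √Q`, up to powers `Q^(3δ)`. The small ratio `1/64` is what makes the recursion
  -- contract.
  set r := Q / 64 with hr
  have hr1 : 1 ≤ r := by omega
  have hrlow : Q ≤ 128 * r := by omega
  have hrup : 64 * r ≤ Q := by omega
  have hrlow' : (Q : ℝ) ≤ 128 * r := by exact_mod_cast hrlow
  have hrup' : 64 * (r : ℝ) ≤ Q := by exact_mod_cast hrup
  have hQ0 : (128 : ℝ) ≤ Q := by exact_mod_cast hQ128
  have hQpos : (0 : ℝ) < Q := by linarith
  have hrpos : (0 : ℝ) < r := by linarith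
  have hA : ((Q * r : ℕ) : ℝ) = Q * r := by push_cast; ring
  have hB : ((2 * Q * r : ℕ) : ℝ) = 2 * (Q * r) := by push_cast; ring
  have hAlow : (Q : ℝ) ^ 2 / 128 ≤ Q * r := by nlinarith
  have key := hC Q r hr1 (by omega)
    (by rw [hA]; exact hcond.trans (Real.rpow_le_rpow (by positivity) hAlow (by linarith)))
    (by rw [hA]; exact hcond'.trans (Real.rpow_le_rpow (by positivity) hAlow (by norm_num)))
  rw [hA, hB] at key
  set a : ℝ := Q * r with ha
  have ha1 : 1 ≤ a := by nlinarith
  have ha0 : 0 < a := by linarith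
  have haQ : 2 * a ≤ (Q : ℝ) ^ 2 := by nlinarith
  have hW := sqrt_div_two_le ha1
  have hsa : 0 < Real.sqrt a := Real.sqrt_pos.2 ha0
  have hpow : (2 * a) ^ δ ≤ (Q : ℝ) ^ (2 * δ) := by
    refine (Real.rpow_le_rpow (by positivity) haQ hδ.le).trans (le_of_eq ?_)
    rw [← Real.rpow_natCast, ← Real.rpow_mul hQpos.le]
    norm_num
  have hsaQ : Real.sqrt a ≤ Q := by
    rw [Real.sqrt_le_left hQpos.le]
    linarith
  have hsq : Real.sqrt a * Real.sqrt a = a := Real.mul_self_sqrt ha0.le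
  have hQs : (Q : ℝ) ^ (2 * δ) * Real.sqrt Q ≤ (Q : ℝ) ^ (1 / 2 + 3 * δ) := by
    rw [Real.sqrt_eq_rpow, ← Real.rpow_add hQpos]
    exact Real.rpow_le_rpow_of_exponent_le (by linarith) (by linarith)
  have h1 : (2 * a) ^ (1 / 2 + δ) * Real.sqrt Q ≤
      Real.sqrt a / 2 * (4 * (Q : ℝ) ^ (1 / 2 + 3 * δ)) := by
    have h2 : (2 * a) ^ (1 / 2 : ℝ) ≤ 2 * Real.sqrt a := by
      rw [← Real.sqrt_eq_rpow, Real.sqrt_le_left (by positivity)]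
      nlinarith
    calc (2 * a) ^ (1 / 2 + δ) * Real.sqrt Q =
          (2 * a) ^ (1 / 2 : ℝ) * ((2 * a) ^ δ * Real.sqrt Q) := by
          rw [Real.rpow_add (by positivity)]
          ring
      _ ≤ 2 * Real.sqrt a * ((Q : ℝ) ^ (2 * δ) * Real.sqrt Q) := by gcongr
      _ ≤ 2 * Real.sqrt a * (Q : ℝ) ^ (1 / 2 + 3 * δ) := by gcongr
      _ = _ := by ring
  have h2 : a * Real.log (2 * a) * (r / 2 : ℝ) ^ (-(1 / 2 - δ)) ≤
      Real.sqrt a / 2 * (32 / δ * (Q : ℝ) ^ (1 / 2 + 3 * δ)) := by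
    have hlog : Real.log (2 * a) ≤ (Q : ℝ) ^ (2 * δ) / δ :=
      (Real.log_le_rpow_div (by positivity) hδ).trans (by gcongr)
    have hlog0 : 0 ≤ Real.log (2 * a) := Real.log_nonneg (by linarith)
    have hrp : (r / 2 : ℝ) ^ (-(1 / 2 - δ)) ≤ 16 * (Q : ℝ) ^ (δ - 1 / 2) := by
      calc (r / 2 : ℝ) ^ (-(1 / 2 - δ)) ≤ ((Q : ℝ) / 256) ^ (-(1 / 2 - δ)) :=
            Real.rpow_le_rpow_of_nonpos (by positivity) (by linarith) (by linarith)
        _ = 256 ^ (1 / 2 - δ) * (Q : ℝ) ^ (δ - 1 / 2) := by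
            rw [Real.div_rpow hQpos.le (by norm_num), Real.rpow_neg (x := 256) (by norm_num),
              div_inv_eq_mul, mul_comm, neg_sub]
        _ ≤ 16 * (Q : ℝ) ^ (δ - 1 / 2) := by
            gcongr
            calc (256 : ℝ) ^ (1 / 2 - δ) ≤ 256 ^ (1 / 2 : ℝ) :=
                  Real.rpow_le_rpow_of_exponent_le (by norm_num) (by linarith)
              _ = 16 := by
                  rw [← Real.sqrt_eq_rpow, show (256 : ℝ) = 16 ^ 2 by norm_num]
                  exact Real.sqrt_sq (by norm_num)
    calc a * Real.log (2 * a) * (r / 2 : ℝ) ^ (-(1 / 2 - δ)) ≤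
          a * ((Q : ℝ) ^ (2 * δ) / δ) * (16 * (Q : ℝ) ^ (δ - 1 / 2)) := by gcongr
      _ = Real.sqrt a * (16 / δ * (Real.sqrt a * ((Q : ℝ) ^ (2 * δ) * (Q : ℝ) ^ (δ - 1 / 2)))) := by
          rw [show Real.sqrt a * (16 / δ * (Real.sqrt a * ((Q : ℝ) ^ (2 * δ) *
            (Q : ℝ) ^ (δ - 1 / 2)))) = Real.sqrt a * Real.sqrt a * (16 / δ * ((Q : ℝ) ^ (2 * δ) *
            (Q : ℝ) ^ (δ - 1 / 2))) by ring, hsq]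
          ring
      _ ≤ Real.sqrt a * (16 / δ * (Q * ((Q : ℝ) ^ (2 * δ) * (Q : ℝ) ^ (δ - 1 / 2)))) := by gcongr
      _ = Real.sqrt a * (16 / δ * (Q : ℝ) ^ (1 / 2 + 3 * δ)) := by
          rw [← Real.rpow_add hQpos, mul_comm (Q : ℝ), ← Real.rpow_add_one hQpos.ne']
          congr 3
          ring
      _ = _ := by ring
  set X := ∑ q ∈ Finset.Ioc Q (2 * Q), meanOrder q - ∑ m ∈ Finset.Icc 1 (2 * r), meanOrder m with hX
  set R := C * (4 + 32 / δ) * (Q : ℝ) ^ (1 / 2 + 3 * δ) with hR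
  have hR0 : 0 ≤ R := by positivity
  have h3 : 2 * (Real.sqrt (2 * a + 1 / 2) - Real.sqrt (a + 1 / 2)) * X ≤ Real.sqrt a / 2 * R := by
    refine key.trans ((mul_le_mul_of_nonneg_left (add_le_add h1 h2) hC0).trans (le_of_eq ?_))
    rw [hR]
    ring
  have h4 : X ≤ R := by
    by_contra! h5
    have h6 : 0 < X := hR0.trans_lt h5
    have h7 := mul_le_mul_of_nonneg_right hW h6.le
    have h8 : Real.sqrt a / 2 * R < Real.sqrt a / 2 * X :=
      mul_lt_mul_of_pos_left h5 (by positivity)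
    linarith
  linarith

theorem exists_sum_meanOrder_le {η : ℝ} (hη : 1 / 2 < η) (hG : GRH) (hMM : ModifiedMontgomery η)
    {δ : ℝ} (hδ : 0 < δ) (hδ' : δ ≤ 1 / 2) : ∃ K : ℝ, 0 ≤ K ∧ ∀ N : ℕ,
      ∑ q ∈ Finset.Icc 1 N, meanOrder q ≤ K * (N : ℝ) ^ (1 / 2 + 3 * δ) := by
  obtain ⟨C, hC0, Q₀, hrec⟩ := exists_recursion hη hG hMM hδ hδ'
  set s := 1 / 2 + 3 * δ with hs
  set F : ℕ → ℝ := fun N => ∑ q ∈ Finset.Icc 1 N, meanOrder q with hF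
  have hmono : Monotone F := fun M N hMN => Finset.sum_le_sum_of_subset_of_nonneg
    (Finset.Icc_subset_Icc_right hMN) fun q _ _ => meanOrder_nonneg q
  have hF0 : ∀ N, 0 ≤ F N := fun N => Finset.sum_nonneg fun q _ => meanOrder_nonneg q
  have hsplit : ∀ Q, F (2 * Q) = F Q + ∑ q ∈ Finset.Ioc Q (2 * Q), meanOrder q := by
    intro Q
    have : Finset.Icc 1 (2 * Q) = Finset.Icc 1 Q ∪ Finset.Ioc Q (2 * Q) := by
      ext n
      simp only [Finset.mem_union, Finset.mem_Icc, Finset.mem_Ioc]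
      omega
    simp only [hF]
    rw [this, Finset.sum_union]
    refine Finset.disjoint_left.2 fun n h1 h2 => ?_
    rw [Finset.mem_Icc] at h1
    rw [Finset.mem_Ioc] at h2
    omega
  set N₁ := max (2 * Q₀) 8 with hN₁
  -- `F N₁` covers the initial range. In the inductive step `F N ≤ F Q + F M + C Q^s` with `M = 2 *
  -- (Q / 64)`, `Q^s ≤ (3/4) N^s` and `M^s ≤ (1/5) Q^s` because `s ≥ 1/2`. This uses `(3/4)(1 + 1/5)
  -- = 9/10` of `K N^s`, and `K ≥ 20 C` lets the remaining tenth absorb the `C` term.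
  set K := F N₁ + 20 * C with hK
  have hK0 : 0 ≤ K := by have := hF0 N₁; positivity
  refine ⟨K, hK0, fun N => ?_⟩
  change F N ≤ K * (N : ℝ) ^ s
  induction N using Nat.strong_induction_on with
  | _ N ih =>
    rcases Nat.eq_zero_or_pos N with rfl | hN0
    · simp only [hF]
      simp
      positivity
    have hN1 : (1 : ℝ) ≤ N := by exact_mod_cast hN0
    rcases le_or_gt N N₁ with h | h
    · have h1 : 1 ≤ (N : ℝ) ^ s := Real.one_le_rpow hN1 (by linarith)
      calc F N ≤ F N₁ := hmono h
        _ ≤ K := by linarith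
        _ ≤ _ := le_mul_of_one_le_right hK0 h1
    · have hN8 : 8 < N := (le_max_right _ _).trans_lt h
      have hNQ : 2 * Q₀ < N := (le_max_left _ _).trans_lt h
      -- Rounding up ensures `N ≤ 2Q`; `N > 8` then gives `Q ≤ 9N/16`, whose square root factor is
      -- `3/4`.
      set Q := (N + 1) / 2 with hQ
      have hQN : (Q : ℝ) ≤ 9 / 16 * N := by
        have h1 : 2 * Q ≤ N + 1 := by omega
        have h2 : (2 * Q : ℝ) ≤ N + 1 := by exact_mod_cast h1
        have h3 : (8 : ℝ) ≤ N := by exact_mod_cast hN8.le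
        linarith
      have hQ0 : (0 : ℝ) ≤ Q := Q.cast_nonneg
      have hM : ((2 * (Q / 64) : ℕ) : ℝ) ≤ 1 / 25 * Q := by
        have h1 : 32 * (2 * (Q / 64)) ≤ Q := by omega
        have h2 : (32 : ℝ) * ((2 * (Q / 64) : ℕ) : ℝ) ≤ Q := by exact_mod_cast h1
        linarith
      have hsq : ∀ x : ℝ, 0 < x → x ≤ 1 → (x ^ 2) ^ s ≤ x := by
        intro x hx hx1
        rw [← Real.rpow_natCast, ← Real.rpow_mul hx.le]
        calc x ^ (((2 : ℕ) : ℝ) * s) ≤ x ^ (1 : ℝ) :=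
              Real.rpow_le_rpow_of_exponent_ge hx hx1 (by push_cast; linarith)
          _ = x := Real.rpow_one x
      have hs0 : 0 ≤ s := by positivity
      have hQs : (Q : ℝ) ^ s ≤ 3 / 4 * (N : ℝ) ^ s := by
        refine (Real.rpow_le_rpow hQ0 hQN hs0).trans ?_
        rw [Real.mul_rpow (by norm_num) (by linarith)]
        have := hsq (3 / 4) (by norm_num) (by norm_num)
        norm_num at this
        gcongr
      have hMs : ((2 * (Q / 64) : ℕ) : ℝ) ^ s ≤ 1 / 5 * (Q : ℝ) ^ s := by
        refine (Real.rpow_le_rpow (Nat.cast_nonneg _) hM hs0).trans ?_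
        rw [Real.mul_rpow (by norm_num) hQ0]
        have := hsq (1 / 5) (by norm_num) (by norm_num)
        norm_num at this
        norm_num
        gcongr
      have h1 := ih Q (by omega)
      have h2 := ih (2 * (Q / 64)) (by omega)
      have h3 : F N ≤ F (2 * Q) := hmono (by omega)
      have h4 := hrec Q (by omega)
      have h5 := hsplit Q
      have h6 : 0 ≤ (N : ℝ) ^ s := by positivity
      have h7 := mul_le_mul_of_nonneg_left hQs hK0
      have h8 := mul_le_mul_of_nonneg_left hMs hK0
      have h9 := mul_le_mul_of_nonneg_left hQs hC0
      have h10 : 20 * C * (N : ℝ) ^ s ≤ K * (N : ℝ) ^ s :=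
        mul_le_mul_of_nonneg_right (by linarith [hF0 N₁]) h6
      have h11 : F (2 * (Q / 64)) = ∑ m ∈ Finset.Icc 1 (2 * (Q / 64)), meanOrder m := rfl
      generalize 2 * (Q / 64) = M at h2 h4 h8 h11
      linarith [mul_nonneg hK0 h6]

/-- The principal character mod `q` vanishes at `1/2` to the same order as the level 1 character,
that is, as `ζ`. Being independent of `q`, this order need not be computed. -/
theorem sum_z_eq (q : ℕ) [NeZero q] : ∑ χ : DirichletCharacter ℂ q, (z χ : ℝ) =
    q.totient * meanOrder q + z (1 : DirichletCharacter ℂ 1) := by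
  classical
  have hφ : (q.totient : ℝ) ≠ 0 := by
    exact_mod_cast (Nat.totient_pos.2 (Nat.pos_of_ne_zero (NeZero.ne q))).ne'
  have h1 := z_changeLevel (one_dvd q) (1 : DirichletCharacter ℂ 1)
  rw [map_one] at h1
  rw [meanOrder_eq, mul_inv_cancel_left₀ hφ, ← h1, Finset.filter_ne',
    ← Finset.sum_erase_add Finset.univ _ (Finset.mem_univ (1 : DirichletCharacter ℂ q))]

end Recursion

end DirichletNonvanishing

end

theorem theorem1 (η : ℝ) (hη : 1 / 2 < η) (hη' : η < 1)
    (hGRH : DirichletNonvanishing.GRH) (hMM : DirichletNonvanishing.ModifiedMontgomery η) :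
    ∀ ε : ℝ, 0 < ε → ∃ C : ℝ, ∀ Q : ℝ, 1 ≤ Q →
      1 / Q ^ 2 * ∑ k ∈ Finset.range ⌊Q⌋₊, ∑ χ : DirichletCharacter ℂ (k + 1),
          (DirichletNonvanishing.z χ : ℝ) ≤
        C * (1 / Q ^ (1 / 2 - ε)) := by
  intro ε hε
  -- The mean orders lose `3δ` in the exponent, and the dyadic estimate requires `δ ≤ 1/2`.
  set δ := min (ε / 3) (1 / 2) with hδ
  have hδ0 : 0 < δ := lt_min (by positivity) (by norm_num)
  have hδε : 3 * δ ≤ ε := by linarith [min_le_left (ε / 3) (1 / 2)]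
  obtain ⟨K, hK0, hK⟩ := DirichletNonvanishing.exists_sum_meanOrder_le hη hGRH hMM hδ0
    (min_le_right _ _)
  set z₀ : ℝ := (DirichletNonvanishing.z (1 : DirichletCharacter ℂ 1) : ℝ) with hz₀
  have hz₀0 : 0 ≤ z₀ := Nat.cast_nonneg _
  refine ⟨K + z₀, fun Q hQ => ?_⟩
  have hQ0 : 0 < Q := by linarith
  set N := ⌊Q⌋₊ with hN
  have hNQ : (N : ℝ) ≤ Q := Nat.floor_le hQ0.le
  -- The index `k` stands for the modulus `k + 1`. Undoing the mean costs a factor `φ(k + 1) ≤ Q`,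
  -- and the principal characters add at most `Q z₀`, which is smaller than `Q^(3/2 + ε)`.
  have hsum : ∑ k ∈ Finset.range N, ∑ χ : DirichletCharacter ℂ (k + 1),
      (DirichletNonvanishing.z χ : ℝ) ≤ Q * (K * Q ^ (1 / 2 + 3 * δ)) + Q * z₀ := by
    calc _ = ∑ k ∈ Finset.range N, (((k + 1).totient : ℝ) *
          DirichletNonvanishing.meanOrder (k + 1) + z₀) :=
          Finset.sum_congr rfl fun k _ => DirichletNonvanishing.sum_z_eq (k + 1)
      _ ≤ ∑ k ∈ Finset.range N, (Q * DirichletNonvanishing.meanOrder (k + 1) + z₀) := by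
          refine Finset.sum_le_sum fun k hk => ?_
          have h1 : ((k + 1).totient : ℝ) ≤ Q := by
            refine le_trans ?_ hNQ
            exact_mod_cast (Nat.totient_le _).trans (Finset.mem_range.1 hk)
          have h2 := mul_le_mul_of_nonneg_right h1 (DirichletNonvanishing.meanOrder_nonneg (k + 1))
          linarith
      _ = Q * ∑ q ∈ Finset.Icc 1 N, DirichletNonvanishing.meanOrder q + N * z₀ := by
          rw [Finset.sum_add_distrib, ← Finset.mul_sum, Finset.sum_const, Finset.card_range,
            nsmul_eq_mul, Finset.range_eq_Ico, Finset.sum_Ico_add' _ 0 N 1, zero_add,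
            Finset.Ico_add_one_right_eq_Icc]
      _ ≤ Q * (K * Q ^ (1 / 2 + 3 * δ)) + Q * z₀ := by
          have h1 := hK N
          have h2 : (N : ℝ) ^ (1 / 2 + 3 * δ) ≤ Q ^ (1 / 2 + 3 * δ) :=
            Real.rpow_le_rpow N.cast_nonneg hNQ (by positivity)
          have h3 := h1.trans (mul_le_mul_of_nonneg_left h2 hK0)
          exact add_le_add (mul_le_mul_of_nonneg_left h3 hQ0.le)
            (mul_le_mul_of_nonneg_right hNQ hz₀0)
  have hpow : ∀ t : ℝ, t ≤ 1 / 2 + ε → Q * Q ^ t ≤ Q ^ 2 * (1 / Q ^ (1 / 2 - ε)) := by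
    intro t ht
    rw [one_div, ← Real.rpow_neg hQ0.le, ← Real.rpow_natCast, ← Real.rpow_add hQ0, mul_comm,
      ← Real.rpow_add_one hQ0.ne']
    exact Real.rpow_le_rpow_of_exponent_le hQ (by push_cast; linarith)
  have h1 := mul_le_mul_of_nonneg_left (hpow (1 / 2 + 3 * δ) (by linarith)) hK0
  have h2 := mul_le_mul_of_nonneg_left (hpow 0 (by linarith)) hz₀0
  rw [Real.rpow_zero, mul_one] at h2
  rw [one_div_mul_eq_div, div_le_iff₀ (by positivity)]
  linarith
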